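/- Let $k$ be an algebraically closed field of arbitrary characteristic and let $X$ be an algebraic curve over $k$, i.e. a reduced separated scheme of finite type over $k$ all of whose irreducible components have dimension one (not necessarily affine or irreducible). Let $f:X'\to X$ be the normalization. Let $\mathrm{Jac}(X/k)=\mathrm{Fitt}_1(\Omega_{X/k})$ be the Jacobian ideal of $X$ and $\mathrm{Jac}(X'/X)=\mathrm{Fitt}_0(\Omega_{X'/X})$ the relative Jacobian ideal, and write $$\mathrm{Jac}(X'/X)=\mathcal O_{X'}(-\widehat K_{X'/X}),\qquad \mathrm{Jac}(X/k)\cdot\mathcal O_{X'}=\mathcal O_{X'}(-J_{X'/X})$$ with effective divisors $\widehat K_{X'/X}$, $J_{X'/X}$. For a coherent ideal sheaf $\mathfrak b\subseteq\mathcal O_X$ with $\mathfrak b\cdot\mathcal O_{X'}=\mathcal O_{X'}(-Z)$ and a real number $\lambda\ge 0$, the Mather–Jacobian multiplier ideal is the subsheaf $$\widehat{\mathcal I}(\mathfrak b^{\lambda})=f_*\mathcal O_{X'}\bigl(\widehat K_{X'/X}-J_{X'/X}-\lfloor\lambda Z\rfloor\bigr)$$ of the sheaf of total quotient rings of $X$;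 put $\widehat{\mathcal I}(\mathcal O_X)=f_*\mathcal O_{X'}(\widehat K_{X'/X}-J_{X'/X})$. (If $\mathfrak b$ vanishes identically on a component of $X$, the coefficients of $Z$ there are $\infty$, with $\lambda\cdot\infty=\infty$ for $\lambda>0$ and $0\cdot\infty=0$; so $\widehat{\mathcal I}(\mathfrak b^\lambda)$ vanishes on that component if $\lambda>0$.) Then for every coherent ideal sheaf $\mathfrak a\subseteq\mathcal O_X$ the following are equivalent: 1. there are a coherent ideal sheaf $\mathfrak b\subseteq\mathcal O_X$ and a real number $\lambda\ge0$, both on all of $X$, such that $\mathfrak a=\widehat{\mathcal I}(\mathfrak b^\lambda)$; 2. $\mathfrak a$ is integrally closed and $\mathfrak a\subseteq\widehat{\mathcal I}(\mathcal O_X)$. Moreover, if $\mathfrak a$ vanishes identically on no irreducible component of $X$, then the equivalence also holds with $\mathfrak b$ in 1 required to vanish identically on no irreducible component of $X$ (so that $Z$ is an honest divisor). -/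

import Mathlib

open AlgebraicGeometry CategoryTheory
open scoped NNReal

universe u

namespace MatherJacobian

noncomputable section Algebra

/-- `x` is integral over the ideal `I`: it satisfies an equation
`x ^ n + c₁ x ^ (n - 1) + ⋯ + cₙ = 0` with `cⱼ ∈ I ^ j`. -/
def IsIntegralOverIdeal {R : Type*} [CommRing R] (I : Ideal R) (x : R) : Prop :=
  ∃ p : Polynomial R, p.Monic ∧ p.eval x = 0 ∧
    ∀ i ≤ p.natDegree, p.coeff i ∈ I ^ (p.natDegree - i)

/-- The ideal `I` is integrally closed: it contains every element integral over it. -/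
def IsIntegrallyClosedIdeal {R : Type*} [CommRing R] (I : Ideal R) : Prop :=
  ∀ x : R, IsIntegralOverIdeal I x → x ∈ I

/-- The `i`-th Fitting ideal of a finitely generated `R`-module `M`: the ideal generated by the
`(n - i)`-minors of the matrices of relations among `n` generators of `M` (the unit ideal if
`n ≤ i`). It does not depend on the generators, so we let all finite generating families
contribute. -/
def fittingIdeal (R : Type*) [CommRing R] (M : Type*) [AddCommGroup M] [Module R M] (i : ℕ) :
    Ideal R :=
  Ideal.span {d | ∃ (n : ℕ) (v : Fin n → M) (_ : Submodule.span R (Set.range v) = ⊤)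
    (A : Matrix (Fin (n - i)) (Fin n) R) (_ : ∀ r, ∑ j, A r j • v j = 0)
    (c : Fin (n - i) → Fin n), d = (A.submatrix id c).det}

/-- The Jacobian ideal `Jac(R/k) = Fitt₁(Ω_{R/k})` of a one-dimensional `k`-algebra `R`, whose
structure map is `φ`. -/
def jacobianIdeal {k : Type*} [CommRing k] {R : Type*} [CommRing R] (φ : k →+* R) : Ideal R :=
  letI : Algebra k R := φ.toAlgebra
  fittingIdeal R (Ω[R⁄k]) 1

/-- The coordinate ring of the normalization of `Spec R` (for `R` reduced Noetherian): the integral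
closure of `R` in its total ring of fractions. -/
abbrev NormalizationRing (R : Type*) [CommRing R] : Type _ :=
  ↥(integralClosure R (FractionRing R))

/-- The relative Jacobian ideal `Jac(X'/X) = Fitt₀(Ω_{S/R})` of the normalization
`X' = Spec S ⟶ X = Spec R`. -/
def relativeJacobian (R : Type*) [CommRing R] : Ideal (NormalizationRing R) :=
  fittingIdeal (NormalizationRing R) (Ω[NormalizationRing R⁄R]) 0

/-- The order of vanishing of the ideal `I` at the closed point `P` of a nonsingular affine curve
`Spec S`: the largest `n` with `I ⊆ P ^ n`, and `⊤` if `I` vanishes identically on the component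
through `P`. If `I · 𝒪 = 𝒪(-Z)`, it is the coefficient of `P` in the divisor `Z`. -/
def ordAt {S : Type*} [CommRing S] (P : MaximalSpectrum S) (I : Ideal S) : ℕ∞ :=
  ⨆ (n : ℕ) (_ : I ≤ P.asIdeal ^ n), (n : ℕ∞)

/-- The round down `⌊t z⌋` of a coefficient, where `t · ⊤ = ⊤` for `t > 0` and `0 · ⊤ = 0`. -/
def roundDown (t : ℝ≥0) (z : ℕ∞) : ℕ∞ :=
  if z = ⊤ then (if t = 0 then 0 else ⊤) else ((⌊t * (z.toNat : ℝ≥0)⌋₊ : ℕ) : ℕ∞)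

/-- The sections over `Spec R` of `f_* 𝒪_{X'}(D₁ - D₂)`, where `f : X' = Spec S ⟶ Spec R` is the
normalization and `D₁`, `D₂` are effective: the rational functions `g` such that
`ord_P g ≥ D₂(P) - D₁(P)` at every closed point `P` of `X'`. The inequality is written as
`g · P ^ m ⊆ P ^ n · S_P` for all naturals `m ≥ D₁(P)` and `n ≤ D₂(P)`. If `D₂(P) = ⊤ ≠ D₁(P)`
it says that `g` vanishes on the component through `P`. -/
def divisorSections (R : Type*) [CommRing R]
    (D₁ D₂ : MaximalSpectrum (NormalizationRing R) → ℕ∞) :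
    Submodule R (FractionRing R) where
  carrier := {g | ∀ (P : MaximalSpectrum (NormalizationRing R)) (m n : ℕ),
    D₁ P ≤ m → (n : ℕ∞) ≤ D₂ P → ∀ x ∈ P.asIdeal ^ m,
      ∃ s ∉ P.asIdeal, ∃ y ∈ P.asIdeal ^ n,
        (s : FractionRing R) * g * (x : FractionRing R) = (y : FractionRing R)}
  zero_mem' P m n _ _ x _ :=
    ⟨1, fun h => P.isMaximal.ne_top ((Ideal.eq_top_iff_one _).2 h), 0, zero_mem _, by simp⟩
  add_mem' := by
    intro a b ha hb P m n hm hn x hx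
    obtain ⟨s, hs, y, hy, h⟩ := ha P m n hm hn x hx
    obtain ⟨s', hs', y', hy', h'⟩ := hb P m n hm hn x hx
    refine ⟨s * s', fun hss => (P.isMaximal.isPrime.mem_or_mem hss).elim hs hs',
      s' * y + s * y', add_mem (Ideal.mul_mem_left _ _ hy) (Ideal.mul_mem_left _ _ hy'), ?_⟩
    push_cast
    rw [← h, ← h']
    ring
  smul_mem' := by
    intro r a ha P m n hm hn x hx
    obtain ⟨s, hs, y, hy, h⟩ := ha P m n hm hn x hx
    refine ⟨s, hs, r • y, ?_, ?_⟩
    · rw [Algebra.smul_def]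
      exact Ideal.mul_mem_left _ _ hy
    · rw [Subalgebra.coe_smul, ← h, mul_smul_comm, smul_mul_assoc]

/-- The Mather–Jacobian multiplier ideal `f_* 𝒪_{X'}(K̂ - J - ⌊t Z⌋)` of the ideal `b` with exponent
`t` on the affine curve `Spec R`, as an `R`-submodule of the total ring of fractions of `R`. Here
`Jac(X'/X) = 𝒪_{X'}(-K̂)`, `Jac(X/k) · 𝒪_{X'} = 𝒪_{X'}(-J)` and `b · 𝒪_{X'} = 𝒪_{X'}(-Z)`. -/
def mjMultiplier {k : Type*} [CommRing k] {R : Type*} [CommRing R] (φ : k →+* R)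
    (b : Ideal R) (t : ℝ≥0) : Submodule R (FractionRing R) :=
  divisorSections R
    (fun P => ordAt P (relativeJacobian R))
    (fun P => ordAt P ((jacobianIdeal φ).map (algebraMap R (NormalizationRing R))) +
      roundDown t (ordAt P (b.map (algebraMap R (NormalizationRing R)))))

end Algebra

section Curve

/-- An algebraic curve over `k`: a reduced separated scheme of finite type over `k`, all of whose
irreducible components have dimension one. -/
structure IsAlgebraicCurve {k : Type u} [Field k] {X : Scheme.{u}}
    (p : X ⟶ Spec (CommRingCat.of k)) : Prop where
  isReduced : IsReduced X
  isSeparated : IsSeparated p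
  locallyOfFiniteType : LocallyOfFiniteType p
  quasiCompact : QuasiCompact p
  equidimensional : ∀ Z ∈ irreducibleComponents X, topologicalKrullDim Z = 1

/-- The structure map `k ⟶ Γ(X, U)` of a `k`-scheme `X`. -/
noncomputable def structureMap {k : Type u} [Field k] {X : Scheme.{u}}
    (p : X ⟶ Spec (CommRingCat.of k)) (U : X.Opens) : k →+* Γ(X, U) :=
  ((Scheme.ΓSpecIso (CommRingCat.of k)).inv ≫ p.appLE ⊤ U le_top).hom

/-- The ideal sheaf is integrally closed. -/
def IsIntegrallyClosedSheaf {X : Scheme.{u}} (a : X.IdealSheafData) : Prop :=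
  ∀ U : X.affineOpens, IsIntegrallyClosedIdeal (a.ideal U)

/-- The ideal sheaf vanishes identically on no irreducible component of the (reduced, Noetherian)
scheme `X`: over every affine open it contains a non-zero-divisor. -/
def IsNowhereZero {X : Scheme.{u}} (a : X.IdealSheafData) : Prop :=
  ∀ U : X.affineOpens, ∃ x ∈ a.ideal U, x ∈ nonZeroDivisors Γ(X, U)

/-- The ideal sheaf `a` is the Mather–Jacobian multiplier ideal `Î(b ^ t)`: both are the same
subsheaf of the sheaf of total quotient rings. -/
def IsMJMultiplierOf {k : Type u} [Field k] {X : Scheme.{u}} (p : X ⟶ Spec (CommRingCat.of k))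
    (a b : X.IdealSheafData) (t : ℝ≥0) : Prop :=
  ∀ U : X.affineOpens,
    IsLocalization.coeSubmodule (FractionRing Γ(X, U)) (a.ideal U) =
      mjMultiplier (structureMap p U) (b.ideal U) t

/-- `a ⊆ Î(𝒪_X)`, where `Î(𝒪_X)` is the Mather–Jacobian multiplier ideal of the unit ideal. -/
def LeMJMultiplierOfUnit {k : Type u} [Field k] {X : Scheme.{u}}
    (p : X ⟶ Spec (CommRingCat.of k)) (a : X.IdealSheafData) : Prop :=
  ∀ U : X.affineOpens,
    IsLocalization.coeSubmodule (FractionRing Γ(X, U)) (a.ideal U) ≤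
      mjMultiplier (structureMap p U) ((⊤ : X.IdealSheafData).ideal U) 1

end Curve

end MatherJacobian

/-! Over an affine piece `Spec R` let `S` be the normalization ring, `F = Fitt₀(Ω_{S/R})`, `J =
Fitt₁(Ω_{R/k})` and `c` the conductor of `S` over `R`. Localizing `S` at maximal ideals gives
discrete valuation rings, so ideals of `S` that vanish at no point behave like divisors.

Condition 1 implies 2 because membership in `Î(b^λ)` is a condition on valuations, inherited by
elements integral over `a`, and because `⌊λZ⌋ ≥ 0`.

For the converse the essential fact is `Î(𝒪_X) ⊆ 𝒪_X`
(`IsCurveRing.exists_algebraMap_eq_of_forall_mul_mem`). As `Î(𝒪_X)` is an `S`-module, `aS ⊆ Î(𝒪_X) ⊆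
R`. Elements of `aS ∩ R` are integral over `a` by Cayley–Hamilton, so `aS = a` when `a` is
integrally closed. Write `aS = 𝒪(-A)` and `E = A + K̂ - J ≥ 0`; it remains to realize `E` as `⌊λZ⌋`.
Let `C` be the divisor of `c` and let `N` exceed all coefficients of `C`. The ideal `𝒪(-C - NE)`
lies in the conductor, hence is an ideal `b` of `R` with `bS = b`, and `⌊(C + NE)/N⌋ = E`. So `λ =
1/N` works (`coeSubmodule_eq_mjMultiplier_rootIdeal`). One `N` serves all of `X`, and `b` commutes
with localization, so it is a coherent sheaf.

The inclusion `Î(𝒪_X) ⊆ 𝒪_X` rests on the Noether different. Choose generators `y_j` of `R` with `R`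
integral over each `k[y_j]`. A Jacobian minor omitting the column of `y = y_j` is `μ(z)` for some `z
∈ R ⊗ R`, over `A = k[y]`, that is killed by the ideal of the diagonal (`μ` is multiplication). An
`S`-linear `h : Hom_A(S, A) → S` is contraction with such an element `m ∈ S ⊗ S`. Computing `mz` in
two ways and contracting with `φ` gives `μ(z) h(φ) = μ(m) φ(z)`, where `φ` acts on the left factor.
Now `μ(m)` kills `Ω_{S/A}`, hence `Ω_{S/R}`, hence lies in `F`, as `Ω_{S/R}` is locally cyclic. If
`eF ⊆ S`, then `e μ(m) ∈ S` can be moved through `z` into `φ`, so `e μ(z) h(φ) ∈ R`. Near a given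
point `h(φ)` can be made a unit. No trace is used, so inseparable projections do no harm. -/

namespace MatherJacobian

/-! ### Fitting ideals do not depend on the generators. -/

section Fitting

variable {R : Type*} [CommRing R] {M : Type*} [AddCommGroup M] [Module R M]

/-- The ideal generated by the `q`-minors of the matrices of relations among the elements of the
family `v`. -/
def minorIdeal {ι : Type*} [Fintype ι] (v : ι → M) (q : ℕ) : Ideal R :=
  Ideal.span {d | ∃ (A : Matrix (Fin q) ι R) (_ : ∀ r, ∑ j, A r j • v j = 0) (c : Fin q → ι),
    d = (A.submatrix id c).det}

theorem det_mem_minorIdeal {ι : Type*} [Fintype ι] {v : ι → M} {q : ℕ} (A : Matrix (Fin q) ι R)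
    (hA : ∀ r, ∑ j, A r j • v j = 0) (c : Fin q → ι) :
    (A.submatrix id c).det ∈ minorIdeal (R := R) v q :=
  Ideal.subset_span ⟨A, hA, c, rfl⟩

theorem minorIdeal_zero {ι : Type*} [Fintype ι] (v : ι → M) : minorIdeal (R := R) v 0 = ⊤ := by
  rw [Ideal.eq_top_iff_one]
  refine Ideal.subset_span ⟨0, by simp, Fin.elim0, by simp⟩

theorem minorIdeal_comp_le {ι κ : Type*} [Fintype ι] [Fintype κ] (v : ι → M) (e : κ ≃ ι) (q : ℕ) :
    minorIdeal (R := R) v q ≤ minorIdeal (v ∘ e) q := by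
  refine Ideal.span_le.2 ?_
  rintro _ ⟨A, hA, c, rfl⟩
  have := det_mem_minorIdeal (v := v ∘ e) (A.submatrix id e)
    (fun r => (e.sum_comp (fun j => A r j • v j)).trans (hA r)) (e.symm ∘ c)
  simpa [Matrix.submatrix_submatrix, Function.comp_def] using this

theorem minorIdeal_comp {ι κ : Type*} [Fintype ι] [Fintype κ] (v : ι → M) (e : κ ≃ ι) (q : ℕ) :
    minorIdeal (R := R) (v ∘ e) q = minorIdeal v q := by
  refine le_antisymm ?_ (minorIdeal_comp_le v e q)
  have := minorIdeal_comp_le (R := R) (v ∘ e) e.symm q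
  simpa [Function.comp_def] using this

/-- The index `none` stands for a zero column, which is what remains of the column of a redundant
generator. -/
theorem det_elim_mem_minorIdeal {ι : Type*} [Fintype ι] {v : ι → M} {q : ℕ}
    (A : Matrix (Fin q) ι R) (hA : ∀ r, ∑ j, A r j • v j = 0) (c : Fin q → Option ι) :
    (Matrix.of fun r s => (c s).elim 0 (A r)).det ∈ minorIdeal (R := R) v q := by
  by_cases h : ∃ s, c s = none
  · obtain ⟨s, hs⟩ := h
    rw [Matrix.det_eq_zero_of_column_eq_zero s (by simp [hs])]
    exact zero_mem _
  · have h' : ∀ s, ∃ j, c s = some j := fun s => by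
      cases hs : c s with
      | none => exact absurd ⟨s, hs⟩ h
      | some j => exact ⟨j, rfl⟩
    choose d hd using h'
    convert det_mem_minorIdeal A hA d using 2
    ext r s
    simp [hd]

theorem det_mem_minorIdeal_of_succ_rows {ι : Type*} [Fintype ι] {v : ι → M} {q : ℕ}
    (A : Matrix (Fin q) ι R) (hA : ∀ r, ∑ j, A r j • v j = 0) (c : Fin (q + 1) → Option ι)
    (N : Matrix (Fin (q + 1)) (Fin (q + 1)) R) (hN : ∀ r s, N r.succ s = (c s).elim 0 (A r)) :
    N.det ∈ minorIdeal (R := R) v q := by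
  rw [Matrix.det_succ_row_zero]
  refine Ideal.sum_mem _ fun s _ => Ideal.mul_mem_left _ _ ?_
  convert det_elim_mem_minorIdeal A hA (c ∘ s.succAbove) using 2
  ext r t
  simp [hN]

/-- Bordering: clearing the first column of `[[1, -b], [a, A_c]]` leaves the perturbed matrix, so
the determinants agree. Expanding the bordered matrix along its first column and then along first
rows leaves only `q`-minors of `A`. -/
theorem det_add_vecMulVec_mem_minorIdeal {ι : Type*} [Fintype ι] {v : ι → M} {q : ℕ}
    (A : Matrix (Fin (q + 1)) ι R) (hA : ∀ r, ∑ j, A r j • v j = 0) (c : Fin (q + 1) → Option ι)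
    (a b : Fin (q + 1) → R) :
    (Matrix.of fun r s => (c s).elim 0 (A r) + a r * b s).det ∈ minorIdeal (R := R) v q := by
  set B : Matrix (Fin (q + 1)) (Fin (q + 1)) R :=
    Matrix.of fun r s => (c s).elim 0 (A r) + a r * b s with hB
  let N : Matrix (Fin (q + 2)) (Fin (q + 2)) R :=
    Matrix.of (Fin.cons (Fin.cons 1 (-b)) fun r => Fin.cons (a r) fun s => (c s).elim 0 (A r))
  let B' : Matrix (Fin (q + 2)) (Fin (q + 2)) R :=
    Matrix.of (Fin.cons (Fin.cons 1 (-b)) fun r => Fin.cons 0 (B r))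
  have h1 : N.det = B'.det := by
    refine Matrix.det_eq_of_forall_row_eq_smul_add_const (Fin.cons 0 a) 0 rfl fun i j => ?_
    refine Fin.cases ?_ (fun r => ?_) i
    · simp [N, B']
    · refine Fin.cases ?_ (fun s => ?_) j
      · simp [N, B']
      · simp [N, B', B]
  have h2 : B'.det = B.det := by
    rw [Matrix.det_succ_column_zero, Fin.sum_univ_succ]
    have : B'.submatrix (Fin.succAbove 0) Fin.succ = B := by
      ext r s; simp [B']
    rw [this]
    simp [B']
  rw [← h2, ← h1, Matrix.det_succ_column_zero]
  refine Ideal.sum_mem _ fun i _ => Ideal.mul_mem_left _ _ ?_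
  refine Fin.cases ?_ (fun r => ?_) i
  · refine det_mem_minorIdeal_of_succ_rows (A.submatrix Fin.succ id) (fun r => hA _) c _ ?_
    intro r s
    simp only [N, Matrix.submatrix_apply, Matrix.of_apply, Fin.succAbove_zero, Fin.cons_succ]
    rfl
  · refine det_mem_minorIdeal_of_succ_rows (A.submatrix r.succAbove id) (fun r => hA _) c _ ?_
    intro r' s
    simp only [N, Matrix.submatrix_apply, Matrix.of_apply, Fin.succ_succAbove_succ, Fin.cons_succ]
    rfl

/-- Substituting `w = ∑ b j • v j` turns relations on the larger family into relations on `v` and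
minors into rank one perturbations. Conversely the relation expressing `w` borders a given matrix.
-/
theorem minorIdeal_option_elim {ι : Type*} [Fintype ι] (v : ι → M) (w : M)
    (hw : w ∈ Submodule.span R (Set.range v)) (q : ℕ) :
    minorIdeal (R := R) (fun o : Option ι => o.elim w v) (q + 1) = minorIdeal v q := by
  obtain ⟨b, hb⟩ := (Submodule.mem_span_range_iff_exists_fun R).1 hw
  apply le_antisymm
  · refine Ideal.span_le.2 ?_
    rintro _ ⟨A, hA, c, rfl⟩
    have hrel : ∀ r, ∑ j, (A r (some j) + A r none * b j) • v j = 0 := fun r => by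
      have := hA r
      rw [Fintype.sum_option] at this
      simp only [Option.elim_none, Option.elim_some] at this
      simp only [add_smul, Finset.sum_add_distrib, mul_smul, ← Finset.smul_sum, hb]
      rw [add_comm]; exact this
    have := det_add_vecMulVec_mem_minorIdeal
      (Matrix.of fun r j => A r (some j) + A r none * b j) hrel c (fun r => A r none)
      (fun s => (c s).elim 1 (-b))
    refine (congrArg (· ∈ minorIdeal (R := R) v q) (congrArg Matrix.det ?_)).mpr this
    ext r s
    cases hs : c s <;> simp [hs]
  · refine Ideal.span_le.2 ?_
    rintro _ ⟨A, hA, c, rfl⟩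
    let A' : Matrix (Fin (q + 1)) (Option ι) R :=
      Matrix.of (Fin.cons (fun o => o.elim 1 (-b)) fun r o => o.elim 0 (A r))
    have hA' : ∀ r, ∑ j, A' r j • (j.elim w v : M) = 0 := by
      intro r
      rw [Fintype.sum_option]
      refine Fin.cases ?_ (fun r => ?_) r
      · simp [A', ← hb]
      · simpa [A'] using hA r
    -- The column of `w` is `(1, 0, …, 0)`, so expanding along it recovers the given minor.
    have := det_mem_minorIdeal A' hA' (Fin.cons none fun s => some (c s))
    convert this using 1
    rw [Matrix.det_succ_column_zero, Fin.sum_univ_succ]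
    have h : (A'.submatrix id (Fin.cons none fun s => some (c s))).submatrix
        (Fin.succAbove 0) Fin.succ = A.submatrix id c := by
      ext r s; simp [A']
    rw [h]
    simp [A']

theorem minorIdeal_sumElim {ι : Type*} [Fintype ι] (v : ι → M) (m : ℕ) (w : Fin m → M)
    (hw : ∀ i, w i ∈ Submodule.span R (Set.range v)) (q : ℕ) :
    minorIdeal (R := R) (Sum.elim v w) (q + m) = minorIdeal v q := by
  induction m with
  | zero =>
    rw [← minorIdeal_comp v (Equiv.sumEmpty ι (Fin 0))]
    congr 1
    ext i
    rcases i with i | i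
    · rfl
    · exact i.elim0
  | succ m ih =>
    rw [← ih (fun i => w i.succ) fun i => hw _, ← add_assoc,
      ← minorIdeal_option_elim (Sum.elim v fun i : Fin m => w i.succ) (w 0)
        (Submodule.span_mono (by rintro _ ⟨i, rfl⟩; exact ⟨Sum.inl i, rfl⟩) (hw 0))]
    let e : Option (ι ⊕ Fin m) ≃ ι ⊕ Fin (m + 1) :=
      { toFun := fun o => o.elim (Sum.inr 0) (Sum.map id Fin.succ)
        invFun := Sum.elim (fun i => some (Sum.inl i))
          (Fin.cases none fun i => some (Sum.inr i))
        left_inv := by rintro (_ | _ | _) <;> simp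
        right_inv := by
          rintro (i | i)
          · simp
          · refine Fin.cases ?_ (fun i => ?_) i <;> simp }
    rw [← minorIdeal_comp _ e]
    congr 1
    ext (_ | _ | _) <;> rfl

theorem minorIdeal_succ_le {ι : Type*} [Fintype ι] (v : ι → M) (q : ℕ) :
    minorIdeal (R := R) v (q + 1) ≤ minorIdeal v q := by
  refine Ideal.span_le.2 ?_
  rintro _ ⟨A, hA, c, rfl⟩
  exact det_mem_minorIdeal_of_succ_rows (A.submatrix Fin.succ id) (fun r => hA _)
    (fun s => some (c s)) _ fun r s => rfl

theorem minorIdeal_antitone {ι : Type*} [Fintype ι] (v : ι → M) :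
    Antitone (minorIdeal (R := R) v) :=
  antitone_nat_of_succ_le (minorIdeal_succ_le v)

theorem minorIdeal_le_of_span_eq_top {m n : ℕ} (v : Fin m → M) (w : Fin n → M)
    (hv : Submodule.span R (Set.range v) = ⊤) (hw : Submodule.span R (Set.range w) = ⊤) (i : ℕ) :
    minorIdeal (R := R) w (n - i) ≤ minorIdeal v (m - i) := by
  rw [← minorIdeal_sumElim v n w (by simp [hv]), ← minorIdeal_sumElim w m v (by simp [hw]),
    ← minorIdeal_comp (Sum.elim v w) (Equiv.sumComm _ _)]
  have h : Sum.elim v w ∘ (Equiv.sumComm (Fin n) (Fin m)) = Sum.elim w v := by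
    ext (_ | _) <;> rfl
  rw [h]
  rcases le_or_gt i m with him | him
  · exact minorIdeal_antitone _ (by omega)
  -- Here `m - i` is truncated and the sizes of minors need not compare, but the ideal of `0`-minors
  -- is the unit ideal.
  · have h0 : minorIdeal (R := R) (Sum.elim w v) (m - i + n) = ⊤ := by
      rw [← h, minorIdeal_comp, minorIdeal_sumElim v n w (by simp [hv]),
        Nat.sub_eq_zero_of_le him.le, minorIdeal_zero]
    rw [h0]
    exact le_top

/-- The Fitting ideal can be computed with any finite generating family. -/
theorem fittingIdeal_eq_minorIdeal {n : ℕ} (v : Fin n → M)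
    (hv : Submodule.span R (Set.range v) = ⊤) (i : ℕ) :
    fittingIdeal R M i = minorIdeal v (n - i) := by
  apply le_antisymm
  · refine Ideal.span_le.2 ?_
    rintro _ ⟨m, w, hw, A, hA, c, rfl⟩
    exact minorIdeal_le_of_span_eq_top v w hv hw i (det_mem_minorIdeal A hA c)
  · refine Ideal.span_le.2 ?_
    rintro _ ⟨A, hA, c, rfl⟩
    exact Ideal.subset_span ⟨n, v, hv, A, hA, c, rfl⟩

end Fitting

/-! ### Fitting ideals commute with localization. -/

section FittingLocalization

variable {R R' : Type*} [CommRing R] [CommRing R'] [Algebra R R']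
  {M M' : Type*} [AddCommGroup M] [Module R M] [AddCommGroup M']
  [Module R M'] [Module R' M'] [IsScalarTower R R' M']

/-- A denominator `t` makes the entries integral; a further factor `U` is needed because the cleared
relations hold in `M` only up to `T`. Both scale the minor by a unit of `R'`. -/
theorem map_minorIdeal (T : Submonoid R) [IsLocalization T R'] (f : M →ₗ[R] M')
    [IsLocalizedModule T f] {n : ℕ} (v : Fin n → M) (q : ℕ) :
    (minorIdeal (R := R) v q).map (algebraMap R R') = minorIdeal (f ∘ v) q := by
  apply le_antisymm
  · refine Ideal.map_le_iff_le_comap.2 (Ideal.span_le.2 ?_)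
    rintro _ ⟨A, hA, c, rfl⟩
    have := det_mem_minorIdeal (R := R') (v := f ∘ v) (A.map (algebraMap R R')) (fun r => by
      have := congrArg f (hA r)
      simpa using this) c
    rw [Matrix.submatrix_map] at this
    rwa [SetLike.mem_coe, Ideal.mem_comap, RingHom.map_det]
  · refine Ideal.span_le.2 ?_
    rintro _ ⟨A, hA, c, rfl⟩
    obtain ⟨t, ht⟩ := IsLocalization.exist_integer_multiples_of_finite T
      (fun p : Fin q × Fin n => A p.1 p.2)
    choose B' hB' using ht
    let B : Fin q → Fin n → R := fun r j => B' (r, j)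
    have hB : ∀ r j, algebraMap R R' (B r j) = (t : R) • A r j := fun r j => hB' (r, j)
    have hrel : ∀ r, ∃ u : T, u • (∑ j, B r j • v j) = 0 := by
      intro r
      refine (IsLocalizedModule.eq_zero_iff T f).1 ?_
      have h := congrArg (fun x => t • x) (hA r)
      simp only [smul_zero, Finset.smul_sum] at h
      rw [map_sum, ← h]
      refine Finset.sum_congr rfl fun j _ => ?_
      rw [map_smul, ← algebraMap_smul R', hB, Submonoid.smul_def, smul_assoc]
      rfl
    choose u hu using hrel
    let U : T := ∏ r, u r
    have hU : ∀ r, (U : R) • (∑ j, B r j • v j) = 0 := fun r => by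
      obtain ⟨w, hw⟩ : u r ∣ U := Finset.dvd_prod_of_mem u (Finset.mem_univ r)
      rw [hw, mul_comm, Submonoid.coe_mul, mul_smul]
      have := hu r
      rw [Submonoid.smul_def] at this
      rw [this, smul_zero]
    have hmem := det_mem_minorIdeal (v := v) (Matrix.of fun r j => (U : R) * B r j)
      (fun r => by simpa [mul_smul, Finset.smul_sum] using hU r) c
    have heq : algebraMap R R' ((Matrix.of fun r j => (U : R) * B r j).submatrix id c).det =
        algebraMap R R' ((U * t : T) : R) ^ q * (A.submatrix id c).det := by
      have h := Matrix.det_smul (A.submatrix id c) (algebraMap R R' ((U * t : T) : R))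
      rw [Fintype.card_fin] at h
      rw [RingHom.map_det, ← h]
      congr 1
      ext r s
      simp [hB, Algebra.smul_def, mul_assoc]
    have hunit := (IsLocalization.map_units R' (U * t)).pow q
    refine (Ideal.unit_mul_mem_iff_mem _ hunit).1 ?_
    rw [← heq]
    exact Ideal.mem_map_of_mem _ hmem

theorem map_fittingIdeal (T : Submonoid R) [IsLocalization T R'] (f : M →ₗ[R] M')
    [IsLocalizedModule T f] [Module.Finite R M] (i : ℕ) :
    (fittingIdeal R M i).map (algebraMap R R') = fittingIdeal R' M' i := by
  obtain ⟨n, v, hv⟩ := Module.Finite.exists_fin (R := R) (M := M)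
  have hv' : Submodule.span R' (Set.range (f ∘ v)) = ⊤ := by
    rw [Set.range_comp]
    exact span_eq_top_of_isLocalizedModule R' T f hv
  rw [fittingIdeal_eq_minorIdeal v hv, fittingIdeal_eq_minorIdeal _ hv', map_minorIdeal T f]

end FittingLocalization

/-! ### The Noether different and contraction. -/

section NoetherDifferent

open scoped TensorProduct

variable {A : Type*} [CommRing A]

/-- The elements of `S ⊗ S` that are killed by the ideal of the diagonal. -/
def IsDiagonal {S : Type*} [CommRing S] [Algebra A S] (z : S ⊗[A] S) : Prop :=
  ∀ s : S, (s ⊗ₜ[A] (1 : S)) * z = ((1 : S) ⊗ₜ[A] s) * z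

section One

variable {S : Type*} [CommRing S] [Algebra A S]

theorem IsDiagonal.mul_eq {z : S ⊗[A] S} (hz : IsDiagonal z) (y : S ⊗[A] S) :
    y * z = ((1 : S) ⊗ₜ[A] Algebra.TensorProduct.lmul' A y) * z := by
  induction y with
  | zero => simp
  | add x y hx hy => rw [add_mul, hx, hy, map_add, TensorProduct.tmul_add, add_mul]
  | tmul a b =>
    have h1 : a ⊗ₜ[A] b = ((1 : S) ⊗ₜ[A] b) * (a ⊗ₜ[A] (1 : S)) := by simp
    have h2 : (1 : S) ⊗ₜ[A] (a * b) = ((1 : S) ⊗ₜ[A] b) * ((1 : S) ⊗ₜ[A] a) := by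
      simp [mul_comm]
    rw [Algebra.TensorProduct.lmul'_apply_tmul, h1, h2, mul_assoc, hz a, mul_assoc]

/-- Both sides equal `z * y`. This exchange drives the inclusion of `Î(𝒪_X)` in `𝒪_X`. -/
theorem IsDiagonal.one_tmul_mul_comm {z y : S ⊗[A] S} (hz : IsDiagonal z) (hy : IsDiagonal y) :
    ((1 : S) ⊗ₜ[A] Algebra.TensorProduct.lmul' A y) * z =
      ((1 : S) ⊗ₜ[A] Algebra.TensorProduct.lmul' A z) * y := by
  rw [← hz.mul_eq, ← hy.mul_eq, mul_comm]

theorem isDiagonal_iff_of_adjoin {s : Set S} (hs : Algebra.adjoin A s = ⊤) {z : S ⊗[A] S}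
    (h : ∀ x ∈ s, (x ⊗ₜ[A] (1 : S)) * z = ((1 : S) ⊗ₜ[A] x) * z) : IsDiagonal z := by
  intro x
  have hx : x ∈ Algebra.adjoin A s := hs ▸ Algebra.mem_top
  induction hx using Algebra.adjoin_induction with
  | mem x hx => exact h x hx
  | algebraMap r =>
    rw [Algebra.algebraMap_eq_smul_one, TensorProduct.smul_tmul]
  | add x y _ _ hx hy => rw [TensorProduct.add_tmul, TensorProduct.tmul_add, add_mul, add_mul, hx, hy]
  | mul x y _ _ hx hy =>
    have h1 : (x * y) ⊗ₜ[A] (1 : S) = (x ⊗ₜ[A] (1 : S)) * (y ⊗ₜ[A] (1 : S)) := by simp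
    have h2 : (1 : S) ⊗ₜ[A] (x * y) = ((1 : S) ⊗ₜ[A] y) * ((1 : S) ⊗ₜ[A] x) := by
      simp [mul_comm]
    rw [h1, h2, mul_assoc, hy, mul_assoc, ← hx]
    ring

theorem ideal_eq_span_of_adjoin {ι : Type*} (l : ι → S)
    (hl : Algebra.adjoin A (Set.range l) = ⊤) :
    KaehlerDifferential.ideal A S =
      Ideal.span (Set.range fun j => (1 : S) ⊗ₜ[A] l j - l j ⊗ₜ[A] (1 : S)) := by
  apply le_antisymm
  · rw [← KaehlerDifferential.span_range_eq_ideal, Ideal.span_le]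
    rintro _ ⟨x, rfl⟩
    have hx : x ∈ Algebra.adjoin A (Set.range l) := hl ▸ Algebra.mem_top
    change (1 : S) ⊗ₜ[A] x - x ⊗ₜ[A] (1 : S) ∈ _
    induction hx using Algebra.adjoin_induction with
    | mem x hx =>
      obtain ⟨j, rfl⟩ := hx
      exact Ideal.subset_span ⟨j, rfl⟩
    | algebraMap r =>
      rw [Algebra.algebraMap_eq_smul_one, TensorProduct.smul_tmul, sub_self]
      exact zero_mem _
    | add x y _ _ hx hy =>
      rw [TensorProduct.add_tmul, TensorProduct.tmul_add, add_sub_add_comm]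
      exact add_mem hx hy
    | mul x y _ _ hx hy =>
      have : (1 : S) ⊗ₜ[A] (x * y) - (x * y) ⊗ₜ[A] (1 : S) =
          ((1 : S) ⊗ₜ[A] y) * ((1 : S) ⊗ₜ[A] x - x ⊗ₜ[A] (1 : S)) +
            (x ⊗ₜ[A] (1 : S)) * ((1 : S) ⊗ₜ[A] y - y ⊗ₜ[A] (1 : S)) := by
        simp only [mul_sub, Algebra.TensorProduct.tmul_mul_tmul, one_mul, mul_one, mul_comm y x]
        abel
      rw [this]
      exact add_mem (Ideal.mul_mem_left _ _ hx) (Ideal.mul_mem_left _ _ hy)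
  · rw [Ideal.span_le]
    rintro _ ⟨j, rfl⟩
    exact KaehlerDifferential.one_smul_sub_smul_one_mem_ideal _ _

/-- With `I` the ideal of the diagonal, `d ⊗ 1 - z` lies in `I` and `z` kills `I`, so `d ⊗ 1`
multiplies `I` into `I ^ 2`. -/
theorem smul_D_eq_zero_of_isDiagonal {z : S ⊗[A] S} (hz : IsDiagonal z) (x : S) :
    Algebra.TensorProduct.lmul' A z • KaehlerDifferential.D A S x = 0 := by
  set d := Algebra.TensorProduct.lmul' A z with hd
  let w : KaehlerDifferential.ideal A S :=
    ⟨(1 : S) ⊗ₜ[A] x - x ⊗ₜ[A] (1 : S), KaehlerDifferential.one_smul_sub_smul_one_mem_ideal A x⟩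
  have h1 : d • KaehlerDifferential.D A S x =
      KaehlerDifferential.fromIdeal A S ((d ⊗ₜ[A] (1 : S)) • w) := by
    rw [map_smul, ← algebraMap_smul (S ⊗[A] S) d]
    rfl
  rw [h1]
  refine (Ideal.toCotangent_eq_zero _ _).2 ?_
  have h2 : z * w.1 = 0 := by
    rw [mul_comm]
    change ((1 : S) ⊗ₜ[A] x - x ⊗ₜ[A] (1 : S)) * z = 0
    rw [sub_mul, hz x, sub_self]
  have h3 : (((d ⊗ₜ[A] (1 : S)) • w : KaehlerDifferential.ideal A S) : S ⊗[A] S) =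
      (d ⊗ₜ[A] (1 : S) - z) * w.1 := by
    rw [sub_mul, h2, sub_zero]; rfl
  rw [h3, pow_two]
  refine Ideal.mul_mem_mul ?_ w.2
  rw [RingHom.mem_ker, map_sub]
  simp [hd]

/-- A relation among the differentials puts a combination of the differences `X j` into `I ^ 2`. As
the `X j` generate `I`, correcting the coefficients by elements of `I` makes the combination vanish.
By Cramer's rule the determinant of the corrected matrix kills every `X j`, and multiplication `S ⊗
S → S` does not see the correction. -/
theorem exists_isDiagonal_of_relations {m : ℕ} (l : Fin m → S)
    (hl : Algebra.adjoin A (Set.range l) = ⊤) (B : Matrix (Fin m) (Fin m) S)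
    (hB : ∀ r, ∑ j, B r j • KaehlerDifferential.D A S (l j) = 0) :
    ∃ z : S ⊗[A] S, IsDiagonal z ∧ Algebra.TensorProduct.lmul' A z = B.det := by
  let X : Fin m → S ⊗[A] S := fun j => (1 : S) ⊗ₜ[A] l j - l j ⊗ₜ[A] (1 : S)
  have hX : KaehlerDifferential.ideal A S = Ideal.span (Set.range X) :=
    ideal_eq_span_of_adjoin l hl
  have hXm : ∀ j, X j ∈ KaehlerDifferential.ideal A S := fun j =>
    KaehlerDifferential.one_smul_sub_smul_one_mem_ideal A (l j)
  have hrow : ∀ r, ∃ η : Fin m → S ⊗[A] S, (∀ j, η j ∈ KaehlerDifferential.ideal A S) ∧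
      ∑ j, η j * X j = ∑ j, (B r j ⊗ₜ[A] (1 : S)) * X j := by
    intro r
    have h1 : KaehlerDifferential.fromIdeal A S
        (∑ j, (B r j ⊗ₜ[A] (1 : S)) • (⟨X j, hXm j⟩ : KaehlerDifferential.ideal A S)) = 0 := by
      rw [← hB r, map_sum]
      refine Finset.sum_congr rfl fun j _ => ?_
      rw [map_smul, ← algebraMap_smul (S ⊗[A] S) (B r j)]
      rfl
    have h2 := (Ideal.toCotangent_eq_zero _ _).1 h1
    rw [pow_two] at h2
    nth_rewrite 2 [hX] at h2
    rw [← smul_eq_mul, Ideal.span, Submodule.mem_ideal_smul_span_iff_exists_sum] at h2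
    obtain ⟨a, ha, h3⟩ := h2
    refine ⟨a, ha, ?_⟩
    rw [Finsupp.sum_fintype _ _ (by simp)] at h3
    simpa using h3
  choose η hη hηX using hrow
  let C : Matrix (Fin m) (Fin m) (S ⊗[A] S) := Matrix.of fun r j => B r j ⊗ₜ[A] (1 : S) - η r j
  have hC : C.mulVec X = 0 := by
    ext r
    simp [C, Matrix.mulVec, dotProduct, sub_mul, hηX]
  refine ⟨C.det, ?_, ?_⟩
  · refine isDiagonal_iff_of_adjoin hl ?_
    rintro _ ⟨j, rfl⟩
    have h : C.det • X = 0 := by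
      rw [← Matrix.one_mulVec (C.det • X), Matrix.mulVec_smul, ← Matrix.smul_mulVec,
        ← Matrix.adjugate_mul, ← Matrix.mulVec_mulVec, hC, Matrix.mulVec_zero]
    have hj := congrFun h j
    simp only [Pi.smul_apply, smul_eq_mul, Pi.zero_apply, X, mul_sub] at hj
    rw [mul_comm, mul_comm _ C.det]
    exact (sub_eq_zero.1 hj).symm
  · rw [AlgHom.map_det]
    congr 1
    ext r j
    have := hη r j
    rw [RingHom.mem_ker] at this
    simp [C, this]

/-- The contraction `s ⊗ t ↦ φ(s) t`. -/
noncomputable def contractLeft (φ : S →ₗ[A] A) : S ⊗[A] S →ₗ[A] S :=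
  (TensorProduct.lid A S).toLinearMap ∘ₗ TensorProduct.map φ LinearMap.id

@[simp]
theorem contractLeft_tmul (φ : S →ₗ[A] A) (s t : S) : contractLeft φ (s ⊗ₜ[A] t) = φ s • t := by
  simp [contractLeft]

theorem contractLeft_one_tmul_mul (φ : S →ₗ[A] A) (x : S) (z : S ⊗[A] S) :
    contractLeft φ (((1 : S) ⊗ₜ[A] x) * z) = x * contractLeft φ z := by
  induction z with
  | zero => simp
  | add y z hy hz => rw [mul_add, map_add, hy, hz, map_add, mul_add]
  | tmul a b => simp

theorem contractLeft_tmul_one_mul (φ : S →ₗ[A] A) (x : S) (z : S ⊗[A] S) :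
    contractLeft φ ((x ⊗ₜ[A] (1 : S)) * z) = contractLeft (φ ∘ₗ LinearMap.mulLeft A x) z := by
  induction z with
  | zero => simp
  | add y z hy hz => rw [mul_add, map_add, hy, hz, map_add]
  | tmul a b => simp

theorem ext_contractLeft [Module.Free A S] [Module.Finite A S] {y z : S ⊗[A] S}
    (h : ∀ φ : S →ₗ[A] A, contractLeft φ y = contractLeft φ z) : y = z := by
  let b := Module.Free.chooseBasis A S
  have key : ∀ w : S ⊗[A] S, w = ∑ i, b i ⊗ₜ[A] contractLeft (b.coord i) w := by
    intro w
    induction w with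
    | zero => simp
    | add y z hy hz =>
      conv_lhs => rw [hy, hz]
      simp only [map_add, TensorProduct.tmul_add, Finset.sum_add_distrib]
    | tmul s t =>
      conv_lhs => rw [← b.sum_repr s, TensorProduct.sum_tmul]
      simp [TensorProduct.smul_tmul]
  rw [key y, key z]
  simp [h]

/-- Contraction identifies `S ⊗ S` with the `A`-linear maps from the dual of `S` to `S`; the
diagonal condition corresponds to `S`-linearity. -/
theorem exists_isDiagonal_of_dual_map [Module.Free A S] [Module.Finite A S]
    (h : (S →ₗ[A] A) →ₗ[A] S)
    (hh : ∀ (s : S) (φ : S →ₗ[A] A), h (φ ∘ₗ LinearMap.mulLeft A s) = s * h φ) :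
    ∃ z : S ⊗[A] S, IsDiagonal z ∧ ∀ φ, contractLeft φ z = h φ := by
  let b := Module.Free.chooseBasis A S
  let z : S ⊗[A] S := ∑ i, b i ⊗ₜ[A] h (b.coord i)
  have hz : ∀ φ, contractLeft φ z = h φ := by
    intro φ
    have : φ = ∑ i, φ (b i) • b.coord i := by
      refine b.ext fun j => ?_
      simp
    conv_rhs => rw [this, map_sum]
    simp [z]
  refine ⟨z, fun s => ext_contractLeft fun φ => ?_, hz⟩
  rw [contractLeft_tmul_one_mul, contractLeft_one_tmul_mul, hz, hz, hh]

end One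

section Two

variable {R S : Type*} [CommRing R] [CommRing S] [Algebra A R] [Algebra A S] [Algebra R S]
  [IsScalarTower A R S]

theorem tmul_mul_injective [Module.Flat A S] {r : S} (hr : r ∈ nonZeroDivisors S) {z : S ⊗[A] S}
    (h : (r ⊗ₜ[A] r) * z = 0) : z = 0 := by
  have hinj : Function.Injective (LinearMap.mulLeft A r) := by
    rw [← LinearMap.ker_eq_bot, LinearMap.ker_eq_bot']
    intro x hx
    exact (mul_left_mem_nonZeroDivisors_eq_zero_iff hr).1 hx
  have h1 := Module.Flat.rTensor_preserves_injective_linearMap (M := S) _ hinj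
  have h2 := Module.Flat.lTensor_preserves_injective_linearMap (M := S) _ hinj
  refine (h1.comp h2) ?_
  rw [Function.comp_apply, Function.comp_apply, map_zero, map_zero, ← h]
  clear h
  induction z with
  | zero => simp
  | add y z hy hz => rw [map_add, map_add, hy, hz, mul_add]
  | tmul a b => simp

/-- Writing `s = r' / r`, multiplication by `r ⊗ r` turns the condition for `s` into conditions for
`r` and `r'` over `R`; by flatness `r ⊗ r` can be cancelled. -/
theorem IsDiagonal.map [Module.Flat A S]
    (hRS : ∀ s : S, ∃ r r' : R, algebraMap R S r ∈ nonZeroDivisors S ∧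
      algebraMap R S r * s = algebraMap R S r') {z : R ⊗[A] R} (hz : IsDiagonal z) :
    IsDiagonal (Algebra.TensorProduct.map (IsScalarTower.toAlgHom A R S)
      (IsScalarTower.toAlgHom A R S) z) := by
  intro s
  obtain ⟨r, r', hr, hs⟩ := hRS s
  set ψ := Algebra.TensorProduct.map (IsScalarTower.toAlgHom A R S) (IsScalarTower.toAlgHom A R S)
  rw [← sub_eq_zero]
  refine tmul_mul_injective hr ?_
  have h1 : (r' ⊗ₜ[A] r - r ⊗ₜ[A] r') * z = 0 := by
    have e1 : r' ⊗ₜ[A] r = ((1 : R) ⊗ₜ[A] r) * (r' ⊗ₜ[A] (1 : R)) := by simp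
    have e2 : r ⊗ₜ[A] r' = ((1 : R) ⊗ₜ[A] r') * (r ⊗ₜ[A] (1 : R)) := by simp
    rw [sub_mul, e1, e2, mul_assoc, mul_assoc, hz, hz, ← mul_assoc, ← mul_assoc, ← sub_mul]
    simp [mul_comm]
  have h2 := congrArg ψ h1
  rw [map_mul, map_sub, map_zero] at h2
  rw [← sub_mul, ← mul_assoc, ← h2, mul_sub]
  simp [ψ, hs]

theorem contractLeft_map_mem_range (φ : S →ₗ[A] A) (z : R ⊗[A] R) :
    contractLeft φ (Algebra.TensorProduct.map (IsScalarTower.toAlgHom A R S)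
      (IsScalarTower.toAlgHom A R S) z) ∈ (algebraMap R S).range := by
  induction z with
  | zero => rw [map_zero, map_zero]; exact zero_mem _
  | add y z hy hz => rw [map_add, map_add]; exact add_mem hy hz
  | tmul a b =>
    refine ⟨φ (algebraMap R S a) • b, ?_⟩
    rw [Algebra.smul_def, map_mul, ← IsScalarTower.algebraMap_apply, ← Algebra.smul_def]
    simp

/-- If `h : Hom_A(S, A) ⟶ S` is `S`-linear and `c` multiplies the annihilator of `Ω[S⁄A]` into
`S`, then `c δ` multiplies the image of `h` into `R`, for every `δ` in the Noether different
of `R` over `A`. -/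
theorem mul_lmul_mul_mem_range [Module.Free A S] [Module.Finite A S]
    (hRS : ∀ s : S, ∃ r r' : R, algebraMap R S r ∈ nonZeroDivisors S ∧
      algebraMap R S r * s = algebraMap R S r') {L : Type*} [CommRing L] [Algebra S L] (c : L)
    (hc : ∀ d : S, (∀ x, d • KaehlerDifferential.D A S x = 0) →
      c * algebraMap S L d ∈ (algebraMap S L).range)
    (h : (S →ₗ[A] A) →ₗ[A] S)
    (hh : ∀ (s : S) (φ : S →ₗ[A] A), h (φ ∘ₗ LinearMap.mulLeft A s) = s * h φ)
    {z : R ⊗[A] R} (hz : IsDiagonal z) (φ : S →ₗ[A] A) :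
    c * algebraMap S L (algebraMap R S (Algebra.TensorProduct.lmul' A z)) * algebraMap S L (h φ) ∈
      ((algebraMap S L).comp (algebraMap R S)).range := by
  obtain ⟨m, hm, hmh⟩ := exists_isDiagonal_of_dual_map h hh
  set ψ := Algebra.TensorProduct.map (IsScalarTower.toAlgHom A R S) (IsScalarTower.toAlgHom A R S)
    with hψ
  have hzS : IsDiagonal (ψ z) := hz.map hRS
  have hδ : Algebra.TensorProduct.lmul' A (ψ z) =
      algebraMap R S (Algebra.TensorProduct.lmul' A z) := by
    have : (Algebra.TensorProduct.lmul' A (S := S)).comp ψ =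
        (IsScalarTower.toAlgHom A R S).comp (Algebra.TensorProduct.lmul' A (S := R)) := by
      ext <;> simp [hψ]
    exact DFunLike.congr_fun this z
  -- Exchanging `m` and `ψ z` gives `δ * h φ = μ(m) * contractLeft φ (ψ z)`, with `μ` the
  -- multiplication.
  have h1 := congrArg (contractLeft φ) (hm.one_tmul_mul_comm hzS)
  rw [contractLeft_one_tmul_mul, contractLeft_one_tmul_mul, hmh, hδ] at h1
  obtain ⟨s, hs⟩ := hc _ (smul_D_eq_zero_of_isDiagonal hm)
  -- The element `s = c * μ(m)` of `S` slides through `ψ z` to the left factor and is absorbed by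
  -- `φ`; what remains is a contraction of an element of `R ⊗ R`.
  rw [mul_assoc, ← map_mul, h1, map_mul, ← mul_assoc, ← hs, ← map_mul, ← contractLeft_one_tmul_mul,
    ← hzS, contractLeft_tmul_one_mul]
  obtain ⟨r, hr⟩ := contractLeft_map_mem_range (φ ∘ₗ LinearMap.mulLeft A s) z
  exact ⟨r, by rw [RingHom.comp_apply, hr]⟩

end Two

end NoetherDifferent

/-! ### Non-zero-divisors in reduced Noetherian rings. -/

section Reduced

variable {R : Type*} [CommRing R]

theorem mem_nonZeroDivisors_of_forall_notMem_minimalPrimes [IsReduced R] {x : R}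
    (hx : ∀ p ∈ minimalPrimes R, x ∉ p) : x ∈ nonZeroDivisors R := by
  rw [mem_nonZeroDivisors_iff_right]
  intro y hy
  have h : y ∈ nilradical R := by
    rw [nilradical, ← Ideal.sInf_minimalPrimes, Ideal.mem_sInf]
    intro p hp
    exact (hp.1.1.mem_or_mem (hy ▸ p.zero_mem : y * x ∈ p)).resolve_right (hx p hp)
  simpa using h

/-- Prime avoidance for `(x) + Ann(x)`: a minimal prime `p` containing it would contain the
intersection of the minimal primes not containing `x`, hence one of these, which would then equal `p
∋ x`. -/
theorem exists_mul_add_mem_nonZeroDivisors [IsReduced R] [IsNoetherianRing R] (x : R) :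
    ∃ c y : R, x * y = 0 ∧ c * x + y ∈ nonZeroDivisors R := by
  classical
  let I : Ideal R := Ideal.span {x} ⊔ LinearMap.ker (LinearMap.mulLeft R x)
  have hfin := minimalPrimes.finite_of_isNoetherianRing R
  have hI : ¬ ((I : Set R) ⊆ ⋃ p ∈ (↑hfin.toFinset : Set (Ideal R)), (p : Set R)) := by
    have := Ideal.subset_union_prime (s := hfin.toFinset) (f := fun p : Ideal R => p) ⊤ ⊤
      (fun p hp _ _ => (hfin.mem_toFinset.1 hp).1.1) (I := I)
    rw [this]
    rintro ⟨p, hp, hIp⟩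
    rw [hfin.mem_toFinset] at hp
    have hxp : x ∈ p := hIp (Ideal.mem_sup_left (Ideal.mem_span_singleton_self x))
    have hprime : p.IsPrime := hp.1.1
    have hinf : (hfin.toFinset.filter (x ∉ ·)).inf id ≤ p := by
      intro y hy
      refine hIp (Ideal.mem_sup_right ?_)
      rw [LinearMap.mem_ker, LinearMap.mulLeft_apply]
      have h : x * y ∈ nilradical R := by
        rw [nilradical, ← Ideal.sInf_minimalPrimes, Ideal.mem_sInf]
        intro q hq
        by_cases hxq : x ∈ q
        · exact q.mul_mem_right _ hxq
        · exact q.mul_mem_left _ (Finset.inf_le (f := id)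
            (Finset.mem_filter.2 ⟨hfin.mem_toFinset.2 hq, hxq⟩) hy)
      simpa using h
    obtain ⟨q, hq, hqp⟩ := (Ideal.IsPrime.inf_le' hprime).1 hinf
    rw [Finset.mem_filter, hfin.mem_toFinset] at hq
    exact hq.2 (hp.2 hq.1.1 hqp hxp)
  rw [Set.not_subset] at hI
  obtain ⟨u, hu, hu'⟩ := hI
  obtain ⟨a, ha, y, hy, rfl⟩ := Submodule.mem_sup.1 hu
  obtain ⟨c, rfl⟩ := Ideal.mem_span_singleton'.1 ha
  refine ⟨c, y, hy, mem_nonZeroDivisors_of_forall_notMem_minimalPrimes fun p hp hup => hu' ?_⟩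
  exact Set.mem_biUnion (hfin.mem_toFinset.2 hp) hup

end Reduced

/-- Through `i` the operator `f` is multiplication by `x`, so Cayley–Hamilton for `f` yields an
equation for `x`. -/
theorem map_aeval_end {S M L : Type*} [CommRing S] [AddCommGroup M] [Module S M] [CommRing L]
    [Algebra S L] (f : Module.End S M) (i : M →ₗ[S] L) (x : L) (h : ∀ v, i (f v) = x * i v)
    (p : Polynomial S) (v : M) : i (Polynomial.aeval f p v) = Polynomial.aeval x p * i v := by
  induction p using Polynomial.induction_on generalizing v with
  | C a => simp [Algebra.smul_def]
  | add p q hp hq => simp [hp, hq, add_mul]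
  | monomial n a hn =>
    have h2 := hn (f v)
    rw [h] at h2
    have e : Polynomial.C a * Polynomial.X ^ (n + 1) =
      (Polynomial.C a * Polynomial.X ^ n) * Polynomial.X := by ring
    rw [e, map_mul, Module.End.mul_apply, Polynomial.aeval_X, h2, map_mul _ (_ * _),
      Polynomial.aeval_X, mul_assoc]

/-! ### Nonsingular affine curves: valuations and orders of vanishing. -/

section Normal

variable (S L : Type*) [CommRing S] [CommRing L] [Algebra S L]

/-- The properties of the ring of functions on a nonsingular affine curve `Spec S` with total ring
of fractions `L`. -/
structure IsNormalCurveRing : Prop where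
  isNoetherianRing : IsNoetherianRing S
  isReduced : IsReduced S
  isFractionRing : IsFractionRing S L
  exists_of_isIntegral : ∀ x : L, IsIntegral S x → ∃ s, algebraMap S L s = x
  exists_mem_minimalPrimes : ∀ P : Ideal S, P.IsMaximal →
    ∃ r ∈ nonZeroDivisors S, P ∈ (Ideal.span {r}).minimalPrimes

variable {S L}

namespace IsNormalCurveRing

theorem injective (h : IsNormalCurveRing S L) : Function.Injective (algebraMap S L) :=
  have := h.isFractionRing
  IsFractionRing.injective S L

/-- The support of `x` is cut out by an idempotent `e`. -/
theorem exists_idempotent (h : IsNormalCurveRing S L) (x : S) :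
    ∃ e : S, e * e = e ∧ e * x = x ∧ ∃ w : L, algebraMap S L x * w = algebraMap S L e := by
  have := h.isFractionRing
  have := h.isReduced
  have := h.isNoetherianRing
  obtain ⟨c, y, hxy, hu⟩ := exists_mul_add_mem_nonZeroDivisors x
  obtain ⟨v, hv⟩ := (IsLocalization.map_units L ⟨_, hu⟩).exists_right_inv
  simp only [map_add, map_mul] at hv
  have hxy' : algebraMap S L x * algebraMap S L y = 0 := by rw [← map_mul, hxy, map_zero]
  set X := algebraMap S L x
  set Y := algebraMap S L y
  set C := algebraMap S L c
  have hee : (C * X * v) * (C * X * v) = C * X * v := by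
    linear_combination (C * X * v) * hv - C * v * v * hxy'
  obtain ⟨e, he⟩ := h.exists_of_isIntegral (C * X * v)
    ⟨Polynomial.X ^ 2 - Polynomial.X, by monicity!, by
      simp only [← Polynomial.aeval_def]; simp [pow_two, hee]⟩
  refine ⟨e, h.injective ?_, h.injective ?_, C * v, ?_⟩
  · rw [map_mul, he, hee]
  · rw [map_mul, he]
    linear_combination X * hv - v * hxy'
  · rw [he]; ring

/-- The witness is the idempotent `e` of `x`: it kills `y`, and `e ∈ P` would make `1 - e`, which
kills `x`, a forbidden multiplier. -/
theorem isUnit_or_eq_zero_aux (h : IsNormalCurveRing S L) (P : Ideal S) [P.IsPrime] {x y : S}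
    (hx : ∀ s ∉ P, s * x ≠ 0) (hxy : x * y = 0) : ∃ s ∉ P, s * y = 0 := by
  obtain ⟨e, hee, hex, w, hw⟩ := h.exists_idempotent x
  refine ⟨e, fun he => ?_, h.injective ?_⟩
  · refine hx (1 - e) (fun h' => ?_) (by rw [sub_mul, hex, one_mul, sub_self])
    exact (Ideal.ne_top_iff_one P).1 (inferInstance : P.IsPrime).ne_top (by
      simpa using add_mem h' he)
  · rw [map_mul, ← hw, mul_right_comm, ← map_mul, hxy, map_zero, zero_mul]

theorem isDomain_localization (h : IsNormalCurveRing S L) (P : Ideal S) [P.IsPrime] :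
    IsDomain (Localization.AtPrime P) := by
  have : NoZeroDivisors (Localization.AtPrime P) := by
    refine ⟨fun {a b} hab => ?_⟩
    obtain ⟨x, s, rfl⟩ := IsLocalization.exists_mk'_eq P.primeCompl a
    obtain ⟨y, t, rfl⟩ := IsLocalization.exists_mk'_eq P.primeCompl b
    rw [← IsLocalization.mk'_mul, IsLocalization.mk'_eq_zero_iff] at hab
    obtain ⟨u, hu⟩ := hab
    rw [IsLocalization.mk'_eq_zero_iff, IsLocalization.mk'_eq_zero_iff]
    by_contra! hcon
    obtain ⟨v, hv, hvy⟩ := h.isUnit_or_eq_zero_aux P (x := x) (y := u * y)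
      (fun s hs => hcon.1 ⟨s, hs⟩) (by rw [← hu]; ring)
    exact hcon.2 ⟨v * u, P.primeCompl.mul_mem hv u.2⟩ (by rw [← hvy]; simp [mul_assoc])
  exact NoZeroDivisors.to_isDomain _

/-- As `P` is associated to `S / (r)`, it is `((r) : b)`, and `b / r` maps `P` into `S`. An element
of `P` whose image lies outside `P` is a uniformizer. Otherwise `b / r` stabilizes `P`, so it is
integral by Cayley–Hamilton, lies in `S`, and forces `1 ∈ P`. -/
theorem exists_uniformizer (h : IsNormalCurveRing S L) (P : Ideal S) [hP : P.IsMaximal] :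
    ∃ y ∈ P, ∃ s ∉ P, ∀ p ∈ P, ∃ q, s * p = q * y := by
  have := h.isFractionRing
  have := h.isNoetherianRing
  obtain ⟨r, hr, hPr⟩ := h.exists_mem_minimalPrimes P hP
  obtain ⟨b, hb⟩ := Submodule.exists_eq_colon_of_mem_minimalPrimes (N := Ideal.span {r})
    (x := (1 : S)) (I := P) (by
      convert hPr
      ext; rw [Submodule.mem_colon_singleton, smul_eq_mul, mul_one])
  have hmem : ∀ p, p ∈ P ↔ ∃ q, q * r = p * b := fun p => by
    rw [hb, Submodule.mem_colon_singleton, smul_eq_mul, Ideal.mem_span_singleton']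
  obtain ⟨v, hv⟩ := (IsLocalization.map_units L (⟨r, hr⟩ : nonZeroDivisors S)).exists_right_inv
  have hrP : r ∈ P := hPr.1.2 (Ideal.mem_span_singleton_self r)
  choose q hq using fun p : P => (hmem p).1 p.2
  have hq' : ∀ p : P, algebraMap S L (q p) = algebraMap S L b * v * algebraMap S L p := fun p => by
    have := congrArg (algebraMap S L) (hq p)
    rw [map_mul, map_mul] at this
    linear_combination (-algebraMap S L (q p)) * hv + v * this
  by_cases hcase : ∃ p : P, q p ∉ P
  · obtain ⟨y, hy⟩ := hcase
    refine ⟨y, y.2, q y, hy, fun p hp => ⟨q ⟨p, hp⟩, h.injective ?_⟩⟩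
    rw [map_mul, map_mul, hq', hq']
    ring
  · exfalso
    push Not at hcase
    let f : Module.End S P :=
      { toFun := fun p => ⟨q p, hcase p⟩
        map_add' := fun a b => Subtype.ext (h.injective (by
          simp only [Submodule.coe_add, map_add, hq', mul_add]))
        map_smul' := fun a b => Subtype.ext (h.injective (by
          simp only [hq', RingHom.id_apply, SetLike.val_smul, smul_eq_mul, map_mul]; ring)) }
    have : Module.Finite S P := Module.Finite.iff_fg.2 (IsNoetherian.noetherian P)
    obtain ⟨p, hp, hpf⟩ := LinearMap.exists_monic_and_aeval_eq_zero S f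
    have h1 := map_aeval_end f ((Algebra.linearMap S L).comp P.subtype) (algebraMap S L b * v)
      (fun p => hq' p) p ⟨r, hrP⟩
    rw [hpf, LinearMap.zero_apply, map_zero] at h1
    have hint : IsIntegral S (algebraMap S L b * v) := by
      refine ⟨p, hp, ?_⟩
      have h2 : Polynomial.aeval (algebraMap S L b * v) p * algebraMap S L r = 0 := h1.symm
      rw [← Polynomial.aeval_def, ← mul_one (Polynomial.aeval _ p), ← hv, ← mul_assoc, h2, zero_mul]
    obtain ⟨s, hs⟩ := h.exists_of_isIntegral _ hint
    refine hP.ne_top ((Ideal.eq_top_iff_one _).2 ((hmem 1).2 ⟨s, h.injective ?_⟩))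
    rw [map_mul, map_mul, hs, map_one]
    linear_combination (algebraMap S L b) * hv

theorem isDiscreteValuationRing (h : IsNormalCurveRing S L) (P : Ideal S) [hP : P.IsMaximal] :
    ∃ _ : IsDomain (Localization.AtPrime P), IsDiscreteValuationRing (Localization.AtPrime P) := by
  have := h.isFractionRing
  have := h.isNoetherianRing
  have hdom := h.isDomain_localization P
  have : IsNoetherianRing (Localization.AtPrime P) :=
    IsLocalization.isNoetherianRing P.primeCompl _ inferInstance
  refine ⟨hdom, ?_⟩
  obtain ⟨y, hy, s, hs, hsy⟩ := h.exists_uniformizer P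
  have hfield : ¬ IsField (Localization.AtPrime P) := by
    rw [IsLocalRing.isField_iff_maximalIdeal_eq, ← Localization.AtPrime.map_eq_maximalIdeal]
    intro hbot
    obtain ⟨r, hr, hPr⟩ := h.exists_mem_minimalPrimes P hP
    have h0 : algebraMap S (Localization.AtPrime P) r ∈ (⊥ : Ideal _) := by
      rw [← hbot]
      exact Ideal.mem_map_of_mem _ (hPr.1.2 (Ideal.mem_span_singleton_self r))
    obtain ⟨t, ht⟩ := (IsLocalization.map_eq_zero_iff P.primeCompl _ _).1 (Ideal.mem_bot.1 h0)
    rw [mul_right_mem_nonZeroDivisors_eq_zero_iff hr] at ht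
    exact t.2 (ht ▸ P.zero_mem)
  have hspan : IsLocalRing.maximalIdeal (Localization.AtPrime P) =
      Ideal.span {algebraMap S (Localization.AtPrime P) y} := by
    rw [← Localization.AtPrime.map_eq_maximalIdeal]
    apply le_antisymm
    · refine Ideal.map_le_iff_le_comap.2 fun p hp => ?_
      obtain ⟨q, hq⟩ := hsy p hp
      have hunit := IsLocalization.map_units (Localization.AtPrime P) (⟨s, hs⟩ : P.primeCompl)
      refine Ideal.mem_comap.2 ((Ideal.unit_mul_mem_iff_mem _ hunit).1 ?_)
      rw [← map_mul, hq, map_mul]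
      exact Ideal.mul_mem_left _ _ (Ideal.mem_span_singleton_self _)
    · exact (Ideal.span_singleton_le_iff_mem _).2 (Ideal.mem_map_of_mem _ hy)
  have hpr : (IsLocalRing.maximalIdeal (Localization.AtPrime P)).IsPrincipal := ⟨_, hspan⟩
  exact ((IsDiscreteValuationRing.TFAE _ hfield).out 0 4).2 hpr

end IsNormalCurveRing

/-- Powers of a maximal ideal are primary, hence are recovered from the localization. -/
theorem le_pow_iff_map_le (P : MaximalSpectrum S) (I : Ideal S) (n : ℕ) :
    I ≤ P.asIdeal ^ n ↔ I.map (algebraMap S (Localization.AtPrime P.asIdeal)) ≤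
      IsLocalRing.maximalIdeal (Localization.AtPrime P.asIdeal) ^ n := by
  rw [← Localization.AtPrime.map_eq_maximalIdeal, ← Ideal.map_pow]
  refine ⟨Ideal.map_mono, fun h => ?_⟩
  rcases Nat.eq_zero_or_pos n with rfl | hn
  · simp
  have hprim : (P.asIdeal ^ n).IsPrimary := by
    refine Ideal.isPrimary_of_isMaximal_radical ?_
    rw [Ideal.radical_pow _ hn.ne', P.isMaximal.isPrime.radical]
    exact P.isMaximal
  have hdisj : Disjoint (P.asIdeal.primeCompl : Set S) (P.asIdeal ^ n : Ideal S) := by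
    rw [Set.disjoint_left]
    exact fun x hx hx' => hx (Ideal.pow_le_self hn.ne' hx')
  rw [← IsLocalization.under_map_of_isPrimary_disjoint P.asIdeal.primeCompl
    (Localization.AtPrime P.asIdeal) hprim hdisj]
  exact Ideal.map_le_iff_le_comap.1 h

theorem pow_maximalIdeal_le_pow_iff {O : Type*} [CommRing O] [IsDomain O]
    [IsDiscreteValuationRing O] (m n : ℕ) :
    IsLocalRing.maximalIdeal O ^ m ≤ IsLocalRing.maximalIdeal O ^ n ↔ n ≤ m := by
  obtain ⟨ϖ, hϖ⟩ := IsDiscreteValuationRing.exists_irreducible O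
  rw [hϖ.maximalIdeal_eq, Ideal.span_singleton_pow, Ideal.span_singleton_pow,
    Ideal.span_singleton_le_span_singleton, pow_dvd_pow_iff hϖ.ne_zero hϖ.not_isUnit]

namespace IsNormalCurveRing

theorem ordAt_eq_coe (h : IsNormalCurveRing S L) {P : MaximalSpectrum S} {I : Ideal S} {n : ℕ}
    (hI : I.map (algebraMap S (Localization.AtPrime P.asIdeal)) =
      IsLocalRing.maximalIdeal (Localization.AtPrime P.asIdeal) ^ n) : ordAt P I = n := by
  obtain ⟨_, _⟩ := h.isDiscreteValuationRing P.asIdeal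
  apply le_antisymm
  · refine iSup₂_le fun m hm => ?_
    rw [le_pow_iff_map_le, hI, pow_maximalIdeal_le_pow_iff] at hm
    exact_mod_cast hm
  · exact le_iSup₂_of_le n ((le_pow_iff_map_le P I n).2 hI.le) le_rfl

theorem ordAt_eq_top {P : MaximalSpectrum S} {I : Ideal S}
    (hI : I.map (algebraMap S (Localization.AtPrime P.asIdeal)) = ⊥) : ordAt P I = ⊤ := by
  rw [ENat.eq_top_iff_forall_ge]
  intro n
  refine le_iSup₂_of_le n ((le_pow_iff_map_le P I n).2 ?_) le_rfl
  rw [hI]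
  exact bot_le

theorem ordAt_cases (h : IsNormalCurveRing S L) (P : MaximalSpectrum S) (I : Ideal S) :
    (∃ n : ℕ, I.map (algebraMap S (Localization.AtPrime P.asIdeal)) =
      IsLocalRing.maximalIdeal (Localization.AtPrime P.asIdeal) ^ n ∧ ordAt P I = n) ∨
    (I.map (algebraMap S (Localization.AtPrime P.asIdeal)) = ⊥ ∧ ordAt P I = ⊤) := by
  by_cases hI : I.map (algebraMap S (Localization.AtPrime P.asIdeal)) = ⊥
  · exact Or.inr ⟨hI, ordAt_eq_top hI⟩
  · obtain ⟨_, _⟩ := h.isDiscreteValuationRing P.asIdeal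
    obtain ⟨ϖ, hϖ⟩ := IsDiscreteValuationRing.exists_irreducible (Localization.AtPrime P.asIdeal)
    obtain ⟨n, hn⟩ := IsDiscreteValuationRing.ideal_eq_span_pow_irreducible hI hϖ
    rw [← Ideal.span_singleton_pow, ← hϖ.maximalIdeal_eq] at hn
    exact Or.inl ⟨n, hn, h.ordAt_eq_coe hn⟩

theorem ordAt_mul (h : IsNormalCurveRing S L) (P : MaximalSpectrum S) (I J : Ideal S) :
    ordAt P (I * J) = ordAt P I + ordAt P J := by
  rcases h.ordAt_cases P I with ⟨m, hm, hm'⟩ | ⟨hm, hm'⟩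
  · rcases h.ordAt_cases P J with ⟨n, hn, hn'⟩ | ⟨hn, hn'⟩
    · rw [hm', hn', h.ordAt_eq_coe (n := m + n) (by rw [Ideal.map_mul, hm, hn, pow_add])]
      rfl
    · rw [hn', add_top, ordAt_eq_top]
      rw [Ideal.map_mul, hn, Ideal.mul_bot]
  · rw [hm', top_add, ordAt_eq_top]
    rw [Ideal.map_mul, hm, Ideal.bot_mul]

theorem ordAt_top (h : IsNormalCurveRing S L) (P : MaximalSpectrum S) :
    ordAt P (⊤ : Ideal S) = 0 := by
  rw [h.ordAt_eq_coe (n := 0) (by rw [Ideal.map_top, pow_zero, Ideal.one_eq_top])]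
  rfl

theorem ordAt_pow (h : IsNormalCurveRing S L) (P : MaximalSpectrum S) (I : Ideal S) (n : ℕ) :
    ordAt P (I ^ n) = n * ordAt P I := by
  induction n with
  | zero => rw [pow_zero, Ideal.one_eq_top, h.ordAt_top]; simp
  | succ n ih => rw [pow_succ, h.ordAt_mul, ih]; push_cast; ring

theorem mem_pow_of_ordAt (P : MaximalSpectrum S) (I : Ideal S) {n : ℕ} (hn : (n : ℕ∞) ≤ ordAt P I) :
    I ≤ P.asIdeal ^ n := by
  rcases Nat.eq_zero_or_pos n with rfl | hpos
  · simp
  by_contra hI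
  have : ordAt P I ≤ (n - 1 : ℕ) := by
    refine iSup₂_le fun m hm => ?_
    by_contra! hlt
    have hlt' : n - 1 < m := by exact_mod_cast hlt
    exact hI (hm.trans (Ideal.pow_le_pow_right (by omega)))
  have h2 := hn.trans this
  have h3 : n ≤ n - 1 := by exact_mod_cast h2
  omega

end IsNormalCurveRing

end Normal

/-! ### Local tests for ideals, and invertibility on a nonsingular curve. -/

section Local

variable {S : Type*} [CommRing S]

theorem exists_mul_mem_iff (P : Ideal S) [P.IsPrime] (I : Ideal S) (x : S) :
    algebraMap S (Localization.AtPrime P) x ∈ I.map (algebraMap S (Localization.AtPrime P)) ↔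
      ∃ s ∉ P, s * x ∈ I :=
  IsLocalization.algebraMap_mem_map_algebraMap_iff P.primeCompl _ I x

theorem mem_of_forall_exists_mul_mem {I : Ideal S} {x : S}
    (h : ∀ P : Ideal S, P.IsMaximal → ∃ s ∉ P, s * x ∈ I) : x ∈ I := by
  by_contra hx
  have hne : I.colon {x} ≠ ⊤ := fun h => hx (by
    have : (1 : S) ∈ I.colon {x} := h ▸ Submodule.mem_top
    simpa using this)
  obtain ⟨P, hP, hle⟩ := Ideal.exists_le_maximal _ hne
  obtain ⟨s, hs, hsx⟩ := h P hP
  exact hs (hle (by simpa using hsx))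

theorem exists_forall_mul_mem {P : Ideal S} [P.IsPrime] {F I : Ideal S} (hF : F.FG)
    (h : ∀ x ∈ F, ∃ s ∉ P, s * x ∈ I) : ∃ s ∉ P, ∀ x ∈ F, s * x ∈ I := by
  induction F, hF using Submodule.fg_induction with
  | singleton y =>
    obtain ⟨s, hs, hsy⟩ := h y (Submodule.mem_span_singleton_self y)
    refine ⟨s, hs, fun x hx => ?_⟩
    obtain ⟨a, rfl⟩ := Submodule.mem_span_singleton.1 hx
    rw [smul_eq_mul, mul_left_comm]
    exact I.mul_mem_left _ hsy
  | sup M N _ _ hM hN =>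
    obtain ⟨s, hs, hs'⟩ := hM fun x hx => h x (Submodule.mem_sup_left hx)
    obtain ⟨t, ht, ht'⟩ := hN fun x hx => h x (Submodule.mem_sup_right hx)
    refine ⟨s * t, fun hst => ((inferInstance : P.IsPrime).mem_or_mem hst).elim hs ht,
      fun x hx => ?_⟩
    obtain ⟨a, ha, b, hb, rfl⟩ := Submodule.mem_sup.1 hx
    rw [mul_add, mul_right_comm, mul_assoc s t b]
    exact add_mem (I.mul_mem_right _ (hs' a ha)) (I.mul_mem_left _ (ht' b hb))

end Local

/-- An element of a discrete valuation ring that is integral over a power of the maximal ideal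
belongs to it. -/
theorem mem_maximalIdeal_pow_of_eval_eq_zero {O : Type*} [CommRing O] [IsDomain O]
    [IsDiscreteValuationRing O] {r : ℕ} {x : O} {p : Polynomial O} (hp : p.Monic)
    (hx : p.eval x = 0)
    (hc : ∀ i ≤ p.natDegree, p.coeff i ∈ (IsLocalRing.maximalIdeal O ^ r) ^ (p.natDegree - i)) :
    x ∈ IsLocalRing.maximalIdeal O ^ r := by
  obtain ⟨ϖ, hϖ⟩ := IsDiscreteValuationRing.exists_irreducible O
  rw [hϖ.maximalIdeal_eq, Ideal.span_singleton_pow] at hc ⊢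
  by_cases hx0 : x = 0
  · rw [hx0]; exact zero_mem _
  obtain ⟨k, u, rfl⟩ := IsDiscreteValuationRing.eq_unit_mul_pow_irreducible hx0 hϖ
  by_contra hcon
  have hk : k < r := by
    by_contra! hrk
    exact hcon (Ideal.mem_span_singleton.2 (Dvd.dvd.mul_left (pow_dvd_pow _ hrk) _))
  rw [Polynomial.eval_eq_sum_range, Finset.sum_range_succ, hp.coeff_natDegree, one_mul] at hx
  -- If `x` has valuation `k < r` and `n` is the degree, the term of index `i < n` has valuation at
  -- least `r(n - i) + ki > kn`, so it cannot cancel `x ^ n`.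
  have hdvd : ϖ ^ (k * p.natDegree + 1) ∣
      ∑ i ∈ Finset.range p.natDegree, p.coeff i * (u * ϖ ^ k) ^ i := by
    refine Finset.dvd_sum fun i hi => ?_
    rw [Finset.mem_range] at hi
    have h1 := hc i hi.le
    rw [Ideal.span_singleton_pow, Ideal.mem_span_singleton, ← pow_mul] at h1
    obtain ⟨c, hc⟩ := h1
    obtain ⟨j, hj⟩ : ∃ j, p.natDegree = i + 1 + j := ⟨_, (Nat.add_sub_cancel' hi).symm⟩
    obtain ⟨l, rfl⟩ : ∃ l, r = k + 1 + l := ⟨_, (Nat.add_sub_cancel' hk).symm⟩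
    have hle : k * p.natDegree + 1 ≤ (k + 1 + l) * (p.natDegree - i) + k * i := by
      have : p.natDegree - i = j + 1 := by omega
      rw [this, hj]
      nlinarith [Nat.zero_le (l * j)]
    rw [hc, mul_pow, ← pow_mul]
    refine (pow_dvd_pow ϖ hle).trans ⟨c * u ^ i, ?_⟩
    rw [pow_add]
    ring
  have h2 : ϖ ^ (k * p.natDegree + 1) ∣ (u * ϖ ^ k) ^ p.natDegree := by
    rw [← dvd_add_right hdvd, hx]
    exact dvd_zero _
  rw [mul_pow, ← pow_mul, ← Units.val_pow_eq_pow_val, Units.dvd_mul_left,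
    pow_dvd_pow_iff hϖ.ne_zero hϖ.not_isUnit] at h2
  omega

namespace IsNormalCurveRing

variable {S L : Type*} [CommRing S] [CommRing L] [Algebra S L]

theorem exists_generator (h : IsNormalCurveRing S L) (P : MaximalSpectrum S) {F : Ideal S}
    (hF : ordAt P F ≠ ⊤) : ∃ f ∈ F,
      (Ideal.span {f}).map (algebraMap S (Localization.AtPrime P.asIdeal)) ≠ ⊥ ∧
      ∃ s ∉ P.asIdeal, ∀ x ∈ F, s * x ∈ Ideal.span {f} := by
  obtain ⟨_, _⟩ := h.isDiscreteValuationRing P.asIdeal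
  have := h.isNoetherianRing
  rcases h.ordAt_cases P F with ⟨n, hn, -⟩ | ⟨-, htop⟩
  swap
  · exact absurd htop hF
  obtain ⟨ϖ, hϖ⟩ := IsDiscreteValuationRing.exists_irreducible (Localization.AtPrime P.asIdeal)
  have hnot : ¬ F ≤ P.asIdeal ^ (n + 1) := by
    rw [le_pow_iff_map_le, hn, pow_maximalIdeal_le_pow_iff]
    omega
  obtain ⟨f, hfF, hf⟩ := Set.not_subset.1 hnot
  have hspan : (Ideal.span {f}).map (algebraMap S (Localization.AtPrime P.asIdeal)) =
      IsLocalRing.maximalIdeal (Localization.AtPrime P.asIdeal) ^ n := by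
    rcases h.ordAt_cases P (Ideal.span {f}) with ⟨m, hm, -⟩ | ⟨hbot, -⟩
    · have h1 : n ≤ m := by
        rw [← pow_maximalIdeal_le_pow_iff (O := Localization.AtPrime P.asIdeal), ← hm, ← hn]
        exact Ideal.map_mono ((Ideal.span_singleton_le_iff_mem _).2 hfF)
      have h2 : ¬ n + 1 ≤ m := by
        rw [← pow_maximalIdeal_le_pow_iff (O := Localization.AtPrime P.asIdeal), ← hm,
          ← le_pow_iff_map_le, Ideal.span_singleton_le_iff_mem]
        exact hf
      rw [hm]
      congr 1
      omega
    · exfalso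
      refine hf ((Ideal.span_singleton_le_iff_mem _).1 ((le_pow_iff_map_le P _ _).2 ?_))
      rw [hbot]
      exact bot_le
  obtain ⟨s, hs, hsF⟩ := exists_forall_mul_mem (P := P.asIdeal) (F := F) (I := Ideal.span {f})
    (IsNoetherian.noetherian F) fun x hx => by
      rw [← exists_mul_mem_iff, hspan, ← hn]
      exact Ideal.mem_map_of_mem _ hx
  refine ⟨f, hfF, ?_, s, hs, hsF⟩
  rw [hspan, hϖ.maximalIdeal_eq, Ideal.span_singleton_pow, Ne, Ideal.span_singleton_eq_bot]
  exact pow_ne_zero _ hϖ.ne_zero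

/-- `F` is locally invertible: `w`, which is `s / f` on the support of `f`, multiplies `F` into `S`
and takes `f` to a unit at `P`. -/
theorem exists_dual_generator (h : IsNormalCurveRing S L) (P : MaximalSpectrum S) {F : Ideal S}
    (hF : ordAt P F ≠ ⊤) : ∃ f ∈ F, ∃ w : L, ∃ s ∉ P.asIdeal,
      (∀ x ∈ F, ∃ t : S, w * algebraMap S L x = algebraMap S L t) ∧
        w * algebraMap S L f = algebraMap S L s := by
  obtain ⟨f, hfF, hspan, s, hs, hsF⟩ := h.exists_generator P hF
  obtain ⟨e, -, hef, w, hw⟩ := h.exists_idempotent f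
  have he : e ∉ P.asIdeal := fun he => by
    have h1 : 1 - e ∉ P.asIdeal := fun h' =>
      (Ideal.ne_top_iff_one _).1 P.isMaximal.ne_top (by simpa using add_mem h' he)
    have h2 : (Ideal.span {f}).map (algebraMap S (Localization.AtPrime P.asIdeal)) = ⊥ := by
      rw [Ideal.map_span, Set.image_singleton, Ideal.span_singleton_eq_bot,
        IsLocalization.map_eq_zero_iff P.asIdeal.primeCompl]
      exact ⟨⟨1 - e, h1⟩, by simp [sub_mul, hef]⟩
    exact hspan h2
  refine ⟨f, hfF, algebraMap S L s * w, s * e,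
    fun hse => (P.isMaximal.isPrime.mem_or_mem hse).elim hs he, fun x hx => ?_, ?_⟩
  · obtain ⟨q, hq⟩ := Ideal.mem_span_singleton'.1 (hsF x hx)
    refine ⟨q * e, ?_⟩
    have := congrArg (algebraMap S L) hq
    rw [map_mul, map_mul] at this
    rw [map_mul, ← hw]
    linear_combination (-w) * this
  · rw [map_mul, ← hw]
    ring

/-- Near each point some `w * f` is a unit, so `g` is locally a multiple of `w * (g * f)`. -/
theorem mem_of_forall_mul_mem (h : IsNormalCurveRing S L) {F : Ideal S}
    (hF : ∀ P, ordAt P F ≠ ⊤) (N : Submodule S L) {g : L}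
    (hg : ∀ w : L, (∀ x ∈ F, ∃ t : S, w * algebraMap S L x = algebraMap S L t) →
      ∀ f ∈ F, w * (g * algebraMap S L f) ∈ N) : g ∈ N := by
  have key : (1 : S) ∈ N.colon {g} := by
    refine mem_of_forall_exists_mul_mem fun P hP => ?_
    obtain ⟨f, hf, w, s, hs, hw, hwf⟩ := h.exists_dual_generator ⟨P, hP⟩ (hF ⟨P, hP⟩)
    refine ⟨s, hs, ?_⟩
    rw [mul_one, Submodule.mem_colon_singleton, Algebra.smul_def, ← hwf]
    convert hg w hw f hf using 1
    ring
  simpa using key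

/-- Ideals that vanish at no point of `Spec S` can be cancelled. -/
theorem exists_mem_of_forall_mul_mem_mul (h : IsNormalCurveRing S L) {F I : Ideal S}
    (hF : ∀ P, ordAt P F ≠ ⊤) {g : L}
    (hg : ∀ f ∈ F, ∃ x ∈ I * F, g * algebraMap S L f = algebraMap S L x) :
    ∃ i ∈ I, algebraMap S L i = g := by
  refine h.mem_of_forall_mul_mem hF (Submodule.map (Algebra.linearMap S L) I) fun w hw f hf => ?_
  obtain ⟨x, hx, hgx⟩ := hg f hf
  rw [hgx]
  clear hgx
  induction hx using Submodule.mul_induction_on' with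
  | mem_mul_mem a ha b hb =>
    obtain ⟨t, ht⟩ := hw b hb
    refine ⟨a * t, I.mul_mem_right _ ha, ?_⟩
    rw [Algebra.linearMap_apply, map_mul, map_mul, ← ht]
    ring
  | add x _ y _ hx hy => rw [map_add, mul_add]; exact add_mem hx hy

theorem ordAt_mono {P : MaximalSpectrum S} {I J : Ideal S} (hIJ : I ≤ J) : ordAt P J ≤ ordAt P I :=
  iSup₂_le fun n hn => le_iSup₂_of_le n (hIJ.trans hn) le_rfl

/-- Subtraction of divisors. Near `P` the ideal `J` is generated by one `f`, and dividing `I` by `f`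
lands in the colon; where `J` vanishes both sides are `⊤`. -/
theorem ordAt_colon_add (h : IsNormalCurveRing S L) {I J : Ideal S} (hIJ : I ≤ J)
    (P : MaximalSpectrum S) : ordAt P (I.colon (J : Set S)) + ordAt P J = ordAt P I := by
  by_cases hJ : ordAt P J = ⊤
  · rw [hJ, add_top]
    exact (top_le_iff.1 (hJ ▸ ordAt_mono hIJ)).symm
  rw [← h.ordAt_mul]
  apply le_antisymm
  · obtain ⟨f, hf, -, s, hs, hsJ⟩ := h.exists_generator P hJ
    have hle : I.map (algebraMap S (Localization.AtPrime P.asIdeal)) ≤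
        (I.colon (J : Set S) * J).map (algebraMap S (Localization.AtPrime P.asIdeal)) := by
      refine Ideal.map_le_iff_le_comap.2 fun x hx => ?_
      rw [Ideal.mem_comap, exists_mul_mem_iff]
      obtain ⟨q, hq⟩ := Ideal.mem_span_singleton'.1 (hsJ x (hIJ hx))
      refine ⟨s * s, fun h => (P.isMaximal.isPrime.mem_or_mem h).elim hs hs, ?_⟩
      rw [mul_assoc, ← hq, ← mul_assoc]
      refine Ideal.mul_mem_mul (Submodule.mem_colon.2 fun y hy => ?_) hf
      obtain ⟨c, hc⟩ := Ideal.mem_span_singleton'.1 (hsJ y hy)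
      have : (s * q) • y = c * s * x := by
        rw [smul_eq_mul]
        linear_combination c * hq - q * hc
      rw [this]
      exact I.mul_mem_left _ hx
    exact iSup₂_le fun n hn => le_iSup₂_of_le n
      ((le_pow_iff_map_le P _ n).2 (hle.trans ((le_pow_iff_map_le P _ n).1 hn))) le_rfl
  · refine ordAt_mono (Ideal.mul_le.2 fun x hx y hy => ?_)
    exact Submodule.mem_colon.1 hx y hy

/-- This replaces the pointwise inequalities defining `divisorSections` by the ideal-theoretic
condition `gF ⊆ I`. -/
theorem forall_exists_mul_mul_eq_iff (h : IsNormalCurveRing S L)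
    {F I : Ideal S} (hF : ∀ P, ordAt P F ≠ ⊤) {g : L} :
    (∀ (P : MaximalSpectrum S) (m n : ℕ), ordAt P F ≤ m → (n : ℕ∞) ≤ ordAt P I →
      ∀ x ∈ P.asIdeal ^ m, ∃ s ∉ P.asIdeal, ∃ y ∈ P.asIdeal ^ n,
        algebraMap S L s * g * algebraMap S L x = algebraMap S L y) ↔
      ∀ f ∈ F, ∃ i ∈ I, g * algebraMap S L f = algebraMap S L i := by
  have := h.isFractionRing
  have := h.isNoetherianRing
  constructor
  · intro hg f hf
    let N : Submodule S L :=
      Submodule.map (Algebra.linearMap _ _) I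
    have key : (1 : S) ∈
        N.colon {g * algebraMap S L f} := by
      refine mem_of_forall_exists_mul_mem fun P hP => ?_
      obtain ⟨_, _⟩ := h.isDiscreteValuationRing P
      rcases h.ordAt_cases ⟨P, hP⟩ F with ⟨K, -, hK⟩ | ⟨-, htop⟩
      swap
      · exact absurd htop (hF _)
      have hfK : f ∈ P ^ K := IsNormalCurveRing.mem_pow_of_ordAt ⟨P, hP⟩ F hK.ge hf
      rcases h.ordAt_cases ⟨P, hP⟩ I with ⟨n, hn, hn'⟩ | ⟨hbot, htop⟩
      · obtain ⟨s, hs, y, hy, hsy⟩ := hg ⟨P, hP⟩ K n hK.le hn'.ge f hfK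
        have hyI : algebraMap _ (Localization.AtPrime P) y ∈
            I.map (algebraMap _ (Localization.AtPrime P)) := by
          rw [hn, ← Localization.AtPrime.map_eq_maximalIdeal, ← Ideal.map_pow]
          exact Ideal.mem_map_of_mem _ hy
        obtain ⟨t, ht, hty⟩ := (exists_mul_mem_iff P I y).1 hyI
        refine ⟨t * s, fun hts => (hP.isPrime.mem_or_mem hts).elim ht hs, ?_⟩
        rw [mul_one, Submodule.mem_colon_singleton]
        refine ⟨t * y, hty, ?_⟩
        rw [Algebra.linearMap_apply, map_mul, ← hsy, Algebra.smul_def, map_mul]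
        ring
      -- Where `I` vanishes the condition holds for every `n`, so Krull's intersection theorem makes
      -- the numerator `u` of `g * f` zero at `P`.
      · obtain ⟨⟨u, r⟩, hur⟩ := IsLocalization.surj (nonZeroDivisors (S))
          (g * algebraMap S L f)
        have hu : algebraMap _ (Localization.AtPrime P) u ∈
            ⨅ n : ℕ, IsLocalRing.maximalIdeal (Localization.AtPrime P) ^ n := by
          rw [Ideal.mem_iInf]
          intro n
          obtain ⟨s, hs, y, hy, hsy⟩ := hg ⟨P, hP⟩ K n hK.le (htop ▸ le_top) f hfK
          rw [← Localization.AtPrime.map_eq_maximalIdeal, ← Ideal.map_pow, exists_mul_mem_iff]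
          refine ⟨s, hs, ?_⟩
          have : s * u = r * y := h.injective (by
            rw [map_mul, map_mul, ← hur, ← hsy]
            ring)
          rw [this]
          exact Ideal.mul_mem_left _ _ hy
        have : IsNoetherianRing (Localization.AtPrime P) :=
          IsLocalization.isNoetherianRing P.primeCompl _ inferInstance
        have hinf := Ideal.iInf_pow_eq_bot_of_isLocalRing
          (IsLocalRing.maximalIdeal (Localization.AtPrime P))
          (IsLocalRing.maximalIdeal.isMaximal _).ne_top
        rw [hinf, Ideal.mem_bot, IsLocalization.map_eq_zero_iff P.primeCompl] at hu
        obtain ⟨t, ht⟩ := hu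
        refine ⟨t, t.2, ?_⟩
        rw [mul_one, Submodule.mem_colon_singleton, Algebra.smul_def]
        have hr := IsLocalization.map_units (L) r
        have h0 : algebraMap S L (t : S) *
            (g * algebraMap S L f) = 0 := by
          rw [← hr.mul_left_eq_zero, mul_assoc, hur, ← map_mul, ht, map_zero]
        rw [h0]
        exact zero_mem _
    have := Submodule.mem_colon_singleton.1 key
    rw [one_smul] at this
    obtain ⟨i, hi, hgi⟩ := this
    exact ⟨i, hi, hgi.symm⟩
  · intro hg P m n hm hn x hx
    rcases h.ordAt_cases P F with ⟨K, hK, hK'⟩ | ⟨-, htop⟩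
    swap
    · exact absurd htop (hF _)
    obtain ⟨_, _⟩ := h.isDiscreteValuationRing P.asIdeal
    have hxF : algebraMap _ (Localization.AtPrime P.asIdeal) x ∈
        F.map (algebraMap _ (Localization.AtPrime P.asIdeal)) := by
      rw [hK]
      refine (pow_maximalIdeal_le_pow_iff m K).2 ?_ ?_
      · rw [hK'] at hm
        exact_mod_cast hm
      · rw [← Localization.AtPrime.map_eq_maximalIdeal, ← Ideal.map_pow]
        exact Ideal.mem_map_of_mem _ hx
    obtain ⟨s, hs, hsx⟩ := (exists_mul_mem_iff P.asIdeal F x).1 hxF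
    obtain ⟨i, hi, hgi⟩ := hg _ hsx
    refine ⟨s, hs, i, IsNormalCurveRing.mem_pow_of_ordAt P I hn hi, ?_⟩
    rw [map_mul] at hgi
    rw [← hgi]
    ring

/-- For `n ≤ m` there is no condition on elements of `R`. For `n = m + r` the hypothesis says that
`a` maps into the `r`-th power of the maximal ideal at `P`, which is integrally closed. -/
theorem exists_mul_mul_eq_of_isIntegralOverIdeal (h : IsNormalCurveRing S L)
    {R : Type*} [CommRing R] [Algebra R S] {a : Ideal R} (P : MaximalSpectrum S) (m n : ℕ)
    (ha : ∀ y ∈ a, ∀ q ∈ P.asIdeal ^ m, ∃ s ∉ P.asIdeal, ∃ t ∈ P.asIdeal ^ n,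
      s * algebraMap R S y * q = t) {x : R}
    (hx : IsIntegralOverIdeal a x) {z : S} (hz : z ∈ P.asIdeal ^ m) :
    ∃ s ∉ P.asIdeal, ∃ t ∈ P.asIdeal ^ n, s * algebraMap R S x * z = t := by
  rcases le_or_gt n m with hnm | hnm
  · exact ⟨1, fun h1 => P.isMaximal.ne_top ((Ideal.eq_top_iff_one _).2 h1), algebraMap R _ x * z,
      Ideal.mul_mem_left _ _ (Ideal.pow_le_pow_right hnm hz), by rw [one_mul]⟩
  obtain ⟨_, _⟩ := h.isDiscreteValuationRing P.asIdeal
  set O := Localization.AtPrime P.asIdeal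
  obtain ⟨r, rfl⟩ : ∃ r, n = m + r := ⟨_, (Nat.add_sub_cancel' hnm.le).symm⟩
  let ψ : R →+* O := (algebraMap S O).comp (algebraMap R S)
  have hψ : a.map ψ ≤ IsLocalRing.maximalIdeal O ^ r := by
    refine Ideal.map_le_iff_le_comap.2 fun y hy => ?_
    obtain ⟨ϖ, hϖ⟩ := IsDiscreteValuationRing.exists_irreducible O
    have h1 : Ideal.span {ϖ ^ m} * Ideal.span {ψ y} ≤ Ideal.span {ϖ ^ m * ϖ ^ r} := by
      rw [← pow_add, ← Ideal.span_singleton_pow, ← Ideal.span_singleton_pow, ← hϖ.maximalIdeal_eq,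
        ← Localization.AtPrime.map_eq_maximalIdeal, ← Ideal.map_pow, ← Ideal.map_pow,
        Ideal.mul_le]
      intro b hb c hc
      obtain ⟨c, rfl⟩ := Ideal.mem_span_singleton'.1 hc
      rw [mul_comm c, ← mul_assoc]
      refine Ideal.mul_mem_right _ _ ?_
      have : Ideal.map (algebraMap _ O) (P.asIdeal ^ m) ≤
          (Ideal.map (algebraMap _ O) (P.asIdeal ^ (m + r))).colon {ψ y} := by
        refine Ideal.map_le_iff_le_comap.2 fun q hq => ?_
        rw [Ideal.mem_comap, Submodule.mem_colon_singleton, smul_eq_mul, RingHom.comp_apply,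
          ← map_mul, exists_mul_mem_iff]
        obtain ⟨s, hs, t, ht, hst⟩ := ha y hy q hq
        refine ⟨s, hs, ?_⟩
        rwa [mul_comm q, ← mul_assoc, hst]
      exact Submodule.mem_colon_singleton.1 (this hb)
    rw [Ideal.span_singleton_mul_span_singleton, Ideal.span_singleton_le_span_singleton] at h1
    rw [Ideal.mem_comap, hϖ.maximalIdeal_eq, Ideal.span_singleton_pow, Ideal.mem_span_singleton]
    exact (mul_dvd_mul_iff_left (pow_ne_zero _ hϖ.ne_zero)).1 h1
  obtain ⟨p, hp, hpx, hpc⟩ := hx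
  have hxr : ψ x ∈ IsLocalRing.maximalIdeal O ^ r := by
    refine mem_maximalIdeal_pow_of_eval_eq_zero (hp.map ψ) ?_ fun i hi => ?_
    · rw [Polynomial.eval_map, Polynomial.eval₂_hom, hpx, map_zero]
    · rw [hp.natDegree_map] at hi ⊢
      rw [Polynomial.coeff_map]
      refine Ideal.pow_right_mono hψ _ ?_
      rw [← Ideal.map_pow]
      exact Ideal.mem_map_of_mem _ (hpc i hi)
  rw [← Localization.AtPrime.map_eq_maximalIdeal, ← Ideal.map_pow, RingHom.comp_apply,
    exists_mul_mem_iff] at hxr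
  obtain ⟨s, hs, hsx⟩ := hxr
  refine ⟨s, hs, s * algebraMap R _ x * z, ?_, rfl⟩
  rw [pow_add, mul_comm (P.asIdeal ^ m)]
  exact Ideal.mul_mem_mul hsx hz

end IsNormalCurveRing

section DivisorSections

variable {R : Type*} [CommRing R]

theorem mem_divisorSections_iff (h : IsNormalCurveRing (NormalizationRing R) (FractionRing R))
    {F I : Ideal (NormalizationRing R)} (hF : ∀ P, ordAt P F ≠ ⊤) {g : FractionRing R} :
    g ∈ divisorSections R (fun P => ordAt P F) (fun P => ordAt P I) ↔
      ∀ f ∈ F, ∃ i ∈ I, g * algebraMap _ (FractionRing R) f = algebraMap _ (FractionRing R) i :=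
  h.forall_exists_mul_mul_eq_iff hF

theorem mem_divisorSections_of_isIntegralOverIdeal
    (h : IsNormalCurveRing (NormalizationRing R) (FractionRing R))
    (D₁ D₂ : MaximalSpectrum (NormalizationRing R) → ℕ∞) {a : Ideal R}
    (ha : ∀ y ∈ a, algebraMap R (FractionRing R) y ∈ divisorSections R D₁ D₂) {x : R}
    (hx : IsIntegralOverIdeal a x) : algebraMap R (FractionRing R) x ∈ divisorSections R D₁ D₂ := by
  intro P m n hm hn z hz
  obtain ⟨s, hs, t, ht, hst⟩ := h.exists_mul_mul_eq_of_isIntegralOverIdeal P m n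
    (fun y hy q hq => by
      obtain ⟨s, hs, t, ht, hst⟩ := ha y hy P m n hm hn q hq
      exact ⟨s, hs, t, ht, Subtype.ext hst⟩) hx hz
  exact ⟨s, hs, t, ht, congrArg Subtype.val hst⟩

end DivisorSections

/-! ### Finiteness of integral closure over a perfect field. -/

section FrobeniusFinite

/-- Coefficients have `p ^ n`-th roots because `k` is perfect; exponents are divided by `p ^ n` with
remainder. -/
theorem exists_sum_pow_mul_X_pow {k : Type*} [Field k] [PerfectField k] (p n : ℕ) [ExpChar k p]
    (f : Polynomial k) : ∃ c : Fin (p ^ n) → Polynomial k,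
      f = ∑ r, c r ^ p ^ n * Polynomial.X ^ (r : ℕ) := by
  have : ExpChar (Polynomial k) p := inferInstance
  have hQ : 0 < p ^ n := pow_pos (expChar_pos k p) n
  induction f using Polynomial.induction_on' with
  | add f g hf hg =>
    obtain ⟨c, hc⟩ := hf
    obtain ⟨d, hd⟩ := hg
    refine ⟨c + d, ?_⟩
    simp only [Pi.add_apply, add_pow_expChar_pow, add_mul, Finset.sum_add_distrib]
    rw [← hc, ← hd]
  | monomial m a =>
    obtain ⟨b, hb⟩ := (bijective_iterateFrobenius k p n).surjective a
    rw [iterateFrobenius_def] at hb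
    refine ⟨Pi.single ⟨m % p ^ n, Nat.mod_lt _ hQ⟩ (Polynomial.monomial (m / p ^ n) b), ?_⟩
    rw [Finset.sum_eq_single ⟨m % p ^ n, Nat.mod_lt _ hQ⟩]
    · rw [Pi.single_eq_same, Polynomial.monomial_pow, hb, Polynomial.monomial_mul_X_pow,
        Nat.div_add_mod']
    · intro r _ hr
      rw [Pi.single_eq_of_ne hr, zero_pow hQ.ne', zero_mul]
    · simp

/-- The coefficient vectors that occur form a submodule `W` of a finite free module. Extracting the
unique `p ^ n`-th root is an `A`-linear map from `W` onto `C`, so `C` is finitely generated. -/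
theorem fg_of_forall_pow_eq_sum {A L : Type*} [CommRing A] [IsNoetherianRing A] [CommRing L]
    [IsReduced L] [Algebra A L] (p n : ℕ) [ExpChar A p] [ExpChar L p] (C : Submodule A L)
    {ι : Type*} [Fintype ι] (e : ι → L)
    (h : ∀ c ∈ C, ∃ a : ι → A, c ^ p ^ n = ∑ i, algebraMap A L (a i) ^ p ^ n * e i) : C.FG := by
  have hinj : ∀ x y : L, x ^ p ^ n = y ^ p ^ n → x = y := fun x y hxy =>
    iterateFrobenius_inj L p n (by simpa [iterateFrobenius_def] using hxy)
  let W : Submodule A (ι → A) :=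
    { carrier := {a | ∃ c ∈ C, c ^ p ^ n = ∑ i, algebraMap A L (a i) ^ p ^ n * e i}
      zero_mem' := ⟨0, zero_mem _, by
        simp [zero_pow (pow_pos (expChar_pos A p) n).ne']⟩
      add_mem' := by
        rintro a b ⟨c, hc, hca⟩ ⟨d, hd, hdb⟩
        refine ⟨c + d, add_mem hc hd, ?_⟩
        simp only [Pi.add_apply, map_add, add_pow_expChar_pow, add_mul, Finset.sum_add_distrib]
        rw [hca, hdb]
      smul_mem' := by
        rintro x a ⟨c, hc, hca⟩
        refine ⟨x • c, C.smul_mem x hc, ?_⟩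
        simp only [Pi.smul_apply, smul_eq_mul, map_mul, mul_pow, Algebra.smul_def, mul_assoc]
        rw [hca, Finset.mul_sum] }
  choose f hfC hf using fun a : W => a.2
  let F : W →ₗ[A] L :=
    { toFun := f
      map_add' := fun a b => hinj _ _ (by
        rw [hf, add_pow_expChar_pow, hf, hf, ← Finset.sum_add_distrib]
        simp [add_pow_expChar_pow, add_mul])
      map_smul' := fun x a => hinj _ _ (by
        rw [hf, RingHom.id_apply, Algebra.smul_def, mul_pow, hf, Finset.mul_sum]
        simp [mul_pow, mul_assoc]) }
  have hF : C = W.map (0 : (ι → A) →ₗ[A] L) ⊔ LinearMap.range F := by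
    apply le_antisymm
    · intro c hc
      obtain ⟨a, ha⟩ := h c hc
      refine Submodule.mem_sup_right ⟨⟨a, c, hc, ha⟩, hinj _ _ ?_⟩
      exact (hf _).trans ha.symm
    · refine sup_le ?_ ?_
      · rintro _ ⟨a, -, rfl⟩
        simp
      · rintro _ ⟨a, rfl⟩
        exact hfC a
  rw [Submodule.map_zero, bot_sup_eq] at hF
  rw [hF]
  have hW : Module.Finite A W := Module.IsNoetherian.finite A W
  exact Module.Finite.iff_fg.1 (Module.Finite.range F)

/-- The integral closure of `k[X]` in a finite extension of `k(X)` is a finite `k[X]`-module. -/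
theorem finite_integralClosure_polynomial {k : Type*} [Field k] [PerfectField k] (K L : Type*)
    [Field K] [Field L] [Algebra (Polynomial k) K] [IsFractionRing (Polynomial k) K]
    [Algebra (Polynomial k) L] [Algebra K L] [IsScalarTower (Polynomial k) K L]
    [FiniteDimensional K L] : Module.Finite (Polynomial k) (integralClosure (Polynomial k) L) := by
  obtain ⟨p, hp⟩ := ExpChar.exists k
  have : ExpChar K p := expChar_of_injective_algebraMap
    (IsFractionRing.injective (Polynomial k) K) p
  have : ExpChar L p := expChar_of_injective_algebraMap (algebraMap K L).injective p
  let E := separableClosure K L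
  have : ExpChar E p := expChar_of_injective_algebraMap (algebraMap K E).injective p
  have : IsScalarTower (Polynomial k) E L := IsScalarTower.of_algebraMap_eq fun x => by
    rw [IsScalarTower.algebraMap_apply (Polynomial k) K L,
      IsScalarTower.algebraMap_apply (Polynomial k) K E]
    rfl
  -- `L` is purely inseparable over `E` with bounded exponent, so `p ^ n`-th powers of integral
  -- elements lie in the integral closure in `E`, which is finite by separability.
  obtain ⟨n, hn⟩ := (IsPurelyInseparable.hasExponent_iff' (K := E) (L := L) p).1 inferInstance
  have hB : Module.Finite (Polynomial k) (integralClosure (Polynomial k) E) :=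
    IsIntegralClosure.finite (Polynomial k) K E _
  obtain ⟨m, b, hb⟩ := Module.Finite.exists_fin (R := Polynomial k)
    (M := integralClosure (Polynomial k) E)
  have hfg : (Subalgebra.toSubmodule (integralClosure (Polynomial k) L)).FG := by
    refine fg_of_forall_pow_eq_sum p n _ (fun i : Fin m × Fin (p ^ n) =>
      algebraMap (Polynomial k) L (Polynomial.X ^ (i.2 : ℕ)) * algebraMap E L (b i.1)) ?_
    intro c hc
    obtain ⟨d, hd⟩ := hn c
    have hdint : IsIntegral (Polynomial k) d := by
      have h1 : IsIntegral (Polynomial k) (algebraMap E L d) := hd ▸ IsIntegral.pow hc _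
      exact (isIntegral_algebraMap_iff (algebraMap E L).injective).1 h1
    obtain ⟨a, ha⟩ := (Submodule.mem_span_range_iff_exists_fun _).1
      (hb ▸ Submodule.mem_top : (⟨d, hdint⟩ : integralClosure (Polynomial k) E) ∈ _)
    choose c' hc' using fun i => exists_sum_pow_mul_X_pow p n (a i)
    refine ⟨fun i => c' i.1 i.2, ?_⟩
    have h2 := congrArg (fun x : integralClosure (Polynomial k) E => algebraMap E L x) ha
    simp only at h2
    rw [← hd, ← h2, Fintype.sum_prod_type, AddSubmonoidClass.coe_finsetSum, map_sum]
    refine Finset.sum_congr rfl fun i _ => ?_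
    rw [Subalgebra.coe_smul, Algebra.smul_def, map_mul, ← IsScalarTower.algebraMap_apply]
    conv_lhs => rw [hc' i]
    rw [map_sum, Finset.sum_mul]
    refine Finset.sum_congr rfl fun r _ => ?_
    rw [map_mul, map_pow, mul_assoc]
  exact Module.Finite.iff_fg.2 hfg

end FrobeniusFinite

/-! ### Noether normalization of affine curves. -/

section CurveRing

/-- The coordinate rings of affine algebraic curves. -/
structure IsCurveRing (k R : Type*) [Field k] [CommRing R] [Algebra k R] : Prop where
  finiteType : Algebra.FiniteType k R
  isReduced : IsReduced R
  not_isMaximal : ∀ p ∈ minimalPrimes R, ¬ p.IsMaximal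
  mem_minimalPrimes_or_isMaximal : ∀ p : Ideal R, p.IsPrime → p ∈ minimalPrimes R ∨ p.IsMaximal

namespace IsCurveRing

variable {k R : Type*} [Field k] [CommRing R] [Algebra k R]

theorem exists_isIntegral_aeval (h : IsCurveRing k R) :
    ∃ z : R, (Polynomial.aeval (R := k) z).toRingHom.IsIntegral := by
  rcases subsingleton_or_nontrivial R with hR | hR
  · exact ⟨0, fun x => ⟨Polynomial.X, Polynomial.monic_X, Subsingleton.elim _ _⟩⟩
  have := h.finiteType
  obtain ⟨s, g, hg, hint⟩ := exists_integral_inj_algHom_of_fg k R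
  -- With two variables, the kernel of setting the first one to `0` is neither zero nor maximal; by
  -- going up, a prime over it would be neither minimal nor maximal.
  have hs : s ≤ 1 := by
    by_contra! hs
    let : Algebra (MvPolynomial (Fin s) k) R := g.toRingHom.toAlgebra
    have : Algebra.IsIntegral (MvPolynomial (Fin s) k) R := ⟨hint⟩
    let i0 : Fin s := ⟨0, by omega⟩
    let i1 : Fin s := ⟨1, hs⟩
    let ψ : MvPolynomial (Fin s) k →ₐ[k] Polynomial k :=
      MvPolynomial.aeval fun i => if i = i0 then 0 else Polynomial.X
    have hψ : Function.Surjective ψ := by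
      intro f
      refine ⟨Polynomial.aeval (MvPolynomial.X i1) f, ?_⟩
      rw [← Polynomial.aeval_algHom_apply]
      have : ψ (MvPolynomial.X i1) = Polynomial.X := by simp [ψ, i0, i1]
      rw [this, Polynomial.aeval_X_left_apply]
    let q := RingHom.ker ψ
    have hqp : q.IsPrime := RingHom.ker_isPrime _
    have hqmax : ¬ q.IsMaximal := fun hq => by
      have e := RingHom.quotientKerEquivOfSurjective (f := ψ.toRingHom) hψ
      have hf : IsField (Polynomial k) :=
        e.toMulEquiv.symm.isField ((Ideal.Quotient.maximal_ideal_iff_isField_quotient _).1 hq)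
      exact Polynomial.not_isField k hf
    have hqbot : q ≠ ⊥ := fun hq => by
      have : MvPolynomial.X i0 ∈ q := by simp [q, ψ, RingHom.mem_ker]
      rw [hq, Ideal.mem_bot] at this
      exact MvPolynomial.X_ne_zero i0 this
    obtain ⟨P0, -, hP0, hP0'⟩ := Ideal.exists_ideal_over_prime_of_isIntegral
      (⊥ : Ideal (MvPolynomial (Fin s) k)) (⊥ : Ideal R) (by
        rw [← RingHom.ker_eq_comap_bot]
        exact ((RingHom.injective_iff_ker_eq_bot _).1 hg).le)
    obtain ⟨P1, hP01, hP1, hP1'⟩ := Ideal.exists_ideal_over_prime_of_isIntegral q P0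
      (hP0' ▸ bot_le)
    rcases h.mem_minimalPrimes_or_isMaximal P1 hP1 with hmin | hmax
    · have := hmin.2 ⟨hP0, bot_le⟩ hP01
      have := le_antisymm this hP01
      rw [this, hP0'] at hP1'
      exact hqbot hP1'.symm
    · exact hqmax (hP1' ▸ Ideal.isMaximal_comap_of_isIntegral_of_isMaximal P1)
  -- If `s = 0` then `R` is already integral over `k` and any `z` serves.
  let z : R := if hs : 0 < s then g (MvPolynomial.X ⟨0, hs⟩) else 0
  refine ⟨z, ?_⟩
  have hcomp : g.toRingHom = (Polynomial.aeval (R := k) z).toRingHom.comp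
      (MvPolynomial.aeval (R := k) (fun _ : Fin s => (Polynomial.X : Polynomial k))).toRingHom := by
    have : g = (Polynomial.aeval (R := k) z).comp
        (MvPolynomial.aeval (R := k) (fun _ : Fin s => (Polynomial.X : Polynomial k))) := by
      refine MvPolynomial.algHom_ext fun i => ?_
      have hs0 : 0 < s := i.pos
      have hi : i = ⟨0, hs0⟩ := Fin.ext (by omega)
      simp [z, hs0, hi]
    conv_lhs => rw [this]
    rfl
  have hint' : g.toRingHom.IsIntegral := hint
  rw [hcomp] at hint'
  exact RingHom.IsIntegral.tower_top _ _ hint'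

/-- If `R` is integral over `k[z]` then it is integral over `k[x + z ^ M]` for large `M`. -/
theorem exists_isIntegral_aeval_add_pow {z : R}
    (hz : (Polynomial.aeval (R := k) z).toRingHom.IsIntegral) (x : R) :
    ∃ M : ℕ, (Polynomial.aeval (R := k) (x + z ^ M)).toRingHom.IsIntegral := by
  obtain ⟨p, hp, hpx⟩ := hz (-x)
  -- `M` exceeds the degrees in `z` of all lower coefficients in the equation of `-x`.
  let M : ℕ := 1 + ∑ i ∈ Finset.range p.natDegree, (p.coeff i).natDegree
  refine ⟨M, ?_⟩
  set y := x + z ^ M with hy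
  let : Algebra (Polynomial k) R := (Polynomial.aeval (R := k) y).toRingHom.toAlgebra
  have hzint : IsIntegral (Polynomial k) z := by
    let T : Polynomial (Polynomial k) := Polynomial.X ^ M - Polynomial.C Polynomial.X
    have hT : T.Monic := Polynomial.monic_X_pow_sub_C _ (by omega)
    have hTdeg : T.natDegree = M := Polynomial.natDegree_X_pow_sub_C
    -- `T` takes the value `z ^ M - y = -x` at `z`, so `Q` is the equation of `-x` read as an
    -- equation for `z`. It is monic because the top power of `T` dominates, by the choice of `M`.
    let Q : Polynomial (Polynomial k) :=
      ∑ i ∈ Finset.range (p.natDegree + 1), (p.coeff i).map Polynomial.C * T ^ i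
    refine ⟨Q, ?_, ?_⟩
    · simp only [Q]
      rw [Finset.sum_range_succ, hp.coeff_natDegree, Polynomial.map_one, one_mul]
      have hdeg : (T ^ p.natDegree).degree = ((p.natDegree * M : ℕ) : WithBot ℕ) := by
        rw [Polynomial.degree_eq_natDegree (hT.pow _).ne_zero, Polynomial.natDegree_pow, hTdeg]
      refine (hT.pow _).add_of_right ?_
      refine (Polynomial.degree_sum_le _ _).trans_lt ?_
      rw [hdeg, Finset.sup_lt_iff (WithBot.bot_lt_coe _)]
      intro i hi
      have h1 : (p.coeff i).natDegree < M :=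
        Nat.lt_one_add_iff.2 (Finset.single_le_sum (f := fun i => (p.coeff i).natDegree)
          (fun _ _ => Nat.zero_le _) hi)
      rw [Finset.mem_range] at hi
      refine Polynomial.degree_le_natDegree.trans_lt (WithBot.coe_lt_coe.2 ?_)
      refine Polynomial.natDegree_mul_le.trans_lt ?_
      rw [Polynomial.natDegree_pow, hTdeg]
      have h2 := Polynomial.natDegree_map_le (f := (Polynomial.C : k →+* Polynomial k))
        (p := p.coeff i)
      nlinarith [Nat.mul_le_mul_right M (Nat.succ_le_of_lt hi)]
    · have hXy : algebraMap (Polynomial k) R Polynomial.X = y := Polynomial.aeval_X y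
      have hTz : Polynomial.eval₂ (algebraMap (Polynomial k) R) z T = -x := by
        simp only [T, Polynomial.eval₂_sub, Polynomial.eval₂_pow, Polynomial.eval₂_X,
          Polynomial.eval₂_C, hXy, hy]
        ring
      have hC : (algebraMap (Polynomial k) R).comp Polynomial.C = algebraMap k R :=
        RingHom.ext fun a => Polynomial.aeval_C y a
      rw [Polynomial.eval₂_eq_sum_range] at hpx
      simp only [Q, Polynomial.eval₂_finsetSum, Polynomial.eval₂_mul, Polynomial.eval₂_pow, hTz,
        Polynomial.eval₂_map, hC]
      exact hpx
  intro r
  obtain ⟨f, hf, hfr⟩ := hz r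
  let C := integralClosure (Polynomial k) R
  let ψ : Polynomial k →+* C :=
    Polynomial.eval₂RingHom ((algebraMap (Polynomial k) C).comp Polynomial.C) ⟨z, hzint⟩
  have hψ : (algebraMap C R).comp ψ = (Polynomial.aeval (R := k) z).toRingHom := by
    refine Polynomial.ringHom_ext (fun a => ?_) ?_
    · rw [RingHom.comp_apply, Polynomial.coe_eval₂RingHom, Polynomial.eval₂_C,
        RingHom.comp_apply, ← IsScalarTower.algebraMap_apply]
      exact (Polynomial.aeval_C y a).trans (Polynomial.aeval_C z a).symm
    · rw [RingHom.comp_apply, Polynomial.coe_eval₂RingHom, Polynomial.eval₂_X]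
      exact (Polynomial.aeval_X z).symm
  have hrC : IsIntegral C r := by
    refine ⟨f.map ψ, hf.map _, ?_⟩
    rw [Polynomial.eval₂_map, hψ]
    exact hfr
  exact isIntegral_trans (R := Polynomial k) r hrC

end IsCurveRing

end CurveRing

/-! ### The normalization is finite and nonsingular. -/

section CurveRing

namespace IsCurveRing

variable {k R : Type*} [Field k] [CommRing R] [Algebra k R]

theorem isNoetherianRing (h : IsCurveRing k R) : IsNoetherianRing R :=
  have := h.finiteType
  Algebra.FiniteType.isNoetherianRing k R

section Polynomial

variable [Algebra (Polynomial k) R] [Algebra.IsIntegral (Polynomial k) R]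

theorem comap_eq_bot_of_mem_minimalPrimes (h : IsCurveRing k R) {p : Ideal R}
    (hp : p ∈ minimalPrimes R) : p.comap (algebraMap (Polynomial k) R) = ⊥ := by
  have hpp : p.IsPrime := hp.1.1
  by_contra hbot
  have hmax : (p.comap (algebraMap (Polynomial k) R)).IsMaximal :=
    (inferInstance : (p.comap (algebraMap (Polynomial k) R)).IsPrime).isMaximal hbot
  exact h.not_isMaximal p hp (Ideal.isMaximal_of_isIntegral_of_isMaximal_comap p hmax)

theorem algebraMap_mem_nonZeroDivisors (h : IsCurveRing k R) {q : Polynomial k} (hq : q ≠ 0) :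
    algebraMap (Polynomial k) R q ∈ nonZeroDivisors R := by
  have := h.isReduced
  refine mem_nonZeroDivisors_of_forall_notMem_minimalPrimes fun p hp hqp => hq ?_
  have : q ∈ p.comap (algebraMap (Polynomial k) R) := hqp
  rwa [h.comap_eq_bot_of_mem_minimalPrimes hp] at this

theorem finite_polynomial [IsScalarTower k (Polynomial k) R] (h : IsCurveRing k R) : Module.Finite (Polynomial k) R := by
  have := h.finiteType
  have : Algebra.FiniteType (Polynomial k) R :=
    Algebra.FiniteType.of_restrictScalars_finiteType k (Polynomial k) R
  exact Algebra.IsIntegral.finite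

theorem algebraMap_normalization_mem_nonZeroDivisors {r : R} (hr : r ∈ nonZeroDivisors R) :
    algebraMap R (NormalizationRing R) r ∈ nonZeroDivisors (NormalizationRing R) := by
  rw [mem_nonZeroDivisors_iff_right]
  intro x hx
  have hu := IsLocalization.map_units (FractionRing R) (⟨r, hr⟩ : nonZeroDivisors R)
  refine Subtype.ext ((hu.mul_left_eq_zero).1 ?_)
  exact congrArg Subtype.val hx

theorem isFractionRing_normalization :
    IsFractionRing (NormalizationRing R) (FractionRing R) where
  map_units := by
    rintro ⟨u, hu⟩
    obtain ⟨⟨r, t⟩, hrt⟩ := IsLocalization.surj (nonZeroDivisors R) (u : FractionRing R)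
    have hr : r ∈ nonZeroDivisors R := by
      rw [mem_nonZeroDivisors_iff_right]
      intro x hx
      have h1 : algebraMap R (NormalizationRing R) (x * t) * u = 0 := by
        refine Subtype.ext ?_
        change algebraMap R (FractionRing R) (x * t) * (u : FractionRing R) = 0
        rw [map_mul, mul_assoc, mul_comm (algebraMap R (FractionRing R) t), hrt, ← map_mul, hx,
          map_zero]
      have h2 := (mul_right_mem_nonZeroDivisors_eq_zero_iff hu).1 h1
      rw [map_mul] at h2
      have h3 := (mul_right_mem_nonZeroDivisors_eq_zero_iff
        (algebraMap_normalization_mem_nonZeroDivisors t.2)).1 h2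
      exact IsFractionRing.injective R (FractionRing R)
        ((congrArg Subtype.val h3).trans (map_zero _).symm)
    exact isUnit_of_mul_isUnit_left (hrt ▸ IsLocalization.map_units (FractionRing R)
      (⟨r, hr⟩ : nonZeroDivisors R))
  surj := by
    intro x
    obtain ⟨⟨r, t⟩, hrt⟩ := IsLocalization.surj (nonZeroDivisors R) x
    exact ⟨⟨algebraMap R _ r, ⟨_, algebraMap_normalization_mem_nonZeroDivisors t.2⟩⟩, hrt⟩
  exists_of_eq := fun hxy => ⟨1, by rw [Subtype.ext hxy]⟩

theorem isTorsionFree_normalization (h : IsCurveRing k R) :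
    Module.IsTorsionFree (Polynomial k) (NormalizationRing R) := by
  refine Module.IsTorsionFree.of_smul_eq_zero fun q x hqx => ?_
  by_contra! hcon
  have hr := algebraMap_normalization_mem_nonZeroDivisors
    (h.algebraMap_mem_nonZeroDivisors hcon.1)
  rw [← IsScalarTower.algebraMap_apply] at hr
  rw [Algebra.smul_def] at hqx
  exact hcon.2 ((mul_left_mem_nonZeroDivisors_eq_zero_iff hr).1 hqx)

end Polynomial

/-- The canonical map from the total ring of fractions to the residue field of a minimal prime. -/
noncomputable def toFractionRingQuotient (p : Ideal R) (hp : p ∈ minimalPrimes R) :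
    FractionRing R →+* FractionRing (R ⧸ p) :=
  have hpp : p.IsPrime := hp.1.1
  IsLocalization.map (M := nonZeroDivisors R) (T := nonZeroDivisors (R ⧸ p))
    (FractionRing (R ⧸ p)) (Ideal.Quotient.mk p) (fun x hx => by
      refine Submonoid.mem_comap.2 (mem_nonZeroDivisors_of_ne_zero fun h0 => ?_)
      exact Set.disjoint_left.1 (Ideal.disjoint_nonZeroDivisors_of_mem_minimalPrimes hp)
        (Ideal.Quotient.eq_zero_iff_mem.1 h0) hx)

theorem toFractionRingQuotient_algebraMap (p : Ideal R) (hp : p ∈ minimalPrimes R) (r : R) :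
    toFractionRingQuotient p hp (algebraMap R _ r) =
      algebraMap (R ⧸ p) _ (Ideal.Quotient.mk p r) := by
  unfold toFractionRingQuotient
  exact IsLocalization.map_eq (M := nonZeroDivisors R) (S := FractionRing R) _ r

theorem toFractionRingQuotient_comp_algebraMap {A : Type*} [CommRing A] [Algebra A R]
    (p : Ideal R) (hp : p ∈ minimalPrimes R) :
    (toFractionRingQuotient p hp).comp (algebraMap A (FractionRing R)) =
      algebraMap A (FractionRing (R ⧸ p)) := by
  ext a
  rw [RingHom.comp_apply, IsScalarTower.algebraMap_apply A R, toFractionRingQuotient_algebraMap]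
  rfl

theorem eq_zero_of_forall_toFractionRingQuotient [IsReduced R] {x : FractionRing R}
    (hx : ∀ (p : Ideal R) (hp : p ∈ minimalPrimes R), toFractionRingQuotient p hp x = 0) :
    x = 0 := by
  obtain ⟨⟨r, s⟩, hrs⟩ := IsLocalization.surj (nonZeroDivisors R) x
  have hr : r = 0 := by
    have : r ∈ nilradical R := by
      rw [nilradical, ← Ideal.sInf_minimalPrimes, Ideal.mem_sInf]
      intro p hp
      have hpp : p.IsPrime := hp.1.1
      have h1 := congrArg (toFractionRingQuotient p hp) hrs
      rw [map_mul, hx p hp, zero_mul, toFractionRingQuotient_algebraMap] at h1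
      rw [← Ideal.Quotient.eq_zero_iff_mem]
      exact (IsFractionRing.injective (R ⧸ p) (FractionRing (R ⧸ p))) (by rw [← h1, map_zero])
    simpa using this
  have hs := IsLocalization.map_units (FractionRing R) s
  rw [hr, map_zero, hs.mul_left_eq_zero] at hrs
  exact hrs

/-- The normalization embeds into the product, over the minimal primes `p`, of the integral closures
of `k[X]` in the fraction fields of `R ⧸ p`. -/
theorem finite_normalization_polynomial [PerfectField k] [Algebra (Polynomial k) R]
    [IsScalarTower k (Polynomial k) R] [Algebra.IsIntegral (Polynomial k) R]
    (h : IsCurveRing k R) : Module.Finite (Polynomial k) (NormalizationRing R) := by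
  have := h.isNoetherianRing
  have := h.isReduced
  have := h.finite_polynomial
  have hfin : Finite (minimalPrimes R) := minimalPrimes.finite_of_isNoetherianRing R
  have hpr : ∀ p : minimalPrimes R, p.1.IsPrime := fun p => p.2.1.1
  have hC : ∀ p : minimalPrimes R,
      Module.Finite (Polynomial k) (integralClosure (Polynomial k) (FractionRing (R ⧸ p.1))) := by
    intro p
    have hinj : Function.Injective (algebraMap (Polynomial k) (R ⧸ p.1)) := by
      rw [RingHom.injective_iff_ker_eq_bot, IsScalarTower.algebraMap_eq (Polynomial k) R,
        ← RingHom.comap_ker]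
      rw [show RingHom.ker (algebraMap R (R ⧸ p.1)) = p.1 from Ideal.mk_ker]
      exact h.comap_eq_bot_of_mem_minimalPrimes p.2
    have : FaithfulSMul (Polynomial k) (R ⧸ p.1) :=
      (faithfulSMul_iff_algebraMap_injective _ _).2 hinj
    have : Module.Finite (Polynomial k) (R ⧸ p.1) :=
      Module.Finite.of_surjective (IsScalarTower.toAlgHom (Polynomial k) R (R ⧸ p.1)).toLinearMap
        Ideal.Quotient.mk_surjective
    let K := FractionRing (Polynomial k)
    let : Algebra K (FractionRing (R ⧸ p.1)) := FractionRing.liftAlgebra _ _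
    have : IsScalarTower (Polynomial k) K (FractionRing (R ⧸ p.1)) := inferInstance
    have : FiniteDimensional K (FractionRing (R ⧸ p.1)) :=
      Module.Finite.of_isLocalization (Polynomial k) (R ⧸ p.1) (nonZeroDivisors (Polynomial k))
    exact finite_integralClosure_polynomial K _
  let f : NormalizationRing R →ₗ[Polynomial k]
      (∀ p : minimalPrimes R, integralClosure (Polynomial k) (FractionRing (R ⧸ p.1))) :=
    LinearMap.pi fun p =>
      { toFun := fun x => ⟨toFractionRingQuotient p.1 p.2 x, by
          have h1 : IsIntegral R (x : FractionRing R) := x.2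
          have h2 : IsIntegral (Polynomial k) (x : FractionRing R) := isIntegral_trans _ h1
          obtain ⟨q, hq, hqx⟩ := h2
          refine ⟨q, hq, ?_⟩
          have := congrArg (toFractionRingQuotient p.1 p.2) hqx
          rw [Polynomial.hom_eval₂, map_zero] at this
          rwa [toFractionRingQuotient_comp_algebraMap] at this⟩
        map_add' := fun x y => Subtype.ext (by simp)
        map_smul' := fun q x => Subtype.ext (by
          rw [Algebra.smul_def, RingHom.id_apply, Algebra.smul_def]
          push_cast
          rw [map_mul]
          congr 1
          exact RingHom.congr_fun (toFractionRingQuotient_comp_algebraMap p.1 p.2) q) }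
  refine Module.Finite.of_injective f ?_
  rw [← LinearMap.ker_eq_bot, LinearMap.ker_eq_bot']
  intro x hx
  refine Subtype.ext (eq_zero_of_forall_toFractionRingQuotient fun p hp => ?_)
  exact congrArg Subtype.val (congrFun hx ⟨p, hp⟩)

theorem finite_normalization [PerfectField k] (h : IsCurveRing k R) :
    Module.Finite R (NormalizationRing R) := by
  obtain ⟨z, hz⟩ := h.exists_isIntegral_aeval
  let : Algebra (Polynomial k) R := (Polynomial.aeval (R := k) z).toRingHom.toAlgebra
  have : IsScalarTower k (Polynomial k) R := IsScalarTower.of_algebraMap_eq fun a =>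
    (Polynomial.aeval_C z a).symm
  have : Algebra.IsIntegral (Polynomial k) R := ⟨hz⟩
  have := h.finite_normalization_polynomial
  exact Module.Finite.of_restrictScalars_finite (Polynomial k) R (NormalizationRing R)

theorem isNormalCurveRing [PerfectField k] (h : IsCurveRing k R) :
    IsNormalCurveRing (NormalizationRing R) (FractionRing R) := by
  have hfin := h.finite_normalization
  have := h.isNoetherianRing
  have := h.isReduced
  obtain ⟨z, hz⟩ := h.exists_isIntegral_aeval
  let : Algebra (Polynomial k) R := (Polynomial.aeval (R := k) z).toRingHom.toAlgebra
  have : IsScalarTower k (Polynomial k) R := IsScalarTower.of_algebraMap_eq fun a =>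
    (Polynomial.aeval_C z a).symm
  have : Algebra.IsIntegral (Polynomial k) R := ⟨hz⟩
  have := h.finite_normalization_polynomial
  have hred : IsReduced (FractionRing R) :=
    isReduced_localizationPreserves (nonZeroDivisors R) _ inferInstance
  refine ⟨IsNoetherianRing.of_finite R _, ?_, ?_, ?_, ?_⟩
  · exact isReduced_of_injective (algebraMap (NormalizationRing R) (FractionRing R))
      Subtype.val_injective
  · exact isFractionRing_normalization
  · intro x hx
    exact ⟨⟨x, isIntegral_trans (R := R) x hx⟩, rfl⟩
  · intro P hP
    -- The non-zero-divisor over which `P` is minimal comes from `k[X]`: by integrality `P`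
    -- contracts to a maximal, hence nonzero, ideal there.
    have hne : P.comap (algebraMap (Polynomial k) (NormalizationRing R)) ≠ ⊥ := fun hbot => by
      have hmax := Ideal.isMaximal_comap_of_isIntegral_of_isMaximal (R := Polynomial k) P
      rw [hbot] at hmax
      exact Polynomial.not_isField k (Ring.isField_iff_maximal_bot.2 hmax)
    obtain ⟨q, hq, hq0⟩ := Submodule.exists_mem_ne_zero_of_ne_bot hne
    refine ⟨algebraMap (Polynomial k) _ q, ?_, ⟨⟨hP.isPrime, ?_⟩, ?_⟩⟩
    · rw [IsScalarTower.algebraMap_apply (Polynomial k) R]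
      exact algebraMap_normalization_mem_nonZeroDivisors (h.algebraMap_mem_nonZeroDivisors hq0)
    · exact (Ideal.span_singleton_le_iff_mem _).2 hq
    · rintro Q ⟨hQ, hQq⟩ hQP
      have hQmax : Q.IsMaximal := by
        refine Ideal.isMaximal_of_isIntegral_of_isMaximal_comap (R := Polynomial k) Q ?_
        refine (inferInstance : (Q.comap (algebraMap (Polynomial k) _)).IsPrime).isMaximal ?_
        intro hbot
        have : q ∈ Q.comap (algebraMap (Polynomial k) (NormalizationRing R)) :=
          hQq (Ideal.mem_span_singleton_self _)
        rw [hbot] at this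
        exact hq0 this
      exact (hQmax.eq_of_le hP.ne_top hQP).ge

end IsCurveRing

end CurveRing

/-! ### Differentials of the normalization. -/

section Differentials

/-- On the generators `m, v i` the relations `d m = 0` and `r v i = c i m` form a triangular matrix
with determinant `d * r ^ n`. -/
theorem mul_pow_mem_fittingIdeal_zero {S M : Type*} [CommRing S] [AddCommGroup M] [Module S M]
    {n : ℕ} (v : Fin n → M) (hv : Submodule.span S (Set.range v) = ⊤) {m : M} {d r : S}
    (hd : d • m = 0) (hr : ∀ i, r • v i ∈ Submodule.span S {m}) :
    d * r ^ n ∈ fittingIdeal S M 0 := by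
  choose c hc using fun i => Submodule.mem_span_singleton.1 (hr i)
  have hv' : Submodule.span S (Set.range (Fin.cons m v : Fin (n + 1) → M)) = ⊤ := by
    rw [eq_top_iff, ← hv]
    refine Submodule.span_mono ?_
    rintro _ ⟨i, rfl⟩
    exact ⟨i.succ, by simp⟩
  let B : Matrix (Fin (n + 1)) (Fin (n + 1)) S :=
    Matrix.of (Fin.cons (Fin.cons d 0) fun i => Fin.cons (-c i) (Pi.single i r))
  have hB : ∀ i, ∑ j, B i j • (Fin.cons m v : Fin (n + 1) → M) j = 0 := by
    intro i
    rw [Fin.sum_univ_succ]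
    refine Fin.cases ?_ (fun i => ?_) i
    · simp [B, hd]
    · simp [B, Pi.single_apply, ite_smul, hc]
  have hdet : B.det = d * r ^ n := by
    rw [Matrix.det_succ_row_zero, Fin.sum_univ_succ]
    have : B.submatrix Fin.succ (Fin.succAbove 0) = Matrix.diagonal fun _ => r := by
      ext i j
      simp [B, Matrix.diagonal_apply, Pi.single_apply, eq_comm]
    rw [this, Matrix.det_diagonal]
    simp [B]
  rw [fittingIdeal_eq_minorIdeal _ hv', ← hdet]
  exact det_mem_minorIdeal B hB id

theorem exists_forall_mul_eq_algebraMap {R S : Type*} [CommRing R] [CommRing S] [Algebra R S]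
    [Module.Finite R S]
    (hRS : ∀ s : S, ∃ r r' : R, algebraMap R S r ∈ nonZeroDivisors S ∧
      algebraMap R S r * s = algebraMap R S r') :
    ∃ r : R, algebraMap R S r ∈ nonZeroDivisors S ∧
      ∀ s, ∃ r', algebraMap R S r * s = algebraMap R S r' := by
  have key : ∀ N : Submodule R S, N.FG → ∃ r : R, algebraMap R S r ∈ nonZeroDivisors S ∧
      ∀ s ∈ N, ∃ r', algebraMap R S r * s = algebraMap R S r' := by
    intro N hN
    induction N, hN using Submodule.fg_induction with
    | singleton y =>
      obtain ⟨r, r', hr, h⟩ := hRS y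
      refine ⟨r, hr, fun x hx => ?_⟩
      obtain ⟨a, rfl⟩ := Submodule.mem_span_singleton.1 hx
      exact ⟨a * r', by rw [Algebra.smul_def, map_mul, ← h]; ring⟩
    | sup N₁ N₂ _ _ h₁ h₂ =>
      obtain ⟨r₁, hr₁, h₁⟩ := h₁
      obtain ⟨r₂, hr₂, h₂⟩ := h₂
      refine ⟨r₁ * r₂, by rw [map_mul]; exact mul_mem hr₁ hr₂, fun x hx => ?_⟩
      obtain ⟨y, hy, z, hz, rfl⟩ := Submodule.mem_sup.1 hx
      obtain ⟨y', hy'⟩ := h₁ y hy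
      obtain ⟨z', hz'⟩ := h₂ z hz
      exact ⟨r₂ * y' + r₁ * z', by
        rw [map_add, map_mul, map_mul, map_mul, ← hy', ← hz']; ring⟩
  obtain ⟨r, hr, h⟩ := key ⊤ Module.Finite.fg_top
  exact ⟨r, hr, fun s => h s trivial⟩

theorem algebraMap_smul_kaehlerDifferential_eq_zero {R S : Type*} [CommRing R] [CommRing S]
    [Algebra R S] {r : R} (hr : ∀ s, ∃ r', algebraMap R S r * s = algebraMap R S r')
    (x : Ω[S⁄R]) : algebraMap R S r • x = 0 := by
  have hx : x ∈ Submodule.span S (Set.range (KaehlerDifferential.D R S)) := by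
    rw [KaehlerDifferential.span_range_derivation]; trivial
  induction hx using Submodule.span_induction with
  | mem x hx =>
    obtain ⟨s, rfl⟩ := hx
    obtain ⟨r', hr'⟩ := hr s
    rw [algebraMap_smul, ← Derivation.map_smul, Algebra.smul_def, hr', Derivation.map_algebraMap]
  | zero => rw [smul_zero]
  | add x y _ _ hx hy => rw [smul_add, hx, hy, add_zero]
  | smul a x _ hx => rw [smul_comm, hx, smul_zero]

/-- A common denominator of `S` over `R` kills `Ω[S⁄R]`, so one of its powers lies in the Fitting
ideal. -/
theorem exists_mem_fittingIdeal_mem_nonZeroDivisors {R S : Type*} [CommRing R] [CommRing S]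
    [Algebra R S] [Module.Finite R S]
    (hRS : ∀ s : S, ∃ r r' : R, algebraMap R S r ∈ nonZeroDivisors S ∧
      algebraMap R S r * s = algebraMap R S r') :
    ∃ x ∈ fittingIdeal S (Ω[S⁄R]) 0, x ∈ nonZeroDivisors S := by
  obtain ⟨r, hr, hrS⟩ := exists_forall_mul_eq_algebraMap hRS
  obtain ⟨n, v, hv⟩ := Module.Finite.exists_fin (R := S) (M := Ω[S⁄R])
  refine ⟨algebraMap R S r ^ n, ?_, pow_mem hr n⟩
  have := mul_pow_mem_fittingIdeal_zero v hv (m := 0) (d := 1) (r := algebraMap R S r)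
    (smul_zero _) fun i => by
      rw [algebraMap_smul_kaehlerDifferential_eq_zero hrS]; exact zero_mem _
  rwa [one_mul] at this

variable {R S L : Type*} [CommRing R] [CommRing S] [CommRing L] [Algebra S L] [Algebra R S]

namespace IsNormalCurveRing

theorem ordAt_ne_top_of_mem (h : IsNormalCurveRing S L) {I : Ideal S} {x : S} (hx : x ∈ I)
    (hx0 : x ∈ nonZeroDivisors S) (P : MaximalSpectrum S) : ordAt P I ≠ ⊤ := by
  intro htop
  rcases h.ordAt_cases P I with ⟨n, -, hn'⟩ | ⟨hn, -⟩
  · rw [hn'] at htop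
    exact ENat.natCast_ne_top _ htop
  · have h1 : algebraMap S (Localization.AtPrime P.asIdeal) x = 0 := by
      rw [← Ideal.mem_bot, ← hn]
      exact Ideal.mem_map_of_mem _ hx
    obtain ⟨s, hs⟩ := (IsLocalization.map_eq_zero_iff P.asIdeal.primeCompl _ x).1 h1
    exact s.2 (((mul_right_mem_nonZeroDivisors_eq_zero_iff hx0).1 hs) ▸ zero_mem _)

variable {k : Type*} [Field k] [IsAlgClosed k] [Algebra k R] [Algebra k S] [IsScalarTower k R S]

/-- The residue field at `P` is `k`, so up to a constant, which has zero differential, `x` lies in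
`P`. There it is locally a multiple of a uniformizer `t`, and Leibniz leaves a multiple of `dt`
modulo `P`. -/
theorem top_le_span_D_sup (h : IsNormalCurveRing S L) [Algebra.FiniteType k S] (P : Ideal S)
    [hP : P.IsMaximal] : ∃ t : S, (⊤ : Submodule S (Ω[S⁄R])) ≤
      Submodule.span S {KaehlerDifferential.D R S t} ⊔ P • ⊤ := by
  obtain ⟨r₀, hr₀, hPr⟩ := h.exists_mem_minimalPrimes P hP
  have hord : ordAt ⟨P, hP⟩ P ≠ ⊤ :=
    h.ordAt_ne_top_of_mem ((Ideal.span_singleton_le_iff_mem _).1 hPr.1.2) hr₀ ⟨P, hP⟩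
  obtain ⟨t, htP, -, s, hs, hst⟩ := h.exists_generator ⟨P, hP⟩ hord
  refine ⟨t, ?_⟩
  conv_lhs => rw [← KaehlerDifferential.span_range_derivation]
  rw [Submodule.span_le]
  rintro _ ⟨x, rfl⟩
  have hsurj : Function.Surjective (algebraMap k (S ⧸ P)) := by
    let := Ideal.Quotient.field P
    have : Module.Finite k (S ⧸ P) := finite_of_finite_type_of_isJacobsonRing k (S ⧸ P)
    exact IsAlgClosed.algebraMap_bijective_of_isIntegral.2
  obtain ⟨c, hc⟩ := hsurj (Ideal.Quotient.mk P x)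
  set y := x - algebraMap k S c with hy
  have hyP : y ∈ P := by
    rw [← Ideal.Quotient.eq_zero_iff_mem, hy, map_sub, ← hc]
    exact sub_self _
  have hDx : KaehlerDifferential.D R S x = KaehlerDifferential.D R S y := by
    rw [hy, map_sub, IsScalarTower.algebraMap_apply k R S, Derivation.map_algebraMap, sub_zero]
  obtain ⟨u, hu⟩ := Ideal.mem_span_singleton'.1 (hst y hyP)
  have hsD : s • KaehlerDifferential.D R S y ∈
      Submodule.span S {KaehlerDifferential.D R S t} ⊔ P • (⊤ : Submodule S (Ω[S⁄R])) := by
    have h1 := congrArg (KaehlerDifferential.D R S) hu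
    rw [Derivation.leibniz, Derivation.leibniz] at h1
    rw [← eq_sub_iff_add_eq] at h1
    have h2 : s • KaehlerDifferential.D R S y = u • KaehlerDifferential.D R S t +
        (t • KaehlerDifferential.D R S u - y • KaehlerDifferential.D R S s) := by
      rw [← add_sub_assoc, h1]; abel
    rw [h2]
    exact Submodule.add_mem_sup
      (Submodule.smul_mem _ _ (Submodule.mem_span_singleton_self _))
      (sub_mem (Submodule.smul_mem_smul htP trivial) (Submodule.smul_mem_smul hyP trivial))
  obtain ⟨v, i, hi, hvi⟩ := hP.exists_inv hs
  change KaehlerDifferential.D R S x ∈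
    Submodule.span S {KaehlerDifferential.D R S t} ⊔ P • (⊤ : Submodule S (Ω[S⁄R]))
  rw [hDx, ← one_smul S (KaehlerDifferential.D R S y), ← hvi, add_smul, mul_smul]
  exact add_mem (Submodule.smul_mem _ _ hsD)
    (Submodule.mem_sup_right (Submodule.smul_mem_smul hi trivial))

/-- By Nakayama `Ω[S⁄R]` is locally cyclic, and for cyclic modules the annihilator is the zeroth
Fitting ideal. -/
theorem mem_fittingIdeal_kaehlerDifferential (h : IsNormalCurveRing S L) [Algebra.FiniteType k S]
    {d : S} (hd : ∀ x : S, d • KaehlerDifferential.D R S x = 0) :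
    d ∈ fittingIdeal S (Ω[S⁄R]) 0 := by
  have : Algebra.FiniteType R S := Algebra.FiniteType.of_restrictScalars_finiteType k R S
  obtain ⟨n, v, hv⟩ := Module.Finite.exists_fin (R := S) (M := Ω[S⁄R])
  refine mem_of_forall_exists_mul_mem fun P hP => ?_
  obtain ⟨t, ht⟩ := h.top_le_span_D_sup (k := k) (R := R) P
  obtain ⟨r, hr, hrN⟩ := Submodule.exists_sub_one_mem_and_smul_le_of_fg_of_le_sup
    (Module.Finite.fg_top (R := S) (M := Ω[S⁄R])) le_top ht
  have hrP : r ∉ P := fun h' => (Ideal.ne_top_iff_one _).1 hP.ne_top (by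
    simpa using sub_mem h' hr)
  refine ⟨r ^ n, fun h' => hrP (hP.isPrime.mem_of_pow_mem _ h'), ?_⟩
  rw [mul_comm]
  exact mul_pow_mem_fittingIdeal_zero v hv (hd t) fun i =>
    hrN (Submodule.smul_mem_pointwise_smul _ _ _ trivial)

theorem ordAt_fittingIdeal_ne_top (h : IsNormalCurveRing S L) [Module.Finite R S]
    (hRS : ∀ s : S, ∃ r r' : R, algebraMap R S r ∈ nonZeroDivisors S ∧
      algebraMap R S r * s = algebraMap R S r') (P : MaximalSpectrum S) :
    ordAt P (fittingIdeal S (Ω[S⁄R]) 0) ≠ ⊤ := by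
  obtain ⟨x, hx, hx0⟩ := exists_mem_fittingIdeal_mem_nonZeroDivisors hRS
  exact h.ordAt_ne_top_of_mem hx hx0 P

end IsNormalCurveRing

end Differentials

/-! ### Functionals that are units at a given point. -/

section Dual

/-- The localization of `M` at `P` is finite, torsion free and nonzero over a discrete valuation
ring, hence free. A coordinate functional lifts, up to a denominator, because `M` is finitely
presented. -/
theorem IsNormalCurveRing.exists_linearMap_notMem {S L : Type*} [CommRing S] [CommRing L]
    [Algebra S L] (h : IsNormalCurveRing S L) (P : Ideal S) [hP : P.IsMaximal] {M : Type*}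
    [AddCommGroup M] [Module S M] [Module.Finite S M]
    (htf : ∀ r ∈ nonZeroDivisors S, ∀ m : M, r • m = 0 → m = 0)
    (hne : ∀ s ∉ P, ∃ m : M, s • m ≠ 0) : ∃ (f : M →ₗ[S] S) (m : M), f m ∉ P := by
  obtain ⟨_, _⟩ := h.isDiscreteValuationRing P
  have := h.isNoetherianRing
  have := h.isFractionRing
  let O := Localization.AtPrime P
  let N := LocalizedModule P.primeCompl M
  have : Module.IsTorsionFree O N := by
    refine Module.IsTorsionFree.of_smul_eq_zero fun a x hax => ?_
    obtain ⟨r, s, rfl⟩ := IsLocalization.exists_mk'_eq P.primeCompl a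
    obtain ⟨⟨m, t⟩, rfl⟩ := IsLocalizedModule.mk'_surjective P.primeCompl
      (LocalizedModule.mkLinearMap P.primeCompl M) x
    rw [Function.uncurry_apply_pair, IsLocalizedModule.mk'_smul_mk',
      IsLocalizedModule.mk'_eq_zero'] at hax
    obtain ⟨u, hu⟩ := hax
    obtain ⟨e, hee, her, w, hw⟩ := h.exists_idempotent r
    by_cases he : e ∈ P
    · left
      rw [IsLocalization.mk'_eq_zero_iff]
      refine ⟨⟨1 - e, fun h' => (Ideal.ne_top_iff_one _).1 hP.ne_top (by
        simpa using add_mem h' he)⟩, ?_⟩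
      rw [sub_mul, one_mul, her, sub_self]
    · right
      rw [Function.uncurry_apply_pair, IsLocalizedModule.mk'_eq_zero']
      refine ⟨⟨e, he⟩ * u, ?_⟩
      have hnzd : r + (1 - e) ∈ nonZeroDivisors S := by
        rw [mem_nonZeroDivisors_iff_right]
        intro y hy
        have h1 : r * y = 0 := by
          linear_combination e * hy - y * her + y * hee
        have h2 : e * y = 0 := by
          refine IsFractionRing.injective S L ?_
          rw [map_mul, ← hw, mul_right_comm, ← map_mul, h1, map_zero, zero_mul]
        linear_combination hy - h1 + h2
      refine htf _ hnzd _ ?_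
      have h1 : (r + (1 - e)) • ((⟨e, he⟩ : P.primeCompl) * u) • m =
          e • (u • r • m) + (u : S) • (e - e * e) • m := by
        simp only [Submonoid.smul_def, Submonoid.coe_mul]
        module
      rw [h1, hu, hee, sub_self, zero_smul, smul_zero, smul_zero, zero_add]
  have : Module.Free O N := Module.free_of_finite_type_torsion_free'
  have : Nontrivial N := by
    have : (⟨P, hP.isPrime⟩ : PrimeSpectrum S) ∈ Module.support S M := by
      rw [Module.mem_support_iff_of_finite]
      intro s hs
      by_contra hsP
      obtain ⟨m, hm⟩ := hne s hsP
      exact hm (Module.mem_annihilator.1 hs m)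
    exact Module.mem_support_iff.1 this
  let b := Module.Free.chooseBasis O N
  obtain ⟨i⟩ : Nonempty (Module.Free.ChooseBasisIndex O N) := b.index_nonempty
  have : Module.FinitePresentation S M := Module.finitePresentation_of_finite S M
  obtain ⟨f, u, hfu⟩ := Module.FinitePresentation.exists_lift_of_isLocalizedModule P.primeCompl
    (Algebra.linearMap S O)
    (((b.coord i).restrictScalars S) ∘ₗ LocalizedModule.mkLinearMap P.primeCompl M)
  obtain ⟨⟨m, t⟩, hmt⟩ := IsLocalizedModule.surj P.primeCompl
    (LocalizedModule.mkLinearMap P.primeCompl M) (b i)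
  refine ⟨f, m, fun hfm => ?_⟩
  have h1 := LinearMap.congr_fun hfu m
  rw [LinearMap.comp_apply, LinearMap.smul_apply, LinearMap.comp_apply, ← hmt] at h1
  have h2 : algebraMap S O (f m) = algebraMap S O (u * t) := by
    rw [Algebra.linearMap_apply] at h1
    rw [h1]
    simp [Submonoid.smul_def, Algebra.smul_def]
  have h3 : algebraMap S O (f m) ∈ IsLocalRing.maximalIdeal O :=
    (IsLocalization.AtPrime.to_map_mem_maximal_iff O P _).2 hfm
  rw [h2, IsLocalization.AtPrime.to_map_mem_maximal_iff O P] at h3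
  exact (u * t).2 h3

variable (A S : Type*) [CommRing A] [CommRing S] [Algebra A S]

/-- The `S`-module structure on the `A`-linear dual of `S`. -/
abbrev dualModule : Module S (S →ₗ[A] A) where
  smul s φ := φ ∘ₗ LinearMap.mulLeft A s
  one_smul φ := LinearMap.ext fun x => congrArg φ (one_mul x)
  mul_smul s t φ := LinearMap.ext fun x => congrArg φ (by simp [mul_left_comm])
  smul_zero s := rfl
  smul_add s φ ψ := rfl
  add_smul s t φ := LinearMap.ext fun x => (congrArg φ (add_mul s t x)).trans (map_add φ _ _)
  zero_smul φ := LinearMap.ext fun x => (congrArg φ (zero_mul x)).trans (map_zero φ)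

variable {A S}

theorem IsNormalCurveRing.exists_dual_map_notMem {L : Type*} [CommRing L] [Algebra S L]
    [IsDomain A] (h : IsNormalCurveRing S L) [Module.Free A S] [Module.Finite A S]
    (P : Ideal S) [hP : P.IsMaximal] :
    ∃ H : (S →ₗ[A] A) →ₗ[A] S,
      (∀ (s : S) (φ : S →ₗ[A] A), H (φ ∘ₗ LinearMap.mulLeft A s) = s * H φ) ∧
        ∃ φ, H φ ∉ P := by
  let inst : Module S (S →ₗ[A] A) := dualModule A S
  have tower : IsScalarTower A S (S →ₗ[A] A) := ⟨fun a s φ => LinearMap.ext fun x => by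
    change φ ((a • s) * x) = a • φ (s * x)
    rw [smul_mul_assoc, map_smul]⟩
  have : Module.Finite S (S →ₗ[A] A) := Module.Finite.of_restrictScalars_finite A S _
  obtain ⟨f, φ, hφ⟩ := h.exists_linearMap_notMem P (M := S →ₗ[A] A) (by
    intro r hr φ hφ
    obtain ⟨p, hp, hpr⟩ := Algebra.IsIntegral.isIntegral (R := A) r
    -- A nonzero coefficient of the integral equation of `r` is a multiple of `r`, which reduces
    -- torsion by `r` to torsion over the domain `A`.
    obtain ⟨i, hi, hir⟩ := Ideal.exists_coeff_ne_zero_mem_comap_of_non_zero_divisor_root_mem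
      (f := algebraMap A S) (I := Ideal.span {r})
      (fun hx => (mul_right_mem_nonZeroDivisors_eq_zero_iff hr).1 hx)
      (Ideal.mem_span_singleton_self r) hp.ne_zero hpr
    obtain ⟨t, ht⟩ := Ideal.mem_span_singleton'.1 (Ideal.mem_comap.1 hir)
    refine LinearMap.ext fun x => (mul_eq_zero.1 (?_ : p.coeff i * φ x = 0)).resolve_left hi
    have h1 : φ (r * (t * x)) = 0 := LinearMap.congr_fun hφ (t * x)
    rw [← smul_eq_mul, ← map_smul, Algebra.smul_def, ← ht, ← h1]
    congr 1
    ring) (by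
    intro s hs
    by_contra! hcon
    have hs0 : s ≠ 0 := fun h0 => hs (h0 ▸ zero_mem _)
    refine hs0 ?_
    let b := Module.Free.chooseBasis A S
    refine b.ext_elem_iff.2 fun i => ?_
    have h1 : b.coord i (s * 1) = 0 := LinearMap.congr_fun (hcon (b.coord i)) 1
    rw [mul_one] at h1
    simpa using h1)
  exact ⟨f.restrictScalars A, fun s ψ => f.map_smul s ψ, φ, hφ⟩

end Dual

/-! ### The inclusion of `Î(𝒪_X)` in `𝒪_X`. -/

section Birational

open scoped TensorProduct

theorem smul_D_eq_zero_of_smul_D_eq_zero {A R S : Type*} [CommRing A] [CommRing R] [CommRing S]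
    [Algebra A R] [Algebra A S] [Algebra R S] [IsScalarTower A R S] {d x : S}
    (h : d • KaehlerDifferential.D A S x = 0) : d • KaehlerDifferential.D R S x = 0 := by
  have := congrArg (KaehlerDifferential.map A R S S) h
  rwa [map_smul, KaehlerDifferential.map_D, map_zero] at this

theorem IsNormalCurveRing.mul_lmul_mem_range {k A R S L : Type*} [Field k] [IsAlgClosed k]
    [CommRing A] [IsDomain A] [CommRing R] [CommRing S] [CommRing L] [Algebra k R] [Algebra k S]
    [Algebra R S] [IsScalarTower k R S] [Algebra.FiniteType k S] [Algebra A R] [Algebra A S]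
    [IsScalarTower A R S] [Algebra S L] (h : IsNormalCurveRing S L) [Module.Free A S]
    [Module.Finite A S]
    (hRS : ∀ s : S, ∃ r r' : R, algebraMap R S r ∈ nonZeroDivisors S ∧
      algebraMap R S r * s = algebraMap R S r') {z : R ⊗[A] R} (hz : IsDiagonal z) {e : L}
    (he : ∀ f ∈ fittingIdeal S (Ω[S⁄R]) 0, ∃ s, e * algebraMap S L f = algebraMap S L s) :
    e * algebraMap S L (algebraMap R S (Algebra.TensorProduct.lmul' A z)) ∈
      ((algebraMap S L).comp (algebraMap R S)).range := by
  set δ := algebraMap S L (algebraMap R S (Algebra.TensorProduct.lmul' A z)) with hδ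
  -- Quantifying over all `s` makes this an ideal of `S`, so that `1 ∈ N` can be tested locally.
  let N : Ideal S :=
    { carrier := {σ | ∀ s : S, e * algebraMap S L s * δ * algebraMap S L σ ∈
        ((algebraMap S L).comp (algebraMap R S)).range}
      zero_mem' := fun s => by rw [map_zero, mul_zero]; exact zero_mem _
      add_mem' := fun ha hb s => by rw [map_add, mul_add]; exact add_mem (ha s) (hb s)
      smul_mem' := fun c σ hσ s => by
        have := hσ (s * c)
        rw [smul_eq_mul, map_mul]
        rw [map_mul] at this
        convert this using 1
        ring }
  have h1 : (1 : S) ∈ N := by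
    refine mem_of_forall_exists_mul_mem fun P hP => ?_
    obtain ⟨H, hH, φ, hφ⟩ := h.exists_dual_map_notMem (A := A) P
    refine ⟨H φ, hφ, ?_⟩
    rw [mul_one]
    intro s
    refine mul_lmul_mul_mem_range hRS (e * algebraMap S L s) (fun d hd => ?_) H hH hz φ
    obtain ⟨t, ht⟩ := he d (h.mem_fittingIdeal_kaehlerDifferential (k := k)
      fun x => smul_D_eq_zero_of_smul_D_eq_zero (hd x))
    exact ⟨s * t, by rw [map_mul, ← ht]; ring⟩
  simpa using h1 1

theorem span_range_D_eq_top {k R ι : Type*} [CommRing k] [CommRing R] [Algebra k R] {y : ι → R}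
    (hy : Algebra.adjoin k (Set.range y) = ⊤) :
    Submodule.span R (Set.range fun j => KaehlerDifferential.D k R (y j)) = ⊤ := by
  rw [eq_top_iff, ← KaehlerDifferential.span_range_derivation, Submodule.span_le]
  rintro _ ⟨x, rfl⟩
  have hx : x ∈ Algebra.adjoin k (Set.range y) := hy ▸ trivial
  rw [SetLike.mem_coe]
  induction hx using Algebra.adjoin_induction with
  | mem x hx =>
    obtain ⟨j, rfl⟩ := hx
    exact Submodule.subset_span ⟨j, rfl⟩
  | algebraMap c => rw [Derivation.map_algebraMap]; exact zero_mem _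
  | add x y _ _ hx hy => rw [map_add]; exact add_mem hx hy
  | mul x y _ _ hx hy =>
    rw [Derivation.leibniz]
    exact add_mem (Submodule.smul_mem _ _ hy) (Submodule.smul_mem _ _ hx)

/-- Over `A` the generator `y j₀` is a constant, so relations over `k` lose the column `j₀` and
become square. -/
theorem exists_isDiagonal_lmul_eq_det {k A R : Type*} [CommRing k] [CommRing A] [CommRing R]
    [Algebra k A] [Algebra k R] [Algebra A R] [IsScalarTower k A R] {n : ℕ} {y : Fin (n + 1) → R}
    (hy : Algebra.adjoin k (Set.range y) = ⊤) {B : Matrix (Fin n) (Fin (n + 1)) R}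
    (hB : ∀ r, ∑ j, B r j • KaehlerDifferential.D k R (y j) = 0) {c : Fin n → Fin (n + 1)}
    (hc : Function.Injective c) {j₀ : Fin (n + 1)} (hj₀ : ∀ j, j ≠ j₀ → j ∈ Set.range c) {a : A}
    (ha : algebraMap A R a = y j₀) :
    ∃ z : R ⊗[A] R, IsDiagonal z ∧
      Algebra.TensorProduct.lmul' A z = (B.submatrix id c).det := by
  have hadj : Algebra.adjoin A (Set.range (y ∘ c)) = ⊤ := by
    rw [eq_top_iff]
    have hle : Algebra.adjoin k (Set.range y) ≤
        (Algebra.adjoin A (Set.range (y ∘ c))).restrictScalars k := by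
      refine Algebra.adjoin_le ?_
      rintro _ ⟨j, rfl⟩
      by_cases hj : j = j₀
      · rw [hj, ← ha]
        exact Subalgebra.algebraMap_mem _ a
      · obtain ⟨i, rfl⟩ := hj₀ j hj
        exact Algebra.subset_adjoin (R := A)
          (show y (c i) ∈ Set.range (y ∘ c) from Set.mem_range_self i)
    intro x _
    exact hle (hy ▸ trivial)
  refine exists_isDiagonal_of_relations (y ∘ c) hadj (B.submatrix id c) fun r => ?_
  let f := ((KaehlerDifferential.D A R).restrictScalars k).liftKaehlerDifferential
  have hf : ∀ x, f (KaehlerDifferential.D k R x) = KaehlerDifferential.D A R x := fun x =>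
    Derivation.liftKaehlerDifferential_comp_D _ x
  have h1 := congrArg f (hB r)
  rw [map_sum, map_zero] at h1
  rw [← h1]
  simp only [map_smul, hf]
  refine Fintype.sum_of_injective c hc _ _ (fun j hj => ?_) fun i => rfl
  have : j = j₀ := by_contra fun h => hj (hj₀ j h)
  rw [this, ← ha, Derivation.map_algebraMap, smul_zero]

theorem exists_forall_ne_mem_range_of_injective {n : ℕ} {c : Fin n → Fin (n + 1)}
    (hc : Function.Injective c) : ∃ j₀, ∀ j, j ≠ j₀ → j ∈ Set.range c := by
  obtain ⟨j₀, hj₀⟩ : ∃ j₀, j₀ ∉ Set.range c := by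
    by_contra! hcon
    simpa using Fintype.card_le_of_surjective c hcon
  refine ⟨j₀, fun j hj => ?_⟩
  have hsub : Finset.univ.image c ⊆ Finset.univ.erase j₀ := fun x hx => by
    obtain ⟨i, -, rfl⟩ := Finset.mem_image.1 hx
    exact Finset.mem_erase.2 ⟨fun h => hj₀ ⟨i, h⟩, Finset.mem_univ _⟩
  have heq := Finset.eq_of_subset_of_card_le hsub (by
    rw [Finset.card_image_of_injective _ hc]
    simp)
  have : j ∈ Finset.univ.image c := heq ▸ Finset.mem_erase.2 ⟨hj, Finset.mem_univ _⟩
  simpa using this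

namespace IsCurveRing

variable {k R : Type*} [Field k] [CommRing R] [Algebra k R]

/-- Each Jacobian minor with distinct columns omits one generator; `R` must be finite over the
polynomial ring in that generator, whichever it is. -/
theorem exists_generators (h : IsCurveRing k R) : ∃ (n : ℕ) (y : Fin (n + 1) → R),
    Algebra.adjoin k (Set.range y) = ⊤ ∧
      ∀ j, (Polynomial.aeval (R := k) (y j)).toRingHom.IsIntegral := by
  obtain ⟨z, hz⟩ := h.exists_isIntegral_aeval
  choose M hM using fun x => exists_isIntegral_aeval_add_pow hz x
  obtain ⟨s, hs⟩ := h.finiteType.out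
  let x : Fin s.card → R := fun j => s.equivFin.symm j
  refine ⟨s.card, Fin.cons z fun j => x j + z ^ M (x j), ?_, Fin.cases hz fun j => hM _⟩
  rw [eq_top_iff, ← hs]
  refine Algebra.adjoin_le fun t ht => ?_
  have h0 : z ∈ Algebra.adjoin k (Set.range
      (Fin.cons z fun j => x j + z ^ M (x j) : Fin (s.card + 1) → R)) :=
    Algebra.subset_adjoin ⟨0, rfl⟩
  have h1 : t + z ^ M t ∈ Algebra.adjoin k (Set.range
      (Fin.cons z fun j => x j + z ^ M (x j) : Fin (s.card + 1) → R)) :=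
    Algebra.subset_adjoin ⟨(s.equivFin ⟨t, ht⟩).succ, by simp [x]⟩
  simpa using sub_mem h1 (pow_mem h0 (M t))

theorem exists_mul_eq_algebraMap_normalization (s : NormalizationRing R) : ∃ r r' : R,
    algebraMap R (NormalizationRing R) r ∈ nonZeroDivisors (NormalizationRing R) ∧
      algebraMap R (NormalizationRing R) r * s = algebraMap R (NormalizationRing R) r' := by
  obtain ⟨⟨r, t⟩, hrt⟩ := IsLocalization.surj (nonZeroDivisors R) (s : FractionRing R)
  exact ⟨t, r, algebraMap_normalization_mem_nonZeroDivisors t.2,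
    Subtype.ext ((mul_comm _ _).trans hrt)⟩

variable [IsAlgClosed k]

theorem mul_mem_range_of_mem_fittingIdeal (h : IsCurveRing k R) {e : FractionRing R}
    (he : ∀ f ∈ relativeJacobian R, ∃ s, e * algebraMap _ (FractionRing R) f =
      algebraMap (NormalizationRing R) (FractionRing R) s) {δ : R}
    (hδ : δ ∈ fittingIdeal R (Ω[R⁄k]) 1) :
    e * algebraMap R (FractionRing R) δ ∈ (algebraMap R (FractionRing R)).range := by
  obtain ⟨n, y, hy, hint⟩ := h.exists_generators
  rw [fittingIdeal_eq_minorIdeal _ (span_range_D_eq_top hy)] at hδ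
  have hS := h.isNormalCurveRing
  have := h.finite_normalization
  have := h.finiteType
  have : Algebra.FiniteType k (NormalizationRing R) := Algebra.FiniteType.trans (S := R) ‹_› inferInstance
  refine Submodule.span_induction (p := fun δ _ => e * algebraMap R (FractionRing R) δ ∈
    (algebraMap R (FractionRing R)).range) ?_ ?_ ?_ ?_ hδ
  · rintro _ ⟨B, hB, c, rfl⟩
    by_cases hc : Function.Injective c
    · obtain ⟨j₀, hj₀⟩ := exists_forall_ne_mem_range_of_injective hc
      let : Algebra (Polynomial k) R := (Polynomial.aeval (R := k) (y j₀)).toRingHom.toAlgebra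
      have : IsScalarTower k (Polynomial k) R := IsScalarTower.of_algebraMap_eq fun a =>
        (Polynomial.aeval_C (y j₀) a).symm
      have : Algebra.IsIntegral (Polynomial k) R := ⟨hint j₀⟩
      have := h.finite_normalization_polynomial
      have := h.isTorsionFree_normalization
      have : Module.Free (Polynomial k) (NormalizationRing R) :=
        Module.free_of_finite_type_torsion_free'
      obtain ⟨z, hz, hzdet⟩ := exists_isDiagonal_lmul_eq_det (A := Polynomial k) hy hB hc hj₀
        (a := Polynomial.X) (Polynomial.aeval_X (y j₀))
      rw [← hzdet]
      obtain ⟨r, hr⟩ := hS.mul_lmul_mem_range (k := k)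
        exists_mul_eq_algebraMap_normalization hz he
      exact ⟨r, hr⟩
    · simp only [Function.Injective, not_forall] at hc
      obtain ⟨i, j, hij, hne⟩ := hc
      rw [Matrix.det_zero_of_column_eq hne fun r => by
        rw [Matrix.submatrix_apply, Matrix.submatrix_apply, hij], map_zero, mul_zero]
      exact zero_mem _
  · exact ⟨0, by simp⟩
  · intro x y _ _ hx hy
    rw [map_add, mul_add]
    exact add_mem hx hy
  · intro a x _ hx
    rw [smul_eq_mul, map_mul, mul_left_comm]
    exact mul_mem ⟨a, rfl⟩ hx

/-- `F` is invertible, so only products `w * (g * f)` with `wF ⊆ S` need be treated, and `g * f` is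
an `S`-combination of Jacobian minors. `N` is the largest `S`-submodule contained in `R`. -/
theorem exists_algebraMap_eq_of_forall_mul_mem (h : IsCurveRing k R) {g : FractionRing R}
    (hg : ∀ f ∈ relativeJacobian R, ∃ j ∈ (fittingIdeal R (Ω[R⁄k]) 1).map
      (algebraMap R (NormalizationRing R)), g * algebraMap _ (FractionRing R) f =
        algebraMap (NormalizationRing R) (FractionRing R) j) :
    ∃ r : R, algebraMap R (FractionRing R) r = g := by
  have hS := h.isNormalCurveRing
  have := h.finite_normalization
  let N : Submodule (NormalizationRing R) (FractionRing R) :=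
    { carrier := {x | ∀ s : NormalizationRing R,
        algebraMap _ (FractionRing R) s * x ∈ (algebraMap R (FractionRing R)).range}
      zero_mem' := fun s => by rw [mul_zero]; exact zero_mem _
      add_mem' := fun ha hb s => by rw [mul_add]; exact add_mem (ha s) (hb s)
      smul_mem' := fun c x hx s => by
        rw [Algebra.smul_def, ← mul_assoc, ← map_mul]
        exact hx _ }
  have hgN : g ∈ N := by
    refine hS.mem_of_forall_mul_mem (hS.ordAt_fittingIdeal_ne_top (R := R)
      exists_mul_eq_algebraMap_normalization) N fun w hw f hf => ?_
    obtain ⟨j, hj, hgj⟩ := hg f hf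
    rw [hgj]
    clear hgj
    refine Submodule.span_induction (p := fun j _ => w * algebraMap _ (FractionRing R) j ∈ N)
      ?_ ?_ ?_ ?_ hj
    · rintro _ ⟨δ, hδ, rfl⟩ s
      rw [← mul_assoc]
      refine h.mul_mem_range_of_mem_fittingIdeal (fun f hf => ?_) hδ
      obtain ⟨t, ht⟩ := hw f hf
      exact ⟨s * t, by rw [map_mul, ← ht, mul_assoc]⟩
    · rw [map_zero, mul_zero]
      exact zero_mem _
    · intro x y _ _ hx hy
      rw [map_add, mul_add]
      exact add_mem hx hy
    · intro a x _ hx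
      rw [smul_eq_mul, map_mul, mul_left_comm, ← Algebra.smul_def]
      exact N.smul_mem a hx
  simpa using hgN 1

end IsCurveRing

end Birational

/-! ### The theorem on an affine curve. -/

section AffineCurve

/-- Multiplication by `r` maps `S` into `aS`; the Cayley–Hamilton polynomial has its coefficients in
the required powers of `a`. -/
theorem isIntegralOverIdeal_of_mem_map {R S : Type*} [CommRing R] [CommRing S] [Algebra R S]
    [Module.Finite R S] (hinj : Function.Injective (algebraMap R S)) {a : Ideal R} {r : R}
    (hr : algebraMap R S r ∈ a.map (algebraMap R S)) : IsIntegralOverIdeal a r := by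
  obtain ⟨p, hp, -, hc, h0⟩ :=
    LinearMap.exists_monic_and_natDegree_eq_and_coeff_mem_pow_and_aeval_eq_zero R
      (LinearMap.mulLeft R (algebraMap R S r)) a (by
        rintro _ ⟨x, rfl⟩
        rw [Ideal.smul_top_eq_map]
        exact Ideal.mul_mem_right x _ hr)
  refine ⟨p, hp, hinj ?_, fun i _ => hc i⟩
  have h1 := map_aeval_end (LinearMap.mulLeft R (algebraMap R S r)) LinearMap.id
    (algebraMap R S r) (fun v => rfl) p 1
  rw [h0, LinearMap.id_apply, LinearMap.id_apply, LinearMap.zero_apply, mul_one,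
    Polynomial.aeval_algebraMap_apply] at h1
  rw [map_zero]
  exact h1.symm

/-- The conductor of `S` over `R`. -/
def conductorIdeal (R S : Type*) [CommRing R] [CommRing S] [Algebra R S] : Ideal S where
  carrier := {s | ∀ t, ∃ r, algebraMap R S r = s * t}
  zero_mem' t := ⟨0, by simp⟩
  add_mem' := fun ha hb t => by
    obtain ⟨r, hr⟩ := ha t
    obtain ⟨r', hr'⟩ := hb t
    exact ⟨r + r', by rw [map_add, hr, hr', add_mul]⟩
  smul_mem' := fun c s hs t => by
    obtain ⟨r, hr⟩ := hs (c * t)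
    exact ⟨r, by rw [hr, smul_eq_mul]; ring⟩

theorem map_comap_of_le_conductorIdeal {R S : Type*} [CommRing R] [CommRing S] [Algebra R S]
    {B : Ideal S} (hB : B ≤ conductorIdeal R S) :
    (B.comap (algebraMap R S)).map (algebraMap R S) = B := by
  refine le_antisymm Ideal.map_comap_le fun x hx => ?_
  obtain ⟨r, hr⟩ := hB hx 1
  rw [mul_one] at hr
  rw [← hr]
  exact Ideal.mem_map_of_mem _ (Ideal.mem_comap.2 (hr ▸ hx))

/-- Where `I` has positive finite order its radical has order one. -/
theorem IsNormalCurveRing.ordAt_le_of_radical_pow_le {S L : Type*} [CommRing S] [CommRing L]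
    [Algebra S L] (h : IsNormalCurveRing S L) {I : Ideal S} {N : ℕ} (hN : I.radical ^ N ≤ I)
    {P : MaximalSpectrum S} (hP : ordAt P I ≠ ⊤) : ordAt P I ≤ N := by
  rcases h.ordAt_cases P I with ⟨n, hn, hn'⟩ | ⟨-, htop⟩
  swap
  · exact absurd htop hP
  rcases Nat.eq_zero_or_pos n with rfl | hpos
  · rw [hn']; exact zero_le
  have hrad : ordAt P I.radical = (1 : ℕ) := by
    refine h.ordAt_eq_coe ?_
    rw [IsLocalization.map_radical P.asIdeal.primeCompl, hn, Ideal.radical_pow _ hpos.ne',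
      (Ideal.IsMaximal.isPrime inferInstance).radical, pow_one]
  refine (ordAt_mono hN).trans ?_
  rw [h.ordAt_pow, hrad, Nat.cast_one, mul_one]

theorem roundDown_one_zero : roundDown 1 0 = 0 := by
  simp [roundDown]

theorem roundDown_inv_add_mul {N : ℕ} {c z : ℕ∞} (hc : c < N) :
    roundDown (N : ℝ≥0)⁻¹ (c + N * z) = z := by
  have hN : 0 < N := by
    rcases Nat.eq_zero_or_pos N with rfl | h
    · simp at hc
    · exact h
  lift c to ℕ using hc.ne_top
  have hcN : c < N := by exact_mod_cast hc
  induction z using ENat.recTopCoe with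
  | top =>
    rw [ENat.mul_top (by exact_mod_cast hN.ne'), add_top]
    simp [roundDown, hN.ne']
  | coe z =>
    have h1 : ((c : ℕ∞) + N * z) = ((c + N * z : ℕ) : ℕ∞) := by push_cast; rfl
    rw [h1, roundDown, if_neg (ENat.natCast_ne_top _), ENat.toNat_natCast]
    congr 1
    rw [← div_eq_inv_mul, Nat.floor_div_natCast, Nat.floor_natCast, Nat.add_mul_div_left _ _ hN,
      Nat.div_eq_of_lt hcN, zero_add]

variable {k R : Type*} [Field k] [CommRing R] (φ : k →+* R)

/-- The ideal `b` of `R` with `a = Î(b ^ (1 / N))`. -/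
noncomputable def rootIdeal (a : Ideal R) (N : ℕ) : Ideal R :=
  (conductorIdeal R (NormalizationRing R) *
    ((a.map (algebraMap R (NormalizationRing R)) * relativeJacobian R).colon
      ((jacobianIdeal φ).map (algebraMap R (NormalizationRing R)) : Set (NormalizationRing R))) ^
        N).comap (algebraMap R (NormalizationRing R))

theorem mjMultiplier_top_one (h : @IsCurveRing k R _ _ φ.toAlgebra) [IsAlgClosed k] :
    mjMultiplier φ ⊤ 1 = divisorSections R (fun P => ordAt P (relativeJacobian R))
      (fun P => ordAt P ((jacobianIdeal φ).map (algebraMap R (NormalizationRing R)))) := by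
  let : Algebra k R := φ.toAlgebra
  have hS := h.isNormalCurveRing
  unfold mjMultiplier
  congr 1
  ext P
  rw [Ideal.map_top, hS.ordAt_top, roundDown_one_zero, add_zero]

theorem divisorSections_anti_right {D₁ D₂ D₂' : MaximalSpectrum (NormalizationRing R) → ℕ∞}
    (hD : D₂ ≤ D₂') : divisorSections R D₁ D₂' ≤ divisorSections R D₁ D₂ :=
  fun _ hg P m n hm hn => hg P m n hm (hn.trans (hD P))

theorem injective_algebraMap_normalization :
    Function.Injective (algebraMap R (NormalizationRing R)) := fun _ _ hxy =>
  IsFractionRing.injective R (FractionRing R) (congrArg Subtype.val hxy)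

variable {φ} in
theorem isIntegrallyClosedIdeal_of_eq_mjMultiplier (h : @IsCurveRing k R _ _ φ.toAlgebra)
    [IsAlgClosed k] {a b : Ideal R} {t : ℝ≥0}
    (hab : IsLocalization.coeSubmodule (FractionRing R) a = mjMultiplier φ b t) :
    IsIntegrallyClosedIdeal a := by
  let : Algebra k R := φ.toAlgebra
  have hS := h.isNormalCurveRing
  intro x hx
  have h1 : algebraMap R (FractionRing R) x ∈ mjMultiplier φ b t :=
    mem_divisorSections_of_isIntegralOverIdeal hS _ _ (a := a) (fun y hy => by
      have : algebraMap R (FractionRing R) y ∈ IsLocalization.coeSubmodule (FractionRing R) a :=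
        (IsLocalization.mem_coeSubmodule _ _).2 ⟨y, hy, rfl⟩
      rw [hab] at this
      exact this) hx
  rw [← hab, IsLocalization.mem_coeSubmodule] at h1
  obtain ⟨y, hy, hxy⟩ := h1
  rwa [← IsFractionRing.injective R (FractionRing R) hxy]

variable {φ} in
theorem mjMultiplier_le_mjMultiplier_top_one (h : @IsCurveRing k R _ _ φ.toAlgebra)
    [IsAlgClosed k] (b : Ideal R) (t : ℝ≥0) : mjMultiplier φ b t ≤ mjMultiplier φ ⊤ 1 := by
  rw [mjMultiplier_top_one φ h]
  exact divisorSections_anti_right fun P => le_self_add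

variable {φ} in
theorem map_mul_relativeJacobian_le (h : @IsCurveRing k R _ _ φ.toAlgebra) [IsAlgClosed k]
    {a : Ideal R}
    (hle : IsLocalization.coeSubmodule (FractionRing R) a ≤ mjMultiplier φ ⊤ 1) :
    a.map (algebraMap R (NormalizationRing R)) * relativeJacobian R ≤
      (jacobianIdeal φ).map (algebraMap R (NormalizationRing R)) := by
  let : Algebra k R := φ.toAlgebra
  have hS := h.isNormalCurveRing
  have := h.finite_normalization
  rw [mjMultiplier_top_one φ h] at hle
  refine Ideal.mul_le.2 fun x hx f hf => ?_
  refine Submodule.span_induction (p := fun x _ => x * f ∈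
    (jacobianIdeal φ).map (algebraMap R (NormalizationRing R))) ?_ ?_ ?_ ?_ hx
  · rintro _ ⟨y, hy, rfl⟩
    obtain ⟨j, hj, hyj⟩ := (mem_divisorSections_iff hS (hS.ordAt_fittingIdeal_ne_top (R := R)
      IsCurveRing.exists_mul_eq_algebraMap_normalization)).1
        (hle ((IsLocalization.mem_coeSubmodule _ _).2 ⟨y, hy, rfl⟩)) f hf
    have : algebraMap R (NormalizationRing R) y * f = j := Subtype.ext hyj
    rwa [this]
  · rw [zero_mul]; exact zero_mem _
  · intro x y _ _ hx hy
    rw [add_mul]; exact add_mem hx hy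
  · intro s x _ hx
    rw [smul_eq_mul, mul_assoc]
    exact Ideal.mul_mem_left _ _ hx

variable {φ} in
-- This is `aS = a`: since `aS · F ⊆ JS`, the ideal `aS` lies in `R`, where its elements are
-- integral over `a`.
theorem exists_algebraMap_eq_of_mem_map (h : @IsCurveRing k R _ _ φ.toAlgebra) [IsAlgClosed k]
    {a : Ideal R} (ha : IsIntegrallyClosedIdeal a)
    (hle : IsLocalization.coeSubmodule (FractionRing R) a ≤ mjMultiplier φ ⊤ 1)
    {x : NormalizationRing R} (hx : x ∈ a.map (algebraMap R (NormalizationRing R))) :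
    ∃ r ∈ a, algebraMap R (NormalizationRing R) r = x := by
  let : Algebra k R := φ.toAlgebra
  have := h.finite_normalization
  obtain ⟨r, hr⟩ := h.exists_algebraMap_eq_of_forall_mul_mem (g := x) fun f hf =>
    ⟨x * f, map_mul_relativeJacobian_le h hle (Ideal.mul_mem_mul hx hf), rfl⟩
  have hr' : algebraMap R (NormalizationRing R) r = x := Subtype.ext hr
  exact ⟨r, ha r (isIntegralOverIdeal_of_mem_map injective_algebraMap_normalization
    (hr' ▸ hx)), hr'⟩

variable {φ} in
-- The root ideal has divisor `C + NE` with `E = A + K̂ - J`, the colon giving `E`. After rounding,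
-- `J + E = A + K̂` is the divisor of `aF`, and `F` cancels.
theorem coeSubmodule_eq_mjMultiplier_rootIdeal (h : @IsCurveRing k R _ _ φ.toAlgebra)
    [IsAlgClosed k] {a : Ideal R} (ha : IsIntegrallyClosedIdeal a)
    (hle : IsLocalization.coeSubmodule (FractionRing R) a ≤ mjMultiplier φ ⊤ 1) {N : ℕ}
    (hN : ∀ P, ordAt P (conductorIdeal R (NormalizationRing R)) < N) :
    IsLocalization.coeSubmodule (FractionRing R) a =
      mjMultiplier φ (rootIdeal φ a N) (N : ℝ≥0)⁻¹ := by
  let : Algebra k R := φ.toAlgebra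
  have hS := h.isNormalCurveRing
  have := h.finite_normalization
  have hF : ∀ P, ordAt P (relativeJacobian R) ≠ ⊤ :=
    hS.ordAt_fittingIdeal_ne_top (R := R) IsCurveRing.exists_mul_eq_algebraMap_normalization
  have hD : mjMultiplier φ (rootIdeal φ a N) (N : ℝ≥0)⁻¹ =
      divisorSections R (fun P => ordAt P (relativeJacobian R))
        (fun P => ordAt P
          (a.map (algebraMap R (NormalizationRing R)) * relativeJacobian R)) := by
    unfold mjMultiplier
    congr 1
    ext P
    rw [rootIdeal, map_comap_of_le_conductorIdeal Ideal.mul_le_left, hS.ordAt_mul, hS.ordAt_pow,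
      roundDown_inv_add_mul (hN P), add_comm,
      hS.ordAt_colon_add (map_mul_relativeJacobian_le h hle)]
  rw [hD]
  ext g
  rw [mem_divisorSections_iff hS hF, IsLocalization.mem_coeSubmodule]
  constructor
  · rintro ⟨y, hy, rfl⟩ f hf
    exact ⟨_, Ideal.mul_mem_mul (Ideal.mem_map_of_mem _ hy) hf, rfl⟩
  · intro hg
    obtain ⟨x, hx, rfl⟩ := hS.exists_mem_of_forall_mul_mem_mul hF hg
    obtain ⟨r, hr, rfl⟩ := exists_algebraMap_eq_of_mem_map h ha hle hx
    exact ⟨r, hr, rfl⟩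

theorem exists_mem_conductorIdeal_mem_nonZeroDivisors {R S : Type*} [CommRing R] [CommRing S]
    [Algebra R S] [Module.Finite R S]
    (hRS : ∀ s : S, ∃ r r' : R, algebraMap R S r ∈ nonZeroDivisors S ∧
      algebraMap R S r * s = algebraMap R S r') :
    ∃ x ∈ conductorIdeal R S, x ∈ nonZeroDivisors S := by
  obtain ⟨r, hr, hrS⟩ := exists_forall_mul_eq_algebraMap hRS
  exact ⟨_, fun t => (hrS t).imp fun _ h => h.symm, hr⟩

variable {φ} in
theorem exists_mem_rootIdeal_mem_nonZeroDivisors (h : @IsCurveRing k R _ _ φ.toAlgebra)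
    [IsAlgClosed k] {a : Ideal R} (ha : ∃ x ∈ a, x ∈ nonZeroDivisors R) (N : ℕ) :
    ∃ x ∈ rootIdeal φ a N, x ∈ nonZeroDivisors R := by
  let : Algebra k R := φ.toAlgebra
  have := h.finite_normalization
  obtain ⟨y, hy, hy0⟩ := ha
  obtain ⟨c, hc, hc0⟩ := exists_mem_conductorIdeal_mem_nonZeroDivisors
    (IsCurveRing.exists_mul_eq_algebraMap_normalization (R := R))
  obtain ⟨f, hf, hf0⟩ := exists_mem_fittingIdeal_mem_nonZeroDivisors
    (IsCurveRing.exists_mul_eq_algebraMap_normalization (R := R))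
  have hmem : c * (algebraMap R (NormalizationRing R) y * f) ^ N ∈
      conductorIdeal R (NormalizationRing R) *
    ((a.map (algebraMap R (NormalizationRing R)) * relativeJacobian R).colon
      ((jacobianIdeal φ).map (algebraMap R (NormalizationRing R)) : Set (NormalizationRing R))) ^
        N :=
    Ideal.mul_mem_mul hc (Ideal.pow_mem_pow (Submodule.mem_colon.2 fun j _ =>
      Ideal.mul_mem_right _ _ (Ideal.mul_mem_mul (Ideal.mem_map_of_mem _ hy) hf)) N)
  have hnzd : c * (algebraMap R (NormalizationRing R) y * f) ^ N ∈
      nonZeroDivisors (NormalizationRing R) :=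
    mul_mem hc0 (pow_mem (mul_mem (IsCurveRing.algebraMap_normalization_mem_nonZeroDivisors hy0) hf0) N)
  obtain ⟨r, hr⟩ := Ideal.mul_le_left hmem 1
  rw [mul_one] at hr
  refine ⟨r, Ideal.mem_comap.2 (hr ▸ hmem), ?_⟩
  rw [← hr] at hnzd
  exact mem_nonZeroDivisors_of_injective injective_algebraMap_normalization hnzd

end AffineCurve

/-! ### Colons, contractions and conductors under localization. -/

section Localization

section Ideal

variable {S S' : Type*} [CommRing S] [CommRing S'] [Algebra S S']

theorem map_colon (T : Submonoid S) [IsLocalization T S'] (I : Ideal S) {J : Ideal S} (hJ : J.FG) :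
    (I.colon (J : Set S)).map (algebraMap S S') =
      (I.map (algebraMap S S')).colon (J.map (algebraMap S S') : Set S') := by
  apply le_antisymm
  · refine Ideal.map_le_iff_le_comap.2 fun x hx => Ideal.mem_comap.2 (Submodule.mem_colon.2 ?_)
    intro y hy
    rw [smul_eq_mul]
    refine Submodule.span_induction (p := fun y _ => algebraMap S S' x * y ∈
      I.map (algebraMap S S')) ?_ ?_ ?_ ?_ hy
    · rintro _ ⟨j, hj, rfl⟩
      rw [← map_mul]
      exact Ideal.mem_map_of_mem _ (Submodule.mem_colon.1 hx j hj)
    · rw [mul_zero]; exact zero_mem _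
    · intro y z _ _ hy hz
      rw [mul_add]; exact add_mem hy hz
    · intro a y _ hy
      rw [smul_eq_mul, mul_left_comm]
      exact Ideal.mul_mem_left _ _ hy
  · intro x hx
    obtain ⟨x, t, rfl⟩ := IsLocalization.exists_mk'_eq T x
    have key : ∀ K : Ideal S, K.FG → K ≤ J → ∃ s ∈ T, ∀ j ∈ K, s * (x * j) ∈ I := by
      intro K hK
      induction K, hK using Submodule.fg_induction with
      | singleton j =>
        intro hj
        have h1 := Submodule.mem_colon.1 hx (algebraMap S S' j)
          (Ideal.mem_map_of_mem _ ((Ideal.span_singleton_le_iff_mem _).1 hj))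
        have h2 := Ideal.mul_mem_left _ (algebraMap S S' t) h1
        rw [smul_eq_mul, ← mul_assoc, IsLocalization.mk'_spec', ← map_mul,
          IsLocalization.algebraMap_mem_map_algebraMap_iff T] at h2
        obtain ⟨s, hs, h3⟩ := h2
        refine ⟨s, hs, fun y hy => ?_⟩
        obtain ⟨a, rfl⟩ := Submodule.mem_span_singleton.1 hy
        rw [smul_eq_mul, mul_left_comm x, mul_left_comm s]
        exact Ideal.mul_mem_left _ _ h3
      | sup K₁ K₂ _ _ h₁ h₂ =>
        intro hK
        obtain ⟨s₁, hs₁, h₁⟩ := h₁ (le_sup_left.trans hK)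
        obtain ⟨s₂, hs₂, h₂⟩ := h₂ (le_sup_right.trans hK)
        refine ⟨s₁ * s₂, mul_mem hs₁ hs₂, fun j hj => ?_⟩
        obtain ⟨y, hy, z, hz, rfl⟩ := Submodule.mem_sup.1 hj
        have : s₁ * s₂ * (x * (y + z)) = s₂ * (s₁ * (x * y)) + s₁ * (s₂ * (x * z)) := by ring
        rw [this]
        exact add_mem (Ideal.mul_mem_left _ _ (h₁ y hy)) (Ideal.mul_mem_left _ _ (h₂ z hz))
    obtain ⟨s, hs, h⟩ := key J hJ le_rfl
    rw [IsLocalization.mk'_mem_map_algebraMap_iff T]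
    exact ⟨s, hs, Submodule.mem_colon.2 fun j hj => by
      rw [smul_eq_mul, mul_assoc]; exact h j hj⟩

end Ideal

section Square

variable {R R' S S' : Type*} [CommRing R] [CommRing R'] [CommRing S] [CommRing S'] [Algebra R R']
  [Algebra R S] [Algebra R S'] [Algebra S S'] [Algebra R' S'] [IsScalarTower R R' S']
  [IsScalarTower R S S']

theorem map_fittingIdeal_kaehlerDifferential_of_isLocalization (M : Submonoid R) [IsLocalization M R']
    [IsLocalization (Algebra.algebraMapSubmonoid S M) S']
    [Algebra.FiniteType R S] (i : ℕ) :
    (fittingIdeal S (Ω[S⁄R]) i).map (algebraMap S S') = fittingIdeal S' (Ω[S'⁄R']) i := by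
  have : IsLocalizedModule (Algebra.algebraMapSubmonoid S M)
      (KaehlerDifferential.map R R' S S') :=
    IsLocalizedModule.of_restrictScalars M _
  exact map_fittingIdeal (Algebra.algebraMapSubmonoid S M) (KaehlerDifferential.map R R' S S') i

theorem map_comap_of_isLocalization (M : Submonoid R) [IsLocalization M R']
    [IsLocalization (Algebra.algebraMapSubmonoid S M) S'] (B : Ideal S) :
    (B.comap (algebraMap R S)).map (algebraMap R R') =
      (B.map (algebraMap S S')).comap (algebraMap R' S') := by
  apply le_antisymm
  · refine Ideal.map_le_iff_le_comap.2 fun x hx => ?_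
    rw [Ideal.mem_comap, Ideal.mem_comap, ← IsScalarTower.algebraMap_apply,
      IsScalarTower.algebraMap_apply R S S']
    exact Ideal.mem_map_of_mem _ hx
  · intro x hx
    obtain ⟨x, t, rfl⟩ := IsLocalization.exists_mk'_eq M x
    have h1 : algebraMap S S' (algebraMap R S x) ∈ B.map (algebraMap S S') := by
      have h2 := Ideal.mul_mem_left _ (algebraMap R' S' (algebraMap R R' t)) (Ideal.mem_comap.1 hx)
      rwa [← map_mul, IsLocalization.mk'_spec', ← IsScalarTower.algebraMap_apply,
        IsScalarTower.algebraMap_apply R S S'] at h2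
    rw [IsLocalization.algebraMap_mem_map_algebraMap_iff (Algebra.algebraMapSubmonoid S M)] at h1
    obtain ⟨_, ⟨m, hm, rfl⟩, h2⟩ := h1
    rw [IsLocalization.mk'_mem_map_algebraMap_iff M]
    exact ⟨m, hm, by rw [Ideal.mem_comap, map_mul]; exact h2⟩

theorem map_conductorIdeal (M : Submonoid R) [IsLocalization M R']
    [IsLocalization (Algebra.algebraMapSubmonoid S M) S']
    [Module.Finite R S] :
    (conductorIdeal R S).map (algebraMap S S') = conductorIdeal R' S' := by
  apply le_antisymm
  · refine Ideal.map_le_iff_le_comap.2 fun x hx y => ?_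
    obtain ⟨y, ⟨_, m, hm, rfl⟩, rfl⟩ :=
      IsLocalization.exists_mk'_eq (Algebra.algebraMapSubmonoid S M) y
    obtain ⟨r, hr⟩ := hx y
    refine ⟨IsLocalization.mk' R' r ⟨m, hm⟩, ?_⟩
    rw [IsLocalization.mul_mk'_eq_mk'_of_mul, IsLocalization.eq_mk'_iff_mul_eq, ← hr,
      ← IsScalarTower.algebraMap_apply, ← IsScalarTower.algebraMap_apply,
      IsScalarTower.algebraMap_apply R R' S', ← map_mul, IsLocalization.mk'_spec R' r ⟨m, hm⟩,
      ← IsScalarTower.algebraMap_apply]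
  · intro x hx
    obtain ⟨x, ⟨_, t, ht, rfl⟩, rfl⟩ :=
      IsLocalization.exists_mk'_eq (Algebra.algebraMapSubmonoid S M) x
    have key : ∀ N : Submodule R S, N.FG →
        ∃ m ∈ M, ∀ y ∈ N, ∃ r, algebraMap R S r = algebraMap R S m * (x * y) := by
      intro N hN
      induction N, hN using Submodule.fg_induction with
      | singleton y =>
        obtain ⟨r, hr⟩ := hx (algebraMap S S' y)
        obtain ⟨r, u, rfl⟩ := IsLocalization.exists_mk'_eq M r
        have h1 : algebraMap S S' (algebraMap R S (r * t)) =
            algebraMap S S' (algebraMap R S u * (x * y)) := by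
          have h2 : algebraMap R' S' (IsLocalization.mk' R' r u) * algebraMap R S' u =
              algebraMap R S' r := by
            rw [IsScalarTower.algebraMap_apply R R' S', ← map_mul, IsLocalization.mk'_spec,
              ← IsScalarTower.algebraMap_apply]
          have h3 := IsLocalization.mk'_spec S' x
            (⟨_, t, ht, rfl⟩ : Algebra.algebraMapSubmonoid S M)
          simp only [map_mul, ← IsScalarTower.algebraMap_apply] at h3 ⊢
          rw [← h2, hr, ← h3]
          ring
        obtain ⟨⟨_, m, hm, rfl⟩, h4⟩ :=
          (IsLocalization.eq_iff_exists (Algebra.algebraMapSubmonoid S M) S').1 h1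
        refine ⟨m * u, mul_mem hm u.2, fun z hz => ?_⟩
        obtain ⟨a, rfl⟩ := Submodule.mem_span_singleton.1 hz
        refine ⟨a * (m * (r * t)), ?_⟩
        rw [map_mul, map_mul (algebraMap R S) m, h4, Algebra.smul_def, map_mul]
        ring
      | sup N₁ N₂ _ _ h₁ h₂ =>
        obtain ⟨m₁, hm₁, h₁⟩ := h₁
        obtain ⟨m₂, hm₂, h₂⟩ := h₂
        refine ⟨m₁ * m₂, mul_mem hm₁ hm₂, fun j hj => ?_⟩
        obtain ⟨y, hy, z, hz, rfl⟩ := Submodule.mem_sup.1 hj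
        obtain ⟨r₁, hr₁⟩ := h₁ y hy
        obtain ⟨r₂, hr₂⟩ := h₂ z hz
        exact ⟨m₂ * r₁ + m₁ * r₂, by
          rw [map_add, map_mul, map_mul, map_mul, hr₁, hr₂]; ring⟩
    obtain ⟨m, hm, h⟩ := key ⊤ Module.Finite.fg_top
    rw [IsLocalization.mk'_mem_map_algebraMap_iff (Algebra.algebraMapSubmonoid S M)]
    exact ⟨_, ⟨m, hm, rfl⟩, fun y => by rw [mul_assoc]; exact h y trivial⟩

end Square

end Localization

/-! ### Normalization commutes with localization. -/

section LocalizationNormalization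

variable {R R' : Type*} [CommRing R] [CommRing R'] [Algebra R R'] (M : Submonoid R)
  [IsLocalization M R']

variable (R') in
/-- The map of total rings of fractions induced by a localization. -/
noncomputable def fractionRingMap : FractionRing R →+* FractionRing R' :=
  IsLocalization.map (FractionRing R') (algebraMap R R')
    (IsLocalization.nonZeroDivisors_le_comap M R')

theorem fractionRingMap_algebraMap (r : R) :
    fractionRingMap R' M (algebraMap R _ r) = algebraMap R (FractionRing R') r := by
  unfold fractionRingMap
  rw [IsScalarTower.algebraMap_apply R R' (FractionRing R')]
  exact IsLocalization.map_eq (M := nonZeroDivisors R) (S := FractionRing R) _ r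

theorem isLocalization_fractionRing [IsReduced R] [IsNoetherianRing R]
    [Algebra (FractionRing R) (FractionRing R')]
    [IsScalarTower R (FractionRing R) (FractionRing R')] :
    IsLocalization (Algebra.algebraMapSubmonoid (FractionRing R) M) (FractionRing R') := by
  have hunit : ∀ m ∈ M, IsUnit (algebraMap R (FractionRing R') m) := fun m hm => by
    rw [IsScalarTower.algebraMap_apply R R']
    exact (IsLocalization.map_units R' (⟨m, hm⟩ : M)).map _
  refine ⟨⟨?_, ?_, ?_⟩⟩
  · rintro ⟨_, m, hm, rfl⟩
    rw [← IsScalarTower.algebraMap_apply]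
    exact hunit m hm
  · intro x
    obtain ⟨r', ⟨t', ht'⟩, rfl⟩ := IsLocalization.exists_mk'_eq (nonZeroDivisors R') x
    obtain ⟨r, m, rfl⟩ := IsLocalization.exists_mk'_eq M r'
    obtain ⟨t, n, rfl⟩ := IsLocalization.exists_mk'_eq M t'
    -- The denominator `t` may be a zero divisor in `R`. It is replaced by `c * t + y` with `t * y =
    -- 0`; here `y` dies in `R'`, where `t` is a non-zero-divisor.
    obtain ⟨c, y, hty, hu⟩ := exists_mul_add_mem_nonZeroDivisors t
    have hr := congrArg (algebraMap R' (FractionRing R')) (IsLocalization.mk'_spec R' r m)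
    have ht := congrArg (algebraMap R' (FractionRing R')) (IsLocalization.mk'_spec R' t n)
    have hx := IsLocalization.mk'_spec (FractionRing R') (IsLocalization.mk' R' r m)
      (⟨_, ht'⟩ : nonZeroDivisors R')
    have hy : algebraMap R R' y = 0 := by
      refine (mul_left_mem_nonZeroDivisors_eq_zero_iff ht').1 ?_
      have h1 : algebraMap R R' n * (IsLocalization.mk' R' t n * algebraMap R R' y) = 0 := by
        rw [← mul_assoc, IsLocalization.mk'_spec', ← map_mul, hty, map_zero]
      exact ((IsLocalization.map_units R' n).mul_right_eq_zero).1 h1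
    have hu' : algebraMap R (FractionRing R') (c * t + y) =
        algebraMap R (FractionRing R') c * algebraMap R (FractionRing R') t := by
      rw [map_add, map_mul, IsScalarTower.algebraMap_apply R R' _ y, hy, map_zero, add_zero]
    have hz := congrArg (algebraMap (FractionRing R) (FractionRing R'))
      (IsLocalization.mk'_spec (FractionRing R) (r * n * c) (⟨_, hu⟩ : nonZeroDivisors R))
    refine ⟨⟨IsLocalization.mk' (FractionRing R) (r * n * c) ⟨_, hu⟩, ⟨_, m, m.2, rfl⟩⟩, ?_⟩
    have hunit' : IsUnit (algebraMap R (FractionRing R') (c * t + y)) := by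
      rw [IsScalarTower.algebraMap_apply R R']
      exact IsLocalization.map_units (FractionRing R')
        (⟨_, IsLocalization.nonZeroDivisors_le_comap M R' hu⟩ : nonZeroDivisors R')
    refine hunit'.mul_left_injective ?_
    dsimp only at hr ht hx hz ⊢
    rw [map_mul, ← IsScalarTower.algebraMap_apply, ← IsScalarTower.algebraMap_apply] at hr ht hz
    rw [hz, hu', ← IsScalarTower.algebraMap_apply, map_mul, map_mul]
    rw [← hr, ← ht, ← hx]
    ring
  · intro x y hxy
    obtain ⟨r, u, rfl⟩ := IsLocalization.exists_mk'_eq (nonZeroDivisors R) x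
    obtain ⟨s, v, rfl⟩ := IsLocalization.exists_mk'_eq (nonZeroDivisors R) y
    have hx := congrArg (algebraMap (FractionRing R) (FractionRing R'))
      (IsLocalization.mk'_spec (FractionRing R) r u)
    have hy := congrArg (algebraMap (FractionRing R) (FractionRing R'))
      (IsLocalization.mk'_spec (FractionRing R) s v)
    have h1 : algebraMap R' (FractionRing R') (algebraMap R R' (r * v)) =
        algebraMap R' (FractionRing R') (algebraMap R R' (s * u)) := by
      rw [map_mul, ← IsScalarTower.algebraMap_apply] at hx hy
      rw [← IsScalarTower.algebraMap_apply, ← IsScalarTower.algebraMap_apply, map_mul, map_mul,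
        IsScalarTower.algebraMap_apply R (FractionRing R) _ r,
        IsScalarTower.algebraMap_apply R (FractionRing R) _ s, ← hx, ← hy, hxy]
      ring
    obtain ⟨m, hm⟩ := (IsLocalization.eq_iff_exists M R').1
      (IsFractionRing.injective R' (FractionRing R') h1)
    refine ⟨⟨_, m, m.2, rfl⟩, ?_⟩
    dsimp only
    rw [IsLocalization.mul_mk'_eq_mk'_of_mul, IsLocalization.mul_mk'_eq_mk'_of_mul,
      IsLocalization.mk'_eq_iff_eq]
    congr 1
    linear_combination hm

theorem exists_algebra_normalization [IsReduced R] [IsNoetherianRing R] :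
    ∃ _ : Algebra (NormalizationRing R) (NormalizationRing R'),
      IsScalarTower R (NormalizationRing R) (NormalizationRing R') ∧
      IsLocalization (Algebra.algebraMapSubmonoid (NormalizationRing R) M)
        (NormalizationRing R') := by
  let : Algebra (FractionRing R) (FractionRing R') := (fractionRingMap R' M).toAlgebra
  have tower : IsScalarTower R (FractionRing R) (FractionRing R') :=
    IsScalarTower.of_algebraMap_eq fun r => (fractionRingMap_algebraMap M r).symm
  have := isLocalization_fractionRing (R' := R') M
  have hint : ∀ x : NormalizationRing R,
      algebraMap (FractionRing R) (FractionRing R') x ∈ integralClosure R' (FractionRing R') :=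
    fun x => (IsIntegral.algebraMap (B := FractionRing R') x.2).tower_top
  let : Algebra (NormalizationRing R) (NormalizationRing R') :=
    (((algebraMap (FractionRing R) (FractionRing R')).comp
      (algebraMap (NormalizationRing R) (FractionRing R))).codRestrict
        (integralClosure R' (FractionRing R')) hint).toAlgebra
  have : IsScalarTower (NormalizationRing R) (NormalizationRing R') (FractionRing R') :=
    IsScalarTower.of_algebraMap_eq fun x => rfl
  have h2 : IsScalarTower R (NormalizationRing R) (NormalizationRing R') :=
    IsScalarTower.of_algebraMap_eq fun r =>
      Subtype.ext (fractionRingMap_algebraMap M r).symm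
  exact ⟨inferInstance, h2, IsLocalization.integralClosure (Rf := R') M⟩

end LocalizationNormalization

/-! ### The root ideal and the conductor bound under localization. -/

section LocalizationRoot

variable {k R R' : Type*} [Field k] [CommRing R] [CommRing R'] [Algebra R R'] {φ : k →+* R}

theorem map_jacobianIdeal (hφ : @Algebra.FiniteType k R _ _ φ.toAlgebra) (M : Submonoid R)
    [IsLocalization M R'] : (jacobianIdeal φ).map (algebraMap R R') =
      jacobianIdeal ((algebraMap R R').comp φ) := by
  let : Algebra k R := φ.toAlgebra
  let : Algebra k R' := ((algebraMap R R').comp φ).toAlgebra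
  have : IsScalarTower k R R' := IsScalarTower.of_algebraMap_eq fun _ => rfl
  have : Algebra.FiniteType k R := hφ
  exact map_fittingIdeal M (KaehlerDifferential.map k k R R') 1

variable [PerfectField k]

theorem map_rootIdeal (h : @IsCurveRing k R _ _ φ.toAlgebra) (M : Submonoid R)
    [IsLocalization M R'] (a : Ideal R) (N : ℕ) :
    (rootIdeal φ a N).map (algebraMap R R') =
      rootIdeal ((algebraMap R R').comp φ) (a.map (algebraMap R R')) N := by
  let : Algebra k R := φ.toAlgebra
  have := h.isNoetherianRing
  have := h.isReduced
  have := h.finite_normalization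
  have hS := h.isNormalCurveRing.isNoetherianRing
  obtain ⟨_, _, _⟩ := exists_algebra_normalization (R' := R') M
  have hF : relativeJacobian R' = (relativeJacobian R).map
      (algebraMap (NormalizationRing R) (NormalizationRing R')) :=
    (map_fittingIdeal_kaehlerDifferential_of_isLocalization M 0).symm
  have hmap : ∀ I : Ideal R, (I.map (algebraMap R R')).map (algebraMap R' (NormalizationRing R')) =
      (I.map (algebraMap R (NormalizationRing R))).map
        (algebraMap (NormalizationRing R) (NormalizationRing R')) := fun I => by
    rw [Ideal.map_map, Ideal.map_map, ← IsScalarTower.algebraMap_eq,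
      ← IsScalarTower.algebraMap_eq]
  unfold rootIdeal
  rw [map_comap_of_isLocalization (S' := NormalizationRing R') M, Ideal.map_mul, Ideal.map_pow,
    map_conductorIdeal (R' := R') M,
    map_colon (Algebra.algebraMapSubmonoid (NormalizationRing R) M) _ (IsNoetherian.noetherian _),
    Ideal.map_mul, ← hF, ← hmap, ← hmap, map_jacobianIdeal h.finiteType M]

/-- This form of the bound on the orders of the conductor localizes and can be checked on an open
cover. -/
theorem exists_radical_conductorIdeal_pow_le (h : @IsCurveRing k R _ _ φ.toAlgebra) :
    ∃ N, (conductorIdeal R (NormalizationRing R)).radical ^ N ≤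
      conductorIdeal R (NormalizationRing R) := by
  let : Algebra k R := φ.toAlgebra
  have := h.isNormalCurveRing.isNoetherianRing
  exact Ideal.exists_radical_pow_le_of_fg _ (IsNoetherian.noetherian _)

theorem radical_conductorIdeal_pow_le_of_isLocalization
    (h : @IsCurveRing k R _ _ φ.toAlgebra) (M : Submonoid R) [IsLocalization M R'] {N : ℕ}
    (hN : (conductorIdeal R (NormalizationRing R)).radical ^ N ≤
      conductorIdeal R (NormalizationRing R)) :
    (conductorIdeal R' (NormalizationRing R')).radical ^ N ≤
      conductorIdeal R' (NormalizationRing R') := by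
  let : Algebra k R := φ.toAlgebra
  have := h.isNoetherianRing
  have := h.isReduced
  have := h.finite_normalization
  obtain ⟨_, _, _⟩ := exists_algebra_normalization (R' := R') M
  rw [← map_conductorIdeal (S := NormalizationRing R) M,
    ← IsLocalization.map_radical (Algebra.algebraMapSubmonoid (NormalizationRing R) M),
    ← Ideal.map_pow]
  exact Ideal.map_mono hN

theorem exists_smul_mem_conductorIdeal_of_isLocalization
    (h : @IsCurveRing k R _ _ φ.toAlgebra) (M : Submonoid R) [IsLocalization M R'] {N : ℕ}
    (hN : (conductorIdeal R' (NormalizationRing R')).radical ^ N ≤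
      conductorIdeal R' (NormalizationRing R')) {x : NormalizationRing R}
    (hx : x ∈ (conductorIdeal R (NormalizationRing R)).radical ^ N) :
    ∃ m ∈ M, m • x ∈ conductorIdeal R (NormalizationRing R) := by
  let : Algebra k R := φ.toAlgebra
  have := h.isNoetherianRing
  have := h.isReduced
  have := h.finite_normalization
  obtain ⟨_, _, _⟩ := exists_algebra_normalization (R' := R') M
  rw [← map_conductorIdeal (S := NormalizationRing R) M,
    ← IsLocalization.map_radical (Algebra.algebraMapSubmonoid (NormalizationRing R) M),
    ← Ideal.map_pow] at hN
  have h1 := hN (Ideal.mem_map_of_mem _ hx)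
  rw [IsLocalization.algebraMap_mem_map_algebraMap_iff
    (Algebra.algebraMapSubmonoid (NormalizationRing R) M)] at h1
  obtain ⟨_, ⟨m, hm, rfl⟩, h2⟩ := h1
  exact ⟨m, hm, by rwa [Algebra.smul_def]⟩

end LocalizationRoot

/-! ### Equidimensionality in terms of primes. -/

section Equidimensional

variable {X : Type*} [TopologicalSpace X] {R : Type*} [CommRing R] {f : PrimeSpectrum R → X}

/-- In a Jacobson space a closed point of an open subset is closed. Were it also generic, its
irreducible component would be a single point, of dimension zero. -/
theorem not_isMaximal_of_mem_minimalPrimes_of_isOpenEmbedding [QuasiSober X] [JacobsonSpace X]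
    (hX : ∀ Z ∈ irreducibleComponents X, topologicalKrullDim Z = 1)
    (hf : Topology.IsOpenEmbedding f) {q : Ideal R} (hq : q ∈ minimalPrimes R) :
    ¬ q.IsMaximal := by
  intro hmax
  let x : PrimeSpectrum R := ⟨q, hq.1.1⟩
  have hclosed : IsClosed {f x} := by
    have h1 : x ∈ closedPoints (PrimeSpectrum R) :=
      (PrimeSpectrum.isClosed_singleton_iff_isMaximal x).2 hmax
    rwa [← hf.preimage_closedPoints] at h1
  have hirr : IsIrreducible (irreducibleComponent (f x)) := isIrreducible_irreducibleComponent
  have hgen := hirr.closure_genericPoint isClosed_irreducibleComponent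
  have hspec : hirr.genericPoint ⤳ f x := by
    rw [specializes_iff_mem_closure, hgen]
    exact mem_irreducibleComponent
  obtain ⟨y, hy⟩ := hspec.mem_open hf.isOpen_range ⟨x, rfl⟩
  rw [← hy, hf.isInducing.specializes_iff, ← PrimeSpectrum.le_iff_specializes] at hspec
  have hyx : y = x := le_antisymm hspec (hq.2 ⟨y.2, bot_le⟩ hspec)
  have hZ : irreducibleComponent (f x) = {f x} := by
    rw [← hgen, ← hy, hyx, hclosed.closure_eq]
  have hdim := hX _ (irreducibleComponent_mem_irreducibleComponents (f x))
  have : Subsingleton (irreducibleComponent (f x)) := by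
    rw [hZ]; exact Set.subsingleton_singleton.coe_sort
  have h0 := topologicalKrullDim_zero_of_discreteTopology (irreducibleComponent (f x))
  rw [hdim] at h0
  exact absurd h0 (by norm_num)

/-- For a minimal prime `q` below `p`, the spectrum of `R ⧸ q` embeds in an irreducible component,
so `R ⧸ q` has dimension at most one. -/
theorem mem_minimalPrimes_or_isMaximal_of_isInducing
    (hX : ∀ Z ∈ irreducibleComponents X, topologicalKrullDim Z = 1)
    (hf : Topology.IsInducing f) {p : Ideal R} (hp : p.IsPrime) :
    p ∈ minimalPrimes R ∨ p.IsMaximal := by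
  have := hp
  obtain ⟨q, hq, hqp⟩ := Ideal.exists_minimalPrimes_le (I := ⊥) (J := p) bot_le
  have hqq : q.IsPrime := hq.1.1
  rcases eq_or_ne q p with rfl | hne
  · exact Or.inl hq
  right
  let x : PrimeSpectrum R := ⟨q, hqq⟩
  let g : PrimeSpectrum (R ⧸ q) → X := f ∘ PrimeSpectrum.comap (Ideal.Quotient.mk q)
  have hg : Topology.IsInducing g := hf.comp
    (PrimeSpectrum.isClosedEmbedding_comap_of_surjective _ _ Ideal.Quotient.mk_surjective).isInducing
  have hgZ : ∀ y, g y ∈ irreducibleComponent (f x) := fun y => by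
    have h1 : f x ⤳ f (PrimeSpectrum.comap (Ideal.Quotient.mk q) y) := by
      rw [hf.specializes_iff, ← PrimeSpectrum.le_iff_specializes]
      intro r hr
      change Ideal.Quotient.mk q r ∈ y.asIdeal
      rw [Ideal.Quotient.eq_zero_iff_mem.2 hr]
      exact zero_mem _
    exact h1.mem_closed isClosed_irreducibleComponent mem_irreducibleComponent
  have hdim := (hg.codRestrict hgZ).topologicalKrullDim_le
  rw [hX _ (irreducibleComponent_mem_irreducibleComponents (f x)),
    PrimeSpectrum.topologicalKrullDim_eq_ringKrullDim] at hdim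
  have : Ring.KrullDimLE 1 (R ⧸ q) := Ring.krullDimLE_iff.2 hdim
  have hmap : (p.map (Ideal.Quotient.mk q)).IsPrime :=
    Ideal.map_isPrime_of_surjective Ideal.Quotient.mk_surjective (by rwa [Ideal.mk_ker])
  have hbot : p.map (Ideal.Quotient.mk q) ≠ ⊥ := by
    rw [Ne, Ideal.map_eq_bot_iff_le_ker, Ideal.mk_ker]
    exact fun h => hne (le_antisymm hqp h)
  have hmax := hmap.isMaximal_of_ne_bot hbot
  have hcomap := Ideal.comap_isMaximal_of_surjective (Ideal.Quotient.mk q)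
    Ideal.Quotient.mk_surjective (K := p.map (Ideal.Quotient.mk q))
  rwa [Ideal.comap_map_of_surjective _ Ideal.Quotient.mk_surjective, ← RingHom.ker_eq_comap_bot,
    Ideal.mk_ker, sup_eq_left.2 hqp] at hcomap

end Equidimensional

/-! ### Passage to the whole curve. -/

section Scheme

variable {k : Type u} [Field k] {X : Scheme.{u}} {p : X ⟶ Spec (CommRingCat.of k)}

theorem IsAlgebraicCurve.isCurveRing (hX : IsAlgebraicCurve p) (U : X.affineOpens) :
    @IsCurveRing k Γ(X, U) _ _ (structureMap p U).toAlgebra := by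
  let : Algebra k Γ(X, U) := (structureMap p U).toAlgebra
  have := hX.isReduced
  have := hX.locallyOfFiniteType
  have := hX.quasiCompact
  have : JacobsonSpace X := LocallyOfFiniteType.jacobsonSpace p
  have hU : IsAffineOpen U.1 := U.2
  have := hU.isOpenImmersion_fromSpec
  have hf : Topology.IsOpenEmbedding (hU.fromSpec : PrimeSpectrum Γ(X, U) → X) :=
    hU.fromSpec.isOpenEmbedding
  refine ⟨?_, inferInstance, fun q hq =>
    not_isMaximal_of_mem_minimalPrimes_of_isOpenEmbedding hX.equidimensional hf hq,
    fun q hq => mem_minimalPrimes_or_isMaximal_of_isInducing hX.equidimensional hf.isInducing hq⟩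
  change (structureMap p U).FiniteType
  unfold structureMap
  rw [CommRingCat.hom_comp]
  exact (p.finiteType_appLE (isAffineOpen_top _) U.2 le_top).comp
    (RingHom.FiniteType.of_surjective _
      (ConcreteCategory.bijective_of_isIso (Scheme.ΓSpecIso (CommRingCat.of k)).inv).2)

theorem structureMap_basicOpen (U : X.affineOpens) (f : Γ(X, U)) :
    structureMap p (X.affineBasicOpen f) =
      (algebraMap Γ(X, U) Γ(X, X.basicOpen f)).comp (structureMap p U) := by
  rw [RingHom.algebraMap_toAlgebra]
  unfold structureMap
  rw [← CommRingCat.hom_comp, Category.assoc]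
  exact congrArg (fun g => ((Scheme.ΓSpecIso (CommRingCat.of k)).inv ≫ g).hom)
    (Scheme.Hom.appLE_map p (U := ⊤) le_top (homOfLE (X.basicOpen_le f)).op).symm

variable [IsAlgClosed k]

/-- The ideal sheaf `b` with `a = Î(b ^ (1 / N))`. -/
noncomputable def rootIdealSheaf (hX : IsAlgebraicCurve p) (a : X.IdealSheafData) (N : ℕ) :
    X.IdealSheafData where
  ideal U := rootIdeal (structureMap p U) (a.ideal U) N
  map_ideal_basicOpen U f := by
    have := U.2.isLocalization_basicOpen f
    rw [← a.map_ideal_basicOpen, structureMap_basicOpen]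
    exact map_rootIdeal (hX.isCurveRing U) (Submonoid.powers f) (a.ideal U) N

theorem IsAlgebraicCurve.exists_smul_mem_conductorIdeal (hX : IsAlgebraicCurve p)
    {U : X.affineOpens} (f : Γ(X, U)) {N : ℕ}
    (hN : (conductorIdeal Γ(X, X.basicOpen f) (NormalizationRing Γ(X, X.basicOpen f))).radical ^ N ≤
      conductorIdeal Γ(X, X.basicOpen f) (NormalizationRing Γ(X, X.basicOpen f)))
    {x : NormalizationRing Γ(X, U)}
    (hx : x ∈ (conductorIdeal Γ(X, U) (NormalizationRing Γ(X, U))).radical ^ N) :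
    ∃ m ∈ Submonoid.powers f, m • x ∈ conductorIdeal Γ(X, U) (NormalizationRing Γ(X, U)) :=
  have := U.2.isLocalization_basicOpen f
  exists_smul_mem_conductorIdeal_of_isLocalization (hX.isCurveRing U) (Submonoid.powers f) hN hx

theorem IsAlgebraicCurve.exists_forall_ordAt_conductorIdeal_lt (hX : IsAlgebraicCurve p) :
    ∃ N : ℕ, ∀ (U : X.affineOpens) P,
      ordAt P (conductorIdeal Γ(X, U) (NormalizationRing Γ(X, U))) < N := by
  have := hX.quasiCompact
  have : CompactSpace X := QuasiCompact.compactSpace_of_compactSpace p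
  have key : ∃ N : ℕ, ∀ U : X.affineOpens,
      (conductorIdeal Γ(X, U) (NormalizationRing Γ(X, U))).radical ^ N ≤
        conductorIdeal Γ(X, U) (NormalizationRing Γ(X, U)) := by
    choose n hn using fun U => exists_radical_conductorIdeal_pow_le (hX.isCurveRing U)
    -- Quasi-compactness provides one exponent for a finite cover; locality of the condition carries
    -- it to every affine open.
    let V := X.affineCover.finiteSubcover
    let W : V.I₀ → X.affineOpens := fun i => ⟨(V.f i).opensRange, isAffineOpen_opensRange _⟩
    obtain ⟨N, hN⟩ : ∃ N, ∀ i, n (W i) ≤ N :=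
      ⟨Finset.univ.sup (n ∘ W), fun i => Finset.le_sup (f := n ∘ W) (Finset.mem_univ i)⟩
    refine ⟨N, fun U => ?_⟩
    refine of_affine_open_cover (P := fun U =>
      (conductorIdeal Γ(X, U) (NormalizationRing Γ(X, U))).radical ^ N ≤
        conductorIdeal Γ(X, U) (NormalizationRing Γ(X, U))) W ?_ U ?_ ?_ ?_
    · exact V.iSup_opensRange
    · intro U f hU
      have := U.2.isLocalization_basicOpen f
      exact radical_conductorIdeal_pow_le_of_isLocalization (R' := Γ(X, X.basicOpen f))
        (hX.isCurveRing U) (Submonoid.powers f) hU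
    · intro U s hs hU x hx
      refine Submodule.mem_of_span_eq_top_of_smul_pow_mem
        ((conductorIdeal Γ(X, U) (NormalizationRing Γ(X, U))).restrictScalars Γ(X, U)) _ hs x ?_
      rintro ⟨f, hf⟩
      let g : Γ(X, U) := f
      have := U.2.isLocalization_basicOpen g
      have h1 : ∃ m ∈ Submonoid.powers g,
          m • x ∈ conductorIdeal Γ(X, U) (NormalizationRing Γ(X, U)) :=
        hX.exists_smul_mem_conductorIdeal g (hU ⟨f, hf⟩) hx
      obtain ⟨_, ⟨m, rfl⟩, hm⟩ := h1
      exact ⟨m, hm⟩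
    · intro i
      exact (Ideal.pow_le_pow_right (hN i)).trans (hn (W i))
  obtain ⟨N, hN⟩ := key
  -- The orders are at most `N`, while the rounding argument needs a strict bound.
  refine ⟨N + 1, fun U P => ?_⟩
  have h := hX.isCurveRing U
  let : Algebra k Γ(X, U) := (structureMap p U).toAlgebra
  have := h.finite_normalization
  obtain ⟨c, hc, hc0⟩ := exists_mem_conductorIdeal_mem_nonZeroDivisors
    (IsCurveRing.exists_mul_eq_algebraMap_normalization (R := Γ(X, U)))
  refine (h.isNormalCurveRing.ordAt_le_of_radical_pow_le (hN U)
    (h.isNormalCurveRing.ordAt_ne_top_of_mem hc hc0 P)).trans_lt ?_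
  exact_mod_cast Nat.lt_succ_self N

theorem IsMJMultiplierOf.isIntegrallyClosedSheaf (hX : IsAlgebraicCurve p)
    {a b : X.IdealSheafData} {t : ℝ≥0} (h : IsMJMultiplierOf p a b t) :
    IsIntegrallyClosedSheaf a := fun U =>
  isIntegrallyClosedIdeal_of_eq_mjMultiplier (hX.isCurveRing U) (h U)

theorem IsMJMultiplierOf.leMJMultiplierOfUnit (hX : IsAlgebraicCurve p)
    {a b : X.IdealSheafData} {t : ℝ≥0} (h : IsMJMultiplierOf p a b t) :
    LeMJMultiplierOfUnit p a := fun U => by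
  rw [h U]
  exact mjMultiplier_le_mjMultiplier_top_one (hX.isCurveRing U) _ _

theorem IsIntegrallyClosedSheaf.exists_isMJMultiplierOf (hX : IsAlgebraicCurve p)
    {a : X.IdealSheafData} (ha : IsIntegrallyClosedSheaf a) (hle : LeMJMultiplierOfUnit p a) :
    ∃ (b : X.IdealSheafData) (t : ℝ≥0), (IsNowhereZero a → IsNowhereZero b) ∧
      IsMJMultiplierOf p a b t := by
  obtain ⟨N, hN⟩ := hX.exists_forall_ordAt_conductorIdeal_lt
  exact ⟨rootIdealSheaf hX a N, (N : ℝ≥0)⁻¹,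
    fun h U => exists_mem_rootIdeal_mem_nonZeroDivisors (hX.isCurveRing U) (h U) N,
    fun U => coeSubmodule_eq_mjMultiplier_rootIdeal (hX.isCurveRing U) (ha U) (hle U) (hN U)⟩

end Scheme

end MatherJacobian

theorem theoremp {k : Type u} [Field k] [IsAlgClosed k] {X : Scheme.{u}}
    (p : X ⟶ Spec (CommRingCat.of k)) (hX : MatherJacobian.IsAlgebraicCurve p)
    (a : X.IdealSheafData) :
    ((∃ (b : X.IdealSheafData) (t : ℝ≥0), MatherJacobian.IsMJMultiplierOf p a b t) ↔
      (MatherJacobian.IsIntegrallyClosedSheaf a ∧ MatherJacobian.LeMJMultiplierOfUnit p a)) ∧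
    (MatherJacobian.IsNowhereZero a →
      ((∃ (b : X.IdealSheafData) (t : ℝ≥0), MatherJacobian.IsNowhereZero b ∧
          MatherJacobian.IsMJMultiplierOf p a b t) ↔
        (MatherJacobian.IsIntegrallyClosedSheaf a ∧
          MatherJacobian.LeMJMultiplierOfUnit p a))) := by
  refine ⟨⟨?_, ?_⟩, fun ha0 => ⟨?_, ?_⟩⟩
  · rintro ⟨b, t, h⟩
    exact ⟨h.isIntegrallyClosedSheaf hX, h.leMJMultiplierOfUnit hX⟩
  · rintro ⟨ha, hle⟩
    obtain ⟨b, t, -, h⟩ := ha.exists_isMJMultiplierOf hX hle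
    exact ⟨b, t, h⟩
  · rintro ⟨b, t, -, h⟩
    exact ⟨h.isIntegrallyClosedSheaf hX, h.leMJMultiplierOfUnit hX⟩
  · rintro ⟨ha, hle⟩
    obtain ⟨b, t, hb, h⟩ := ha.exists_isMJMultiplierOf hX hle
    exact ⟨b, t, hb ha0, h⟩
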